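/- **Theorem 2 (asymptotic validity of the MCLR test).** Fix integers and parameters not depending on $n$: $l\ge 1$, $\beta,\beta_0\in\mathbb R^l$, a positive definite $(l+1)\times(l+1)$ matrix $\Omega$, and a nominal level $a\in(0,1)$. For each sample size $n$ let $Z$ be a non-random $n\times k$ matrix, $k=k_n$, with $k\ge1$ and full column rank for all large $n$, let $\Pi_2$ be a $k\times l$ matrix (both may depend on $n$), and $$y_1=Y_2\beta+u,\qquad Y_2=Z\Pi_2+V_2 ,$$ with $y_1,u$ random $n$-vectors and $Y_2,V_2$ random $n\times l$ matrices. Put $Y=(y_1,Y_2)$, $V=(V_2\beta+u,\,V_2)$, $\Pi=(\Pi_2\beta,\Pi_2)$, so $Y=Z\Pi+V$. Let $P_Z=Z(Z'Z)^{-1}Z'$, $M_Z=I_n-P_Z$, $b_0=(1,-\beta_0')'$, $A_0=(\beta_0,I_l)'$, $\hat\Omega=\frac1{n-k}Y'M_ZY$, $$\frac{LR_1}{n-k}=\frac{b_0'Y'P_ZYb_0}{b_0'Y'M_ZYb_0}-\hat\lambda,\qquad \hat T=(Z'Z)^{-1/2}Z'Y\hat\Omega^{-1}A_0\,(A_0'\hat\Omega^{-1}A_0)^{-1/2},$$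 where $\hat\lambda$ is the smallest eigenvalue of $\frac1{n-k}\hat\Omega^{-1/2}Y'P_ZY\hat\Omega^{-1/2}$. For a $k\times l$ matrix $t$ let $c_{1,a}(t)$ be the $(1-a)$-th quantile of $$\frac{\mathcal S'\mathcal S}{\mathcal W_{11}}-\min\Big\{\lambda:\ \det\big((\mathcal S,t)'(\mathcal S,t)-\lambda\,\mathcal W\big)=0\Big\},$$ where $\mathcal S\sim N(0,I_k)$ and the $(l+1)\times(l+1)$ matrix $\mathcal W\sim \mathrm{Wishart}(n-k,I_{l+1})$ (central) are independent and $\mathcal W_{11}$ is the upper left entry of $\mathcal W$. Assume: 1. the rows of $V$ are i.i.d. $N(0,\Omega)$ for every $n$; 2. either (a) $k/n\to\kappa$ for some $\kappa\in[0,1)$ and the concentration parameter $$\mu^2=(A_0'\Omega^{-1}A_0)^{-1/2}A_0'\Omega^{-1}\Pi'Z'Z\Pi\Omega^{-1}A_0(A_0'\Omega^{-1}A_0)^{-1/2}$$ satisfies $\mu^2/\sqrt k\to\infty$ (for $l>1$, where $\mu^2$ is a matrix: its smallest eigenvalue divided by $\sqrt k$ tends to $\infty$), or (b) $k/n\to0$,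 with no condition on $\mu^2$. Then, under the null hypothesis $H_0:\beta=\beta_0$, the feasible MCLR test, which rejects when $LR_1/(n-k)\ge c_{1,a}(\hat T)$, is asymptotically valid, that is, its rejection probability converges to the nominal level: $$\Pr\Big\{\frac{LR_1}{n-k}\ge c_{1,a}(\hat T)\Big\}\to a\qquad\text{as } n\to\infty .$$ -/

import Mathlib

open MeasureTheory ProbabilityTheory Filter Topology Matrix

noncomputable section

namespace MCLR

section Algebra

/-- The matrix `(y, X)` obtained by putting the column `y` in front of the columns of `X`. -/
def cols {m l : ℕ} (y : Fin m → ℝ) (X : Matrix (Fin m) (Fin l) ℝ) :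
    Matrix (Fin m) (Fin (l + 1)) ℝ :=
  Matrix.of fun i => Matrix.vecCons (y i) (X i)

/-- The vector `b₀ = (1, -β₀')'`. -/
def bVec {l : ℕ} (β₀ : Fin l → ℝ) : Fin (l + 1) → ℝ :=
  Matrix.vecCons 1 (-β₀)

/-- The `(l + 1) × l` matrix `A₀ = (β₀, I_l)'`, whose first row is `β₀'`. -/
def aMat {l : ℕ} (β₀ : Fin l → ℝ) : Matrix (Fin (l + 1)) (Fin l) ℝ :=
  Matrix.of (Matrix.vecCons β₀ fun i => (1 : Matrix (Fin l) (Fin l) ℝ) i)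

open scoped MatrixOrder in
/-- The inverse `A^{-1/2}` of the positive semidefinite square root of `A`. -/
def invSqrt {p : ℕ} (A : Matrix (Fin p) (Fin p) ℝ) : Matrix (Fin p) (Fin p) ℝ :=
  (CFC.sqrt A)⁻¹

/-- The smallest eigenvalue of a real symmetric matrix. -/
def minEig {p : ℕ} (A : Matrix (Fin p) (Fin p) ℝ) : ℝ :=
  sInf (spectrum ℝ A)

/-- The projection matrix `P_Z = Z (Z'Z)⁻¹ Z'`. -/
def projMat {n k : ℕ} (Z : Matrix (Fin n) (Fin k) ℝ) : Matrix (Fin n) (Fin n) ℝ :=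
  Z * (Zᵀ * Z)⁻¹ * Zᵀ

/-- The residual maker `M_Z = I_n - P_Z`. -/
def residMat {n k : ℕ} (Z : Matrix (Fin n) (Fin k) ℝ) : Matrix (Fin n) (Fin n) ℝ :=
  1 - projMat Z

end Algebra

section Statistics

variable {n k l : ℕ}

/-- The variance estimator `Ω̂ = (n - k)⁻¹ Y' M_Z Y`. -/
def omegaHat (Z : Matrix (Fin n) (Fin k) ℝ) (Y : Matrix (Fin n) (Fin (l + 1)) ℝ) :
    Matrix (Fin (l + 1)) (Fin (l + 1)) ℝ :=
  ((n : ℝ) - (k : ℝ))⁻¹ • (Yᵀ * residMat Z * Y)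

/-- `λ̂`, the smallest eigenvalue of `(n - k)⁻¹ Ω̂^{-1/2} Y' P_Z Y Ω̂^{-1/2}`. -/
def lambdaHat (Z : Matrix (Fin n) (Fin k) ℝ) (Y : Matrix (Fin n) (Fin (l + 1)) ℝ) : ℝ :=
  minEig (((n : ℝ) - (k : ℝ))⁻¹ •
    (invSqrt (omegaHat Z Y) * (Yᵀ * projMat Z * Y) * invSqrt (omegaHat Z Y)))

/-- The likelihood ratio statistic `LR₁` with unknown error variance:
`LR₁ / (n - k) = (b₀' Y' P_Z Y b₀) / (b₀' Y' M_Z Y b₀) - λ̂`. -/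
def LR1 (β₀ : Fin l → ℝ) (Z : Matrix (Fin n) (Fin k) ℝ)
    (Y : Matrix (Fin n) (Fin (l + 1)) ℝ) : ℝ :=
  ((n : ℝ) - (k : ℝ)) *
    ((bVec β₀ ⬝ᵥ ((Yᵀ * projMat Z * Y) *ᵥ bVec β₀)) /
      (bVec β₀ ⬝ᵥ ((Yᵀ * residMat Z * Y) *ᵥ bVec β₀)) - lambdaHat Z Y)

/-- `T̂ = (Z'Z)^{-1/2} Z' Y Ω̂⁻¹ A₀ (A₀' Ω̂⁻¹ A₀)^{-1/2}`. -/
def tHat (β₀ : Fin l → ℝ) (Z : Matrix (Fin n) (Fin k) ℝ)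
    (Y : Matrix (Fin n) (Fin (l + 1)) ℝ) : Matrix (Fin k) (Fin l) ℝ :=
  invSqrt (Zᵀ * Z) * Zᵀ * Y * (omegaHat Z Y)⁻¹ * aMat β₀ *
    invSqrt ((aMat β₀)ᵀ * (omegaHat Z Y)⁻¹ * aMat β₀)

/-- The concentration matrix
`μ² = (A₀'Ω⁻¹A₀)^{-1/2} A₀'Ω⁻¹ Π'Z'ZΠ Ω⁻¹A₀ (A₀'Ω⁻¹A₀)^{-1/2}`. -/
def concMat (β₀ : Fin l → ℝ) (Ω : Matrix (Fin (l + 1)) (Fin (l + 1)) ℝ)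
    (Z : Matrix (Fin n) (Fin k) ℝ) (Pi : Matrix (Fin k) (Fin (l + 1)) ℝ) :
    Matrix (Fin l) (Fin l) ℝ :=
  invSqrt ((aMat β₀)ᵀ * Ω⁻¹ * aMat β₀) *
    ((aMat β₀)ᵀ * Ω⁻¹ * Piᵀ * Zᵀ * Z * Pi * Ω⁻¹ * aMat β₀) *
    invSqrt ((aMat β₀)ᵀ * Ω⁻¹ * aMat β₀)

end Statistics

section CriticalValue

/-- The central Wishart distribution with `m` degrees of freedom and scale matrix `I_p`: the law of
`G'G`, where the entries of the `m × p` matrix `G` are independent standard normal. -/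
def wishart (m p : ℕ) : Measure (Fin p → Fin p → ℝ) :=
  (Measure.pi fun _ : Fin m => Measure.pi fun _ : Fin p => gaussianReal 0 1).map
    fun G i j => ∑ r, G r i * G r j

/-- The function expressing `LR₁ / (n - k)` through the `(l + 1) × (l + 1)` matrices
`D = (S̄, T̄)'(S̄, T̄)` and `W = (S̃, T̃)'(S̃, T̃)`, that is, through the six blocks
`S̄'S̄, S̄'T̄, T̄'T̄, S̃'S̃, S̃'T̃, T̃'T̃`: the ratio of the upper left entries minus
the smallest root `λ` of `det (D - λ W) = 0`. -/
def psi1 {l : ℕ} (D W : Matrix (Fin (l + 1)) (Fin (l + 1)) ℝ) : ℝ :=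
  D 0 0 / W 0 0 - sInf {x : ℝ | (D - x • W).det = 0}

/-- The `q`-th quantile of the real random variable `f` under `μ`. -/
def quantile {X : Type*} [MeasurableSpace X] (μ : Measure X) (f : X → ℝ) (q : ℝ) : ℝ :=
  sInf {c : ℝ | q ≤ μ.real {x | f x ≤ c}}

/-- The critical value function `c_{1,a}(t)`: the `(1 - a)`-th quantile of
`ψ₁(S'S, S't, t't, W₁, W₂, W₃)` for independent `S ∼ N(0, I_k)` and
`W ∼ Wishart(n - k, I_{l+1})`. -/
def critVal (n k : ℕ) {l : ℕ} (a : ℝ) (t : Matrix (Fin k) (Fin l) ℝ) : ℝ :=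
  quantile
    ((Measure.pi fun _ : Fin k => gaussianReal 0 1).prod (wishart (n - k) (l + 1)))
    (fun x => psi1 ((cols x.1 t)ᵀ * cols x.1 t) (Matrix.of x.2))
    (1 - a)

end CriticalValue

section Assumptions

/-- The rows of the random matrix `V` are independent and identically `N(0, Ω)` distributed. -/
def NormalRows {E : Type*} [MeasurableSpace E] (P : Measure E) {n p : ℕ}
    (V : E → Matrix (Fin n) (Fin p) ℝ) (Ω : Matrix (Fin p) (Fin p) ℝ) : Prop :=
  iIndepFun (fun (i : Fin n) (ω : E) => WithLp.toLp 2 (V ω i)) P ∧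
    ∀ i : Fin n, HasLaw (fun ω => WithLp.toLp 2 (V ω i)) (multivariateGaussian 0 Ω) P

/-- Many weak instruments: either (a) `k/n` tends to a limit in `[0, 1)` and `μ²/√k → ∞`
(for a matrix `μ²`, its smallest eigenvalue is meant), or (b) `k/n → 0`. -/
def ManyWeakInstruments {l : ℕ} (k : ℕ → ℕ) (μsq : ℕ → Matrix (Fin l) (Fin l) ℝ) : Prop :=
  ((∃ κ : ℝ, 0 ≤ κ ∧ κ < 1 ∧ Tendsto (fun n => (k n : ℝ) / (n : ℝ)) atTop (𝓝 κ)) ∧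
      Tendsto (fun n => minEig (μsq n) / √(k n : ℝ)) atTop atTop) ∨
    Tendsto (fun n => (k n : ℝ) / (n : ℝ)) atTop (𝓝 0)

end Assumptions

end MCLR

end

/-!
**Reduction.** Let `m = n - k`. The rows of `C = (Z'Z)^{-1/2} Z'` and of a complementary `N` form an
orthonormal basis of the sample space (`exists_rotation`), and a coordinate change `J` standardizes
the errors (`exists_standardization`). In these coordinates `LR₁ / (n - k)` equals `lr S T γ Γ`,
where `(S, T)` are the columns of `C Y J` and `(γ, Γ)` those of `N Y J` (`LR1_div_eq_lr`). Under the
null hypothesis `S`, `γ`, `Γ` and the noise in `T` are independent standard normal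
(`NormalRows.hasLaw_data`), only `T` has a mean `M`, and `M'M` is the concentration matrix
(`gram_mean_eq_concMat`). If the critical value were computed at `T`, then the conditional rejection
probability given `T` would be `a`. The feasible test uses `T̂ = T H + S g'` instead, where `H - 1`
and `g` are of order `1 / √m`: the weight matrix in `T̂` is a
Lipschitz function of `Ω̂` (`exists_weight_lipschitz`, `tHat_eq`, `rel_of_weight`). This
perturbation is the relation `Rel`.

**Stability of the law.** The law of `t ↦ lr S t γ Γ` changes little under such perturbations of
`t`. This is shown without densities or limit laws of the statistic. A statement `y < lr S t γ Γ` is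
witnessed by a single direction, and `dominate` shows that a witness for the column matrix `t₂` also
witnesses the same bound for `t₁`, provided that `S` (and `γ`) are enlarged slightly. With few
instruments, where `k / m` is small, `S` is scaled by `1 + ε / √k` (`lt_lr_smul`); with strong
instruments, where `k / m` is bounded and `t't` exceeds `k` by a large multiple of `√k`, `S` is
stretched along the span of `t` and `γ` along the span of `Γ` by `1 + ε` (`lt_lr_stretch`). Either
operation changes a standard normal law by little in total variation, in the second case because the
stretched subspaces have dimension at most `l` (`stdGaussian_smul_le`, `stdGaussian_stretch_le`).
The comparison needs `y ≥ c / m`; smaller thresholds are harmless by the small-ball estimate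
`exists_smallBall`. The outcome is a domination of the law at `t₂` by the law at `t₁`
(`exists_domination_of_small`, `exists_domination_of_strong`), and `Rel.symm` gives the converse.

**Conclusion.** Hence the feasible critical value is nearly a `1 - a` quantile of the statistic
given `T`, in the sense of `Acceptable`. The critical value depends on all of the data, but whether
the statistic reaches it can be bracketed by two p-values of the statistic given `T`; as these are
stochastically larger than uniform variables, the rejection probability is near `a`
(`abs_rejection_sub_le`, `exists_rejection_bound`). With few instruments this applies to every `T`.
With many instruments the growth of the smallest eigenvalue of `M'M` relative to `√k` makes `T = M +
noise` strong with high probability (`exists_strong_bound`).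
-/

namespace MCLR

open scoped RealInnerProductSpace NNReal ENNReal

/-! ### Total variation cost of rescaling independent normal variables -/

section Scaling

/-- The density of `d X` with respect to the law of `X`, for `X` standard normal on the line. -/
noncomputable def scaleDensity (d x : ℝ) : ℝ := d⁻¹ * Real.exp (-(x ^ 2 / 2) * (d⁻¹ ^ 2 - 1))

lemma scaleDensity_pos {d : ℝ} (hd : 0 < d) (x : ℝ) : 0 < scaleDensity d x := by
  unfold scaleDensity; positivity

@[fun_prop]
lemma measurable_scaleDensity (d : ℝ) : Measurable (scaleDensity d) := by
  unfold scaleDensity; fun_prop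

lemma mk_sq_ne_zero {d : ℝ} (hd : 0 < d) : NNReal.mk (d ^ 2) (sq_nonneg d) ≠ 0 := fun h ↦ by
  have h' : d ^ 2 = 0 := congrArg NNReal.toReal h
  exact hd.ne' (by simpa using h')

lemma gaussianPDFReal_std (x : ℝ) :
    gaussianPDFReal 0 1 x = (√(2 * Real.pi))⁻¹ * Real.exp (-(x ^ 2 / 2)) := by
  simp [gaussianPDFReal, neg_div]

lemma gaussianPDFReal_mul_scaleDensity {d : ℝ} (hd : 0 < d) (x : ℝ) :
    gaussianPDFReal 0 1 x * scaleDensity d x = gaussianPDFReal 0 (NNReal.mk (d ^ 2) (sq_nonneg d)) x := by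
  rw [gaussianPDFReal_std]
  simp only [scaleDensity, gaussianPDFReal]
  have h : √(2 * Real.pi * d ^ 2) = √(2 * Real.pi) * d := by
    rw [Real.sqrt_mul (by positivity), Real.sqrt_sq hd.le]
  simp only [NNReal.coe_mk, h, sub_zero]
  rw [mul_inv, mul_mul_mul_comm, mul_comm (Real.exp _), mul_assoc, mul_assoc, ← Real.exp_add,
    mul_right_inj' (by positivity), mul_right_inj' (by positivity)]
  congr 1
  field_simp
  ring

lemma map_const_mul_gaussianReal {d : ℝ} (hd : 0 < d) :
    (gaussianReal 0 1).map (d * ·) =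
      (gaussianReal 0 1).withDensity fun x ↦ ENNReal.ofReal (scaleDensity d x) := by
  have hv := mk_sq_ne_zero hd
  rw [gaussianReal_map_const_mul, mul_zero, mul_one, gaussianReal_of_var_ne_zero 0 hv,
    gaussianReal_of_var_ne_zero 0 one_ne_zero, ← withDensity_mul _ (by fun_prop) (by fun_prop)]
  congr 1
  ext x
  rw [Pi.mul_apply, gaussianPDF, gaussianPDF, ← ENNReal.ofReal_mul (gaussianPDFReal_nonneg _ _ _),
    gaussianPDFReal_mul_scaleDensity hd]

lemma integrable_scaleDensity {d : ℝ} (hd : 0 < d) :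
    Integrable (scaleDensity d) (gaussianReal 0 1) ∧
      ∫ x, scaleDensity d x ∂(gaussianReal 0 1) = 1 := by
  have hv := mk_sq_ne_zero hd
  constructor
  · rw [gaussianReal_of_var_ne_zero 0 one_ne_zero,
      integrable_withDensity_iff (measurable_gaussianPDF _ _) (by simp [gaussianPDF])]
    simp only [toReal_gaussianPDF]
    refine (integrable_gaussianPDFReal 0 (NNReal.mk (d ^ 2) (sq_nonneg d))).congr (.of_forall fun x ↦ ?_)
    simp only
    rw [← gaussianPDFReal_mul_scaleDensity hd, mul_comm]
  · rw [integral_gaussianReal_eq_integral_smul one_ne_zero]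
    simp only [smul_eq_mul, gaussianPDFReal_mul_scaleDensity hd]
    exact integral_gaussianPDFReal_eq_one 0 hv

lemma integrable_scaleDensity_sq {d : ℝ} (hd : 0 < d) (hd2 : d ^ 2 < 2) :
    Integrable (fun x ↦ scaleDensity d x ^ 2) (gaussianReal 0 1) ∧
      ∫ x, scaleDensity d x ^ 2 ∂(gaussianReal 0 1) = (√(1 - (d ^ 2 - 1) ^ 2))⁻¹ := by
  have h2 : 0 < 2 - d ^ 2 := by linarith
  set s : ℝ := d / √(2 - d ^ 2) with hs
  have hs0 : 0 < s := by positivity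
  have hs2 : s ^ 2 = d ^ 2 / (2 - d ^ 2) := by rw [hs, div_pow, Real.sq_sqrt h2.le]
  have hv := mk_sq_ne_zero hs0
  have key : ∀ x, gaussianPDFReal 0 1 x * scaleDensity d x ^ 2 =
      (√(1 - (d ^ 2 - 1) ^ 2))⁻¹ * gaussianPDFReal 0 (NNReal.mk (s ^ 2) (sq_nonneg s)) x := by
    intro x
    rw [← gaussianPDFReal_mul_scaleDensity hs0, scaleDensity, scaleDensity, mul_pow, ← Real.exp_nat_mul]
    have e1 : √(1 - (d ^ 2 - 1) ^ 2) = d * √(2 - d ^ 2) := by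
      rw [show 1 - (d ^ 2 - 1) ^ 2 = d ^ 2 * (2 - d ^ 2) by ring, Real.sqrt_mul (by positivity),
        Real.sqrt_sq hd.le]
    have e2 : (((2 : ℕ) : ℝ) * (-(x ^ 2 / 2) * (d⁻¹ ^ 2 - 1))) = -(x ^ 2 / 2) * (s⁻¹ ^ 2 - 1) := by
      rw [inv_pow s, hs2]; push_cast; field_simp; ring
    rw [e1, e2, hs]
    have := Real.sqrt_pos.2 h2
    field_simp
  constructor
  · rw [gaussianReal_of_var_ne_zero 0 one_ne_zero,
      integrable_withDensity_iff (measurable_gaussianPDF _ _) (by simp [gaussianPDF])]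
    simp only [toReal_gaussianPDF]
    refine ((integrable_gaussianPDFReal 0 (NNReal.mk (s ^ 2) (sq_nonneg s))).const_mul
      (√(1 - (d ^ 2 - 1) ^ 2))⁻¹).congr (.of_forall fun x ↦ ?_)
    simp only
    rw [← key, mul_comm]
  · rw [integral_gaussianReal_eq_integral_smul one_ne_zero]
    simp only [smul_eq_mul, key]
    rw [integral_const_mul, integral_gaussianPDFReal_eq_one 0 hv, mul_one]

lemma map_smul_pi_gaussianReal {r : ℕ} {d : ℝ} (hd : 0 < d) :
    (Measure.pi fun _ : Fin r ↦ gaussianReal 0 1).map (d • ·) =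
      (Measure.pi fun _ : Fin r ↦ gaussianReal 0 1).withDensity
        fun x ↦ ENNReal.ofReal (∏ i, scaleDensity d (x i)) := by
  have h1 : (Measure.pi fun _ : Fin r ↦ gaussianReal 0 1).map (d • ·) =
      Measure.pi fun _ : Fin r ↦ (gaussianReal 0 1).map (d * ·) := by
    have := Measure.pi_map_pi (μ := fun _ : Fin r ↦ gaussianReal 0 1)
      (f := fun _ x ↦ d * x) (hμ := fun i ↦ inferInstance) (fun i ↦ by fun_prop)
    rw [← this]
    rfl
  rw [h1]
  refine Measure.pi_eq fun s hs ↦ ?_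
  have hint : Integrable (fun x : Fin r → ℝ ↦ ∏ i, (s i).indicator (scaleDensity d) (x i))
      (Measure.pi fun _ : Fin r ↦ gaussianReal 0 1) :=
    Integrable.fintype_prod fun i ↦ (integrable_scaleDensity hd).1.indicator (hs i)
  rw [withDensity_apply _ (MeasurableSet.univ_pi hs), ← lintegral_indicator (MeasurableSet.univ_pi hs)]
  have h2 : ∀ x : Fin r → ℝ, (Set.univ.pi s).indicator
      (fun x ↦ ENNReal.ofReal (∏ i, scaleDensity d (x i))) x =
      ENNReal.ofReal (∏ i, (s i).indicator (scaleDensity d) (x i)) := by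
    intro x
    by_cases hx : x ∈ Set.univ.pi s
    · rw [Set.indicator_of_mem hx]
      congr 1
      refine Finset.prod_congr rfl fun i _ ↦ ?_
      rw [Set.indicator_of_mem (hx i (Set.mem_univ i))]
    · rw [Set.indicator_of_notMem hx]
      simp only [Set.mem_pi, Set.mem_univ, true_imp_iff, not_forall] at hx
      obtain ⟨i, hi⟩ := hx
      rw [Finset.prod_eq_zero (Finset.mem_univ i) (Set.indicator_of_notMem hi _), ENNReal.ofReal_zero]
  simp_rw [h2]
  rw [← ofReal_integral_eq_lintegral_ofReal hint (.of_forall fun x ↦ Finset.prod_nonneg fun i _ ↦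
    Set.indicator_nonneg (fun y _ ↦ (scaleDensity_pos hd y).le) _),
    integral_fintype_prod_eq_prod, ENNReal.ofReal_prod_of_nonneg
      (fun i _ ↦ integral_nonneg fun x ↦ Set.indicator_nonneg (fun y _ ↦ (scaleDensity_pos hd y).le) _)]
  refine Finset.prod_congr rfl fun i _ ↦ ?_
  rw [map_const_mul_gaussianReal hd, withDensity_apply _ (hs i), integral_indicator (hs i),
    ofReal_integral_eq_lintegral_ofReal (integrable_scaleDensity hd).1.integrableOn
      (.of_forall fun x ↦ (scaleDensity_pos hd x).le)]

/-- One-sided total variation bound between the laws of `d X` and `X`, for `X` standard normal in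
`r` dimensions. The second moment of the likelihood ratio is a power of the one-dimensional one, so
that `r (d² - 1)²` governs its variance; the bound follows by Cauchy–Schwarz. -/
lemma pi_gaussianReal_smul_le {r : ℕ} {d : ℝ} (hd : 0 < d)
    (hr : (r : ℝ) * (d ^ 2 - 1) ^ 2 ≤ 1 / 2) (hd2 : (d ^ 2 - 1) ^ 2 ≤ 1 / 2)
    {B : Set (Fin r → ℝ)} (hB : MeasurableSet B) :
    (Measure.pi fun _ : Fin r ↦ gaussianReal 0 1).real {x | d • x ∈ B} ≤
      (Measure.pi fun _ : Fin r ↦ gaussianReal 0 1).real B + √(2 * (r * (d ^ 2 - 1) ^ 2)) := by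
  set μ := Measure.pi fun _ : Fin r ↦ gaussianReal 0 1
  set f : (Fin r → ℝ) → ℝ := fun x ↦ ∏ i, scaleDensity d (x i) with hf
  have hd3 : d ^ 2 < 2 := by nlinarith
  have hf1 : Integrable f μ := Integrable.fintype_prod fun i ↦ (integrable_scaleDensity hd).1
  have hfi : ∫ x, f x ∂μ = 1 := by
    simp [hf, μ, integral_fintype_prod_eq_prod, (integrable_scaleDensity hd).2]
  have hff : (fun x ↦ f x ^ 2) = fun x : Fin r → ℝ ↦ ∏ i, scaleDensity d (x i) ^ 2 := by
    ext x; simp [hf, Finset.prod_pow]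
  have hf2 : Integrable (fun x ↦ f x ^ 2) μ := by
    rw [hff]; exact Integrable.fintype_prod (f := fun _ x ↦ scaleDensity d x ^ 2)
      fun i ↦ (integrable_scaleDensity_sq hd hd3).1
  have hf2i : ∫ x, f x ^ 2 ∂μ = ((√(1 - (d ^ 2 - 1) ^ 2))⁻¹) ^ r := by
    rw [hff, integral_fintype_prod_eq_prod (f := fun _ x ↦ scaleDensity d x ^ 2)]
    simp [(integrable_scaleDensity_sq hd hd3).2]
  have hfm : Measurable f := by
    refine Finset.measurable_prod _ fun i _ ↦ ?_
    exact (measurable_scaleDensity d).comp (measurable_pi_apply i)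
  have h1 : μ.real {x | d • x ∈ B} = ∫ x in B, f x ∂μ := by
    have e : μ {x | d • x ∈ B} = μ.map (d • ·) B := by
      rw [Measure.map_apply (by fun_prop) hB]; rfl
    rw [measureReal_def, e, map_smul_pi_gaussianReal hd, withDensity_apply _ hB,
      integral_eq_lintegral_of_nonneg_ae (.of_forall fun x ↦
        Finset.prod_nonneg fun i _ ↦ (scaleDensity_pos hd (x i)).le) hfm.aestronglyMeasurable]
  have h2 : μ.real B = ∫ x in B, (1 : ℝ) ∂μ := by simp
  have hg2 : Integrable (fun x ↦ (f x - 1) ^ 2) μ := by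
    have : (fun x ↦ (f x - 1) ^ 2) = fun x ↦ f x ^ 2 - 2 * f x + 1 := by ext; ring
    rw [this]; exact (hf2.sub (hf1.const_mul 2)).add (integrable_const 1)
  have hg2i : ∫ x, (f x - 1) ^ 2 ∂μ = ((√(1 - (d ^ 2 - 1) ^ 2))⁻¹) ^ r - 1 := by
    have : (fun x ↦ (f x - 1) ^ 2) = fun x ↦ f x ^ 2 - 2 * f x + 1 := by ext; ring
    rw [this, integral_add (f := fun x ↦ f x ^ 2 - 2 * f x) (hf2.sub (hf1.const_mul 2)) (integrable_const 1),
      integral_sub hf2 (hf1.const_mul 2), integral_const_mul, hfi, hf2i]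
    simp; ring
  have h3 : ∫ x in B, f x ∂μ - ∫ x in B, (1 : ℝ) ∂μ ≤ ∫ x, |f x - 1| ∂μ := by
    rw [← integral_sub hf1.integrableOn (integrable_const 1).integrableOn]
    calc ∫ x in B, (f x - 1) ∂μ ≤ ∫ x in B, |f x - 1| ∂μ :=
          integral_mono ((hf1.sub (integrable_const 1)).integrableOn)
            ((hf1.sub (integrable_const 1)).abs.integrableOn) fun x ↦ le_abs_self _
      _ ≤ _ := setIntegral_le_integral (hf1.sub (integrable_const 1)).abs
            (.of_forall fun x ↦ abs_nonneg _)
  have h4 : (∫ x, |f x - 1| ∂μ) ^ 2 ≤ ∫ x, (f x - 1) ^ 2 ∂μ := by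
    set c := ∫ x, |f x - 1| ∂μ
    have hi : Integrable (fun x ↦ |f x - 1|) μ := (hf1.sub (integrable_const 1)).abs
    have : 0 ≤ ∫ x, (|f x - 1| - c) ^ 2 ∂μ := integral_nonneg fun x ↦ sq_nonneg _
    have e : (fun x ↦ (|f x - 1| - c) ^ 2) = fun x ↦ (f x - 1) ^ 2 - 2 * c * |f x - 1| + c ^ 2 := by
      ext x; rw [← sq_abs (f x - 1)]; ring
    rw [e, integral_add (f := fun x ↦ (f x - 1) ^ 2 - 2 * c * |f x - 1|) (hg2.sub (hi.const_mul _))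
        (integrable_const _),
      integral_sub hg2 (hi.const_mul _), integral_const_mul] at this
    simp at this
    nlinarith
  have h5 : ((√(1 - (d ^ 2 - 1) ^ 2))⁻¹) ^ r - 1 ≤ 2 * (r * (d ^ 2 - 1) ^ 2) := by
    set s := (d ^ 2 - 1) ^ 2
    have hs0 : 0 ≤ s := sq_nonneg _
    have hb : 1 - r * s ≤ (1 - s) ^ r := by
      have := one_add_mul_le_pow (a := -s) (by linarith) r
      simpa [sub_eq_add_neg] using this
    have hsq : (1 - s) ^ r ≤ (√(1 - s)) ^ r :=
      pow_le_pow_left₀ (by linarith) (Real.le_sqrt_of_sq_le (by nlinarith)) r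
    rw [inv_pow]
    have hpos : 0 < (√(1 - s)) ^ r := by
      have := Real.sqrt_pos.2 (show 0 < 1 - s by linarith)
      positivity
    have : ((√(1 - s)) ^ r)⁻¹ ≤ 1 + 2 * (r * s) := by
      rw [inv_le_comm₀ hpos (by positivity)]
      refine le_trans ?_ (hb.trans hsq)
      rw [inv_le_iff_one_le_mul₀ (by positivity)]
      have : 0 ≤ (r : ℝ) * s := by positivity
      nlinarith
    linarith
  have h6 : ∫ x, |f x - 1| ∂μ ≤ √(2 * (r * (d ^ 2 - 1) ^ 2)) :=
    Real.le_sqrt_of_sq_le (by linarith)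
  linarith

end Scaling

/-! ### Standard normal vectors -/

section Gaussian

variable {E F G : Type*} [NormedAddCommGroup E] [InnerProductSpace ℝ E] [FiniteDimensional ℝ E]
  [MeasurableSpace E] [BorelSpace E]
  [NormedAddCommGroup F] [InnerProductSpace ℝ F] [FiniteDimensional ℝ F]
  [MeasurableSpace F] [BorelSpace F]
  [NormedAddCommGroup G] [InnerProductSpace ℝ G] [FiniteDimensional ℝ G]
  [MeasurableSpace G] [BorelSpace G]

lemma map_pi_stdGaussian {ι : Type*} [Fintype ι] :
    (Measure.pi fun _ : ι ↦ stdGaussian E).map (WithLp.toLp 2) =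
      stdGaussian (PiLp 2 fun _ : ι ↦ E) := by
  apply Measure.ext_of_charFun
  ext t
  rw [charFun_pi, charFun_stdGaussian, ← Complex.ofReal_pow ‖t‖, PiLp.norm_sq_eq_of_L2]
  simp_rw [charFun_stdGaussian]
  rw [← Complex.exp_sum]
  congr 1
  push_cast
  rw [← Finset.sum_div, Finset.sum_neg_distrib]

/-- If `A A* + B B* = 1`, then `A X + B Y` is standard normal for independent standard normal
vectors `X` and `Y`. -/
lemma map_add_prod_stdGaussian (A : E →L[ℝ] G) (B : F →L[ℝ] G)
    (h : ∀ y, ‖A.adjoint y‖ ^ 2 + ‖B.adjoint y‖ ^ 2 = ‖y‖ ^ 2) :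
    ((stdGaussian E).prod (stdGaussian F)).map (fun p ↦ A p.1 + B p.2) = stdGaussian G := by
  apply Measure.ext_of_charFun
  ext y
  rw [charFun_stdGaussian, charFun_apply, integral_map (by fun_prop) (by fun_prop)]
  have : ∀ p : E × F, Complex.exp (⟪A p.1 + B p.2, y⟫ * Complex.I) =
      Complex.exp (⟪p.1, A.adjoint y⟫ * Complex.I) * Complex.exp (⟪p.2, B.adjoint y⟫ * Complex.I) := by
    intro p
    rw [← Complex.exp_add, inner_add_left, ContinuousLinearMap.adjoint_inner_right,
      ContinuousLinearMap.adjoint_inner_right]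
    push_cast; ring_nf
  simp_rw [this]
  rw [integral_prod_mul (fun x : E ↦ Complex.exp (⟪x, A.adjoint y⟫ * Complex.I))
    (fun x : F ↦ Complex.exp (⟪x, B.adjoint y⟫ * Complex.I)), ← charFun_apply, ← charFun_apply,
    charFun_stdGaussian, charFun_stdGaussian, ← Complex.exp_add]
  congr 1
  have := congrArg (fun x : ℝ ↦ (x : ℂ)) (h y)
  push_cast at this
  rw [← this]; ring

lemma map_inner_stdGaussian (x : E) :
    (stdGaussian E).map (fun S ↦ ⟪S, x⟫) = gaussianReal 0 (NNReal.mk (‖x‖ ^ 2) (sq_nonneg _)) := by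
  apply Measure.ext_of_charFun
  ext t
  rw [charFun_gaussianReal, charFun_apply, integral_map (by fun_prop) (by fun_prop)]
  have : ∀ S : E, Complex.exp (⟪⟪S, x⟫, t⟫ * Complex.I) = Complex.exp (⟪S, t • x⟫ * Complex.I) := by
    intro S; simp [real_inner_smul_right, mul_comm]
  simp_rw [this]
  rw [← charFun_apply, charFun_stdGaussian, norm_smul]
  congr 1
  simp [mul_pow]
  rw [← Complex.ofReal_pow |t|, sq_abs]
  push_cast
  ring

lemma integral_inner_sq_stdGaussian (x : E) :
    Integrable (fun S ↦ ⟪S, x⟫ ^ 2) (stdGaussian E) ∧ ∫ S, ⟪S, x⟫ ^ 2 ∂(stdGaussian E) = ‖x‖ ^ 2 := by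
  have hm : AEMeasurable (fun S ↦ ⟪S, x⟫) (stdGaussian E) := by fun_prop
  have hv := variance_id_gaussianReal (μ := 0) (v := NNReal.mk (‖x‖ ^ 2) (sq_nonneg _))
  rw [variance_eq_integral aemeasurable_id] at hv
  simp only [id_eq, integral_id_gaussianReal, sub_zero, NNReal.coe_mk] at hv
  have hi : Integrable (fun y ↦ y ^ 2) (gaussianReal 0 (NNReal.mk (‖x‖ ^ 2) (sq_nonneg _))) :=
    (memLp_id_gaussianReal (2 : ℝ≥0)).integrable_sq
  rw [← map_inner_stdGaussian] at hi hv
  constructor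
  · exact (integrable_map_measure (by fun_prop) hm).1 hi
  · rw [integral_map hm (by fun_prop)] at hv
    exact hv

/-- The stretch `x ↦ x + e P_U x` of the space along the subspace `U`. -/
noncomputable def stretch (U : Submodule ℝ E) (e : ℝ) (x : E) : E := x + e • U.starProjection x

lemma measurable_stretch (U : Submodule ℝ E) (e : ℝ) : Measurable (stretch U e) := by
  unfold stretch; fun_prop

/-- The total variation cost of a scaling by `d = 1 + ε / √k` in dimension `k` is of order `ε`. -/
lemma stdGaussian_smul_le {d : ℝ} (hd : 0 < d)
    (hr : (Module.finrank ℝ E : ℝ) * (d ^ 2 - 1) ^ 2 ≤ 1 / 2) (hd2 : (d ^ 2 - 1) ^ 2 ≤ 1 / 2)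
    {B : Set E} (hB : MeasurableSet B) :
    (stdGaussian E).real {x | d • x ∈ B} ≤
      (stdGaussian E).real B + √(2 * (Module.finrank ℝ E * (d ^ 2 - 1) ^ 2)) := by
  have hf : Measurable fun x : Fin (Module.finrank ℝ E) → ℝ ↦ ∑ i, x i • stdOrthonormalBasis ℝ E i := by
    fun_prop
  have hB2 : MeasurableSet {x : E | d • x ∈ B} := (measurable_const_smul d) hB
  rw [stdGaussian, map_measureReal_apply hf hB, map_measureReal_apply hf hB2]
  refine le_trans (le_of_eq ?_) (pi_gaussianReal_smul_le hd hr hd2 (hf hB))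
  congr 1
  ext x
  simp [Finset.smul_sum, smul_smul]

lemma map_subspace_prod_stdGaussian (U : Submodule ℝ E) :
    ((stdGaussian U).prod (stdGaussian Uᗮ)).map (fun p ↦ (p.1 : E) + p.2) = stdGaussian E := by
  refine map_add_prod_stdGaussian U.subtypeL Uᗮ.subtypeL fun y ↦ ?_
  rw [Submodule.adjoint_subtypeL, Submodule.adjoint_subtypeL]
  exact (Submodule.norm_sq_eq_add_norm_sq_projection y U).symm

/-- The total variation cost of a stretch depends on the dimension of the stretched subspace only,
not on that of the ambient space. -/
lemma stdGaussian_stretch_le (U : Submodule ℝ E) {e : ℝ} (he : 0 ≤ e)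
    (hr : (Module.finrank ℝ U : ℝ) * ((1 + e) ^ 2 - 1) ^ 2 ≤ 1 / 2)
    (hd2 : ((1 + e) ^ 2 - 1) ^ 2 ≤ 1 / 2) {B : Set E} (hB : MeasurableSet B) :
    (stdGaussian E).real {x | stretch U e x ∈ B} ≤
      (stdGaussian E).real B + √(2 * (Module.finrank ℝ U * ((1 + e) ^ 2 - 1) ^ 2)) := by
  set δ := √(2 * (Module.finrank ℝ U * ((1 + e) ^ 2 - 1) ^ 2)) with hδ
  have hδ0 : 0 ≤ δ := Real.sqrt_nonneg _
  have hf : Measurable fun p : U × Uᗮ ↦ (p.1 : E) + p.2 := by fun_prop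
  have hB2 : MeasurableSet {x | stretch U e x ∈ B} := measurable_stretch U e hB
  rw [← map_subspace_prod_stdGaussian U, map_measureReal_apply hf hB2, map_measureReal_apply hf hB]
  have key : (((stdGaussian U).prod (stdGaussian Uᗮ)) ((fun p ↦ (p.1 : E) + p.2) ⁻¹' {x | stretch U e x ∈ B}))
      ≤ ((stdGaussian U).prod (stdGaussian Uᗮ)) ((fun p ↦ (p.1 : E) + p.2) ⁻¹' B) + ENNReal.ofReal δ := by
    rw [Measure.prod_apply_symm (hf hB2), Measure.prod_apply_symm (hf hB)]
    calc _ ≤ ∫⁻ y, (stdGaussian U ((fun x ↦ (x, y)) ⁻¹' ((fun p : U × Uᗮ ↦ (p.1 : E) + p.2) ⁻¹' B))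
            + ENNReal.ofReal δ) ∂(stdGaussian Uᗮ) := by
          refine lintegral_mono fun y ↦ ?_
          have hm : MeasurableSet ((fun x ↦ (x, y)) ⁻¹' ((fun p : U × Uᗮ ↦ (p.1 : E) + p.2) ⁻¹' B)) :=
            measurable_prodMk_right (hf hB)
          have h := stdGaussian_smul_le (E := U) (d := 1 + e) (by linarith) hr hd2 hm
          have h2 := ENNReal.ofReal_le_ofReal h
          rw [ENNReal.ofReal_add measureReal_nonneg hδ0, ofReal_measureReal, ofReal_measureReal] at h2
          refine le_trans (le_of_eq ?_) h2
          congr 1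
          ext x
          have e1 : U.starProjection ((x : E) + y) = x := by
            rw [map_add, Submodule.starProjection_eq_self_iff.2 x.2,
              (Submodule.starProjection_apply_eq_zero_iff U).2 y.2, add_zero]
          simp only [Set.mem_preimage, Set.mem_ofPred_eq, stretch, e1, Submodule.coe_smul]
          rw [add_smul, one_smul, add_right_comm]
      _ = _ := by
          rw [lintegral_add_right _ measurable_const]
          simp
  have h3 := ENNReal.toReal_mono (by finiteness) key
  rw [ENNReal.toReal_add (by finiteness) (by finiteness), ENNReal.toReal_ofReal hδ0] at h3
  exact h3

end Gaussian

/-! ### Concentration of quadratic and bilinear forms -/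

section Moments

variable {E F : Type*} [NormedAddCommGroup E] [InnerProductSpace ℝ E] [FiniteDimensional ℝ E]
  [MeasurableSpace E] [BorelSpace E]
  [NormedAddCommGroup F] [InnerProductSpace ℝ F] [FiniteDimensional ℝ F]
  [MeasurableSpace F] [BorelSpace F]

/-- The variance of the square of a standard normal variable. -/
noncomputable def chiVar : ℝ := Var[fun x ↦ x ^ 2; gaussianReal 0 1]

lemma chiVar_nonneg : 0 ≤ chiVar := variance_nonneg _ _

lemma memLp_sq_gaussianReal : MemLp (fun x : ℝ ↦ x ^ 2) 2 (gaussianReal 0 1) := by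
  rw [memLp_two_iff_integrable_sq (by fun_prop)]
  have := (memLp_id_gaussianReal (μ := 0) (v := 1) (4 : ℝ≥0)).integrable_norm_pow' 
  refine this.congr (.of_forall fun x ↦ ?_)
  simp [← pow_mul, Even.pow_abs (show Even 4 by decide)]

lemma integral_sq_gaussianReal : ∫ x, x ^ 2 ∂(gaussianReal 0 1) = 1 := by
  have hv := variance_id_gaussianReal (μ := 0) (v := 1)
  rw [variance_eq_integral aemeasurable_id] at hv
  simpa using hv

/-- Chebyshev bound for a chi-square variable. -/
lemma prob_norm_sq_sub (E : Type*) [NormedAddCommGroup E] [InnerProductSpace ℝ E]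
    [FiniteDimensional ℝ E] [MeasurableSpace E] [BorelSpace E] {K : ℝ} (hK : 0 < K) :
    (stdGaussian E).real {S | K * √(Module.finrank ℝ E) < |‖S‖ ^ 2 - Module.finrank ℝ E|} ≤
      chiVar / K ^ 2 := by
  set k := Module.finrank ℝ E with hk
  have hf : Measurable fun x : Fin k → ℝ ↦ ∑ i, x i • stdOrthonormalBasis ℝ E i := by fun_prop
  rw [stdGaussian, map_measureReal_apply hf (measurableSet_lt (by fun_prop) (by fun_prop))]
  set μ := Measure.pi fun _ : Fin k ↦ gaussianReal 0 1
  have hn : ∀ x : Fin k → ℝ, ‖∑ i, x i • stdOrthonormalBasis ℝ E i‖ ^ 2 = ∑ i, x i ^ 2 := by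
    intro x
    have := (stdOrthonormalBasis ℝ E).equiv_apply_euclideanSpace (WithLp.toLp 2 x)
    rw [← this, LinearIsometryEquiv.norm_map, EuclideanSpace.real_norm_sq_eq]
  simp only [Set.preimage_ofPred_eq, hn]
  rcases Nat.eq_zero_or_pos k with h0 | hpos
  · have : {x : Fin k → ℝ | K * √(k : ℝ) < |∑ i, x i ^ 2 - (k : ℝ)|} = ∅ := by
      ext x
      have : IsEmpty (Fin k) := by rw [h0]; infer_instance
      simp [h0]
    rw [this]; simp; exact div_nonneg chiVar_nonneg (sq_nonneg K)
  have hL : ∀ i : Fin k, MemLp (fun x : ℝ ↦ x ^ 2) 2 (gaussianReal 0 1) := fun _ ↦ memLp_sq_gaussianReal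
  have hLi : ∀ i : Fin k, MemLp (fun x : Fin k → ℝ ↦ x i ^ 2) 2 μ := fun i ↦
    (hL i).comp_measurePreserving (measurePreserving_eval _ i)
  have hvar : Var[fun x : Fin k → ℝ ↦ ∑ i, x i ^ 2; μ] = k * chiVar := by
    have := variance_sum_pi (μ := fun _ : Fin k ↦ gaussianReal 0 1) (X := fun _ x ↦ x ^ 2) hL
    have e : (∑ i, fun ω : Fin k → ℝ ↦ ω i ^ 2) = fun x : Fin k → ℝ ↦ ∑ i, x i ^ 2 := by
      ext x; simp
    rw [e] at this
    rw [this]; simp [chiVar]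
  have hmean : ∫ x, ∑ i, x i ^ 2 ∂μ = k := by
    rw [integral_finsetSum _ fun i _ ↦ (hLi i).integrable (by norm_num)]
    have : ∀ i : Fin k, ∫ x, x i ^ 2 ∂μ = 1 := fun i ↦ by
      rw [integral_comp_eval (μ := fun _ : Fin k ↦ gaussianReal 0 1) (f := fun x : ℝ ↦ x ^ 2)
        (by fun_prop), integral_sq_gaussianReal]
    simp [this]
  have hmem : MemLp (fun x : Fin k → ℝ ↦ ∑ i, x i ^ 2) 2 μ := memLp_finsetSum _ fun i _ ↦ hLi i
  have hk0 : (0 : ℝ) < k := by exact_mod_cast hpos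
  have hc : 0 < K * √k := by positivity
  have := meas_ge_le_variance_div_sq hmem hc
  rw [hmean, hvar] at this
  have h2 : μ {x : Fin k → ℝ | K * √(k : ℝ) < |∑ i, x i ^ 2 - (k : ℝ)|} ≤
      ENNReal.ofReal (chiVar / K ^ 2) := by
    refine le_trans (measure_mono fun x hx ↦ ?_) (this.trans_eq ?_)
    · exact (show K * √(k : ℝ) < |∑ i, x i ^ 2 - (k : ℝ)| from hx).le
    · congr 1
      rw [mul_pow, Real.sq_sqrt hk0.le]
      field_simp
  exact ENNReal.toReal_le_of_le_ofReal (div_nonneg chiVar_nonneg (sq_nonneg K)) h2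

lemma markov_real {Ω : Type*} [MeasurableSpace Ω] {μ : Measure Ω} [IsFiniteMeasure μ] {f : Ω → ℝ}
    (hf : Integrable f μ) (h0 : ∀ x, 0 ≤ f x) {M c : ℝ} (hc : 0 < c) (hM : ∫ x, f x ∂μ ≤ M) :
    μ.real {x | c < f x} ≤ M / c := by
  have := mul_meas_ge_le_integral_of_nonneg (.of_forall h0) hf c
  rw [le_div_iff₀ hc, mul_comm]
  refine le_trans (mul_le_mul_of_nonneg_left (measureReal_mono ?_) hc.le) (this.trans hM)
  intro x hx; exact (show c < f x from hx).le

lemma prob_inner (x : E) {K : ℝ} (hK : 0 < K) :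
    (stdGaussian E).real {S | K * ‖x‖ < |⟪S, x⟫|} ≤ 1 / K ^ 2 := by
  rcases eq_or_ne x 0 with rfl | hx
  · simp; positivity
  have hx' : 0 < ‖x‖ := norm_pos_iff.2 hx
  have h := markov_real (integral_inner_sq_stdGaussian x).1 (fun _ ↦ sq_nonneg _)
    (c := (K * ‖x‖) ^ 2) (by positivity) (integral_inner_sq_stdGaussian x).2.le
  have e : ‖x‖ ^ 2 / (K * ‖x‖) ^ 2 = 1 / K ^ 2 := by field_simp
  rw [e] at h
  refine le_trans (measureReal_mono ?_) h
  intro S hS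
  have hS' : K * ‖x‖ < |⟪S, x⟫| := hS
  show (K * ‖x‖) ^ 2 < ⟪S, x⟫ ^ 2
  rw [← sq_abs ⟪S, x⟫]
  exact pow_lt_pow_left₀ hS' (by positivity) two_ne_zero

lemma prob_projection (U : Submodule ℝ E) {K : ℝ} (hK : 0 < K) :
    (stdGaussian E).real {S | K < ‖U.starProjection S‖ ^ 2} ≤ Module.finrank ℝ U / K := by
  set b := stdOrthonormalBasis ℝ U
  have hn : ∀ S : E, ‖U.starProjection S‖ ^ 2 = ∑ i, ⟪S, (b i : E)⟫ ^ 2 := by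
    intro S
    rw [Submodule.starProjection_apply, ← Submodule.coe_norm, ← b.sum_sq_inner_left]
    refine Finset.sum_congr rfl fun i _ ↦ ?_
    rw [Submodule.coe_inner, ← Submodule.starProjection_apply,
      Submodule.inner_starProjection_left_eq_right, Submodule.starProjection_eq_self_iff.2 (b i).2]
  have hi : ∀ i, Integrable (fun S ↦ ⟪S, (b i : E)⟫ ^ 2) (stdGaussian E) := fun i ↦
    (integral_inner_sq_stdGaussian _).1
  have h1 : Integrable (fun S ↦ ‖U.starProjection S‖ ^ 2) (stdGaussian E) := by
    simp_rw [hn]; exact integrable_finsetSum _ fun i _ ↦ hi i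
  refine markov_real h1 (fun _ ↦ sq_nonneg _) hK (le_of_eq ?_)
  simp_rw [hn]
  rw [integral_finsetSum _ fun i _ ↦ hi i]
  simp_rw [(integral_inner_sq_stdGaussian _).2]
  have : ∀ i, ‖(b i : E)‖ = 1 := fun i ↦ by rw [← Submodule.coe_norm]; exact b.norm_eq_one i
  simp [this]

/-- The standard normal density is at most `1`. -/
lemma gaussianReal_le_volume (s : Set ℝ) : gaussianReal 0 1 s ≤ volume s := by
  rw [gaussianReal_apply 0 one_ne_zero]
  calc _ ≤ ∫⁻ _ in s, 1 := by
        refine lintegral_mono fun x ↦ ?_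
        rw [gaussianPDF, ← ENNReal.ofReal_one]
        refine ENNReal.ofReal_le_ofReal ?_
        rw [gaussianPDFReal_std]
        have h1 : 1 ≤ √(2 * Real.pi) := by
          rw [Real.one_le_sqrt]; nlinarith [Real.pi_gt_three]
        have h2 : Real.exp (-(x ^ 2 / 2)) ≤ 1 := Real.exp_le_one_iff.2 (by nlinarith [sq_nonneg x])
        have h3 : (√(2 * Real.pi))⁻¹ ≤ 1 := inv_le_one_of_one_le₀ h1
        have := Real.exp_pos (-(x ^ 2 / 2))
        have h4 : 0 ≤ (√(2 * Real.pi))⁻¹ := by positivity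
        nlinarith
    _ = _ := by simp

lemma gaussianReal_le_of_diam {s : Set ℝ} {δ : ℝ} (hδ : 0 ≤ δ)
    (h : ∀ x ∈ s, ∀ y ∈ s, |x - y| ≤ δ) : (gaussianReal 0 1).real s ≤ δ := by
  refine ENNReal.toReal_le_of_le_ofReal hδ ((gaussianReal_le_volume s).trans ?_)
  refine (Real.volume_le_diam s).trans (Metric.ediam_le fun x hx y hy ↦ ?_)
  rw [edist_dist, Real.dist_eq]
  exact ENNReal.ofReal_le_ofReal (h x hx y hy)

/-- A lower bound on the norm, uniform in the dimension `k`: Chebyshev for `k ≥ 4 K²`, and otherwise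
the bounded density of a single coordinate. The free parameter `K` separates the two cases. -/
lemma prob_norm_sq_small {K c : ℝ} (hK : 0 < K) (hc : 0 < c) (hc2 : c ≤ 1 / 2)
    (hk : 1 ≤ Module.finrank ℝ E) :
    (stdGaussian E).real {S | ‖S‖ ^ 2 < c * Module.finrank ℝ E} ≤
      chiVar / K ^ 2 + 4 * K * √c := by
  have hkr : (1 : ℝ) ≤ Module.finrank ℝ E := by exact_mod_cast hk
  set k : ℝ := (Module.finrank ℝ E : ℝ) with hkdef
  have hV := chiVar_nonneg
  rcases le_or_gt (4 * K ^ 2) k with h | h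
  · have h1 := prob_norm_sq_sub E hK
    have : 0 ≤ 4 * K * √c := by positivity
    refine le_trans (measureReal_mono ?_) (h1.trans (by linarith))
    intro S hS
    have hS' : ‖S‖ ^ 2 < c * k := hS
    show K * √k < |‖S‖ ^ 2 - k|
    rw [abs_sub_comm]
    refine lt_of_lt_of_le ?_ (le_abs_self _)
    have : 2 * K ≤ √k := Real.le_sqrt_of_sq_le (by nlinarith)
    have hsq := Real.sq_sqrt (show 0 ≤ k by linarith)
    have := Real.sqrt_nonneg k
    nlinarith
  · have : Nontrivial E := Module.nontrivial_of_finrank_pos (R := ℝ) (by omega)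
    obtain ⟨u, hu⟩ := exists_norm_eq E (zero_le_one)
    have hmap := map_inner_stdGaussian u
    have hone : NNReal.mk (‖u‖ ^ 2) (sq_nonneg _) = 1 := by
      apply NNReal.coe_injective; simp [hu]
    rw [hone] at hmap
    have h1 : (gaussianReal 0 1).real {x | |x| < 2 * K * √c} ≤ 4 * K * √c := by
      refine gaussianReal_le_of_diam (by positivity) fun x hx y hy ↦ ?_
      have hx' : |x| < 2 * K * √c := hx
      have hy' : |y| < 2 * K * √c := hy
      rw [abs_lt] at *
      rw [abs_le]; constructor <;> linarith
    rw [← hmap, map_measureReal_apply (by fun_prop) (measurableSet_lt (by fun_prop) (by fun_prop))] at h1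
    have h2 : 0 ≤ chiVar / K ^ 2 := by positivity
    refine le_trans (measureReal_mono ?_) (h1.trans (by linarith))
    intro S hS
    have hS' : ‖S‖ ^ 2 < c * k := hS
    show |⟪S, u⟫| < 2 * K * √c
    refine lt_of_pow_lt_pow_left₀ 2 (by positivity) ?_
    have h3 : |⟪S, u⟫| ≤ ‖S‖ := by simpa [hu] using abs_real_inner_le_norm S u
    calc |⟪S, u⟫| ^ 2 ≤ ‖S‖ ^ 2 := by gcongr
      _ < c * k := hS'
      _ ≤ c * (4 * K ^ 2) := by gcongr
      _ = _ := by rw [mul_pow, Real.sq_sqrt hc.le]; ring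

lemma prob_prod_inner {K : ℝ} (hK : 0 < K) :
    ((stdGaussian F).prod (stdGaussian F)).real
      {p | K * √(Module.finrank ℝ F) < |⟪p.1, p.2⟫|} ≤ 1 / K ^ 2 := by
  set m := Module.finrank ℝ F
  have hms : MeasurableSet {p : F × F | K * √(m : ℝ) < |⟪p.1, p.2⟫|} :=
    measurableSet_lt (by fun_prop) (by fun_prop)
  rcases Nat.eq_zero_or_pos m with h0 | hpos
  · have : Subsingleton F := Module.finrank_zero_iff (R := ℝ).1 h0
    have : {p : F × F | K * √(m : ℝ) < |⟪p.1, p.2⟫|} = ∅ := by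
      ext p; simp [h0, Subsingleton.elim p.1 0]
    rw [this]; simp; positivity
  have hm0 : (0 : ℝ) < m := by exact_mod_cast hpos
  have hsum : ∀ y : F, ‖y‖ ^ 2 = ∑ i, ⟪y, stdOrthonormalBasis ℝ F i⟫ ^ 2 := fun y ↦
    ((stdOrthonormalBasis ℝ F).sum_sq_inner_left y).symm
  have hi : ∀ i, Integrable (fun S ↦ ⟪S, stdOrthonormalBasis ℝ F i⟫ ^ 2) (stdGaussian F) := fun i ↦
    (integral_inner_sq_stdGaussian _).1
  have hint : Integrable (fun y : F ↦ ‖y‖ ^ 2) (stdGaussian F) := by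
    simp_rw [hsum]; exact integrable_finsetSum _ fun i _ ↦ hi i
  have hmean : ∫ y, ‖y‖ ^ 2 ∂(stdGaussian F) = m := by
    simp_rw [hsum]
    rw [integral_finsetSum _ fun i _ ↦ hi i]
    simp_rw [(integral_inner_sq_stdGaussian _).2]
    simp [m]
  refine ENNReal.toReal_le_of_le_ofReal (by positivity) ?_
  rw [Measure.prod_apply_symm hms]
  calc _ ≤ ∫⁻ y, ENNReal.ofReal (‖y‖ ^ 2 / (K ^ 2 * m)) ∂(stdGaussian F) := by
        refine lintegral_mono fun y ↦ ?_
        have := markov_real (integral_inner_sq_stdGaussian y).1 (fun _ ↦ sq_nonneg _)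
          (c := K ^ 2 * m) (by positivity) (integral_inner_sq_stdGaussian y).2.le
        rw [← ofReal_measureReal]
        refine ENNReal.ofReal_le_ofReal (le_trans (measureReal_mono ?_) this)
        intro x hx
        have hx' : K * √(m : ℝ) < |⟪x, y⟫| := hx
        show K ^ 2 * m < ⟪x, y⟫ ^ 2
        rw [← sq_abs ⟪x, y⟫, show K ^ 2 * (m : ℝ) = (K * √(m : ℝ)) ^ 2 by
          rw [mul_pow, Real.sq_sqrt hm0.le]]
        exact pow_lt_pow_left₀ hx' (by positivity) two_ne_zero
    _ = ENNReal.ofReal (∫ y, ‖y‖ ^ 2 / (K ^ 2 * m) ∂(stdGaussian F)) :=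
        (ofReal_integral_eq_lintegral_ofReal (hint.div_const _) (.of_forall fun y ↦ by positivity)).symm
    _ = _ := by
        rw [integral_div, hmean]; congr 1; field_simp

end Moments

/-! ### The likelihood ratio statistic as a minimum over directions -/

section Statistic

variable {l : ℕ} {E F : Type*} [NormedAddCommGroup E] [InnerProductSpace ℝ E]
  [NormedAddCommGroup F] [InnerProductSpace ℝ F]

/-- The linear combination `∑ vᵢ tᵢ` of the columns of `t`. -/
noncomputable def comb (t : Fin l → E) : EuclideanSpace ℝ (Fin l) →ₗ[ℝ] E where
  toFun v := ∑ i, v i • t i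
  map_add' v w := by simp [add_smul, Finset.sum_add_distrib]
  map_smul' c v := by simp [Finset.smul_sum, mul_smul]

lemma comb_apply (t : Fin l → E) (v : EuclideanSpace ℝ (Fin l)) : comb t v = ∑ i, v i • t i := rfl

lemma comb_mem_span (t : Fin l → E) (v : EuclideanSpace ℝ (Fin l)) :
    comb t v ∈ Submodule.span ℝ (Set.range t) := by
  rw [comb_apply]
  exact Submodule.sum_mem _ fun i _ ↦
    Submodule.smul_mem _ _ (Submodule.subset_span (Set.mem_range_self i))

/-- The ratio of the quadratic forms of `(S, t)` and `(γ, Γ)` in the direction `(v₀, v)`. -/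
noncomputable def ratio (S : E) (t : Fin l → E) (γ : F) (Γ : Fin l → F)
    (v₀ : ℝ) (v : EuclideanSpace ℝ (Fin l)) : ℝ :=
  ‖v₀ • S + comb t v‖ ^ 2 / ‖v₀ • γ + comb Γ v‖ ^ 2

/-- The statistic `LR₁ / (n - k)` as a function of the columns `(S, t)` and `(γ, Γ)`: the value of
`ratio` in the direction `(1, 0)` minus its infimum. The infimum runs over rational directions,
which makes the statistic measurable; under `FullRank` it is the minimum over all real directions,
by `iInf_ratio_eq`. -/
noncomputable def lr (S : E) (t : Fin l → E) (γ : F) (Γ : Fin l → F) : ℝ :=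
  ‖S‖ ^ 2 / ‖γ‖ ^ 2 - ⨅ q : {q : ℚ × (Fin l → ℚ) // q ≠ 0},
    ratio S t γ Γ q.1.1 (WithLp.toLp 2 fun i ↦ (q.1.2 i : ℝ))

/-- The columns `γ, Γ₁, …, Γ_l` are linearly independent. -/
def FullRank (γ : F) (Γ : Fin l → F) : Prop :=
  ∀ (v₀ : ℝ) (v : EuclideanSpace ℝ (Fin l)), v₀ • γ + comb Γ v = 0 → v₀ = 0 ∧ v = 0

lemma FullRank.pos {γ : F} {Γ : Fin l → F} (h : FullRank γ Γ) {v₀ : ℝ}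
    {v : EuclideanSpace ℝ (Fin l)} (hv : ¬ (v₀ = 0 ∧ v = 0)) : 0 < ‖v₀ • γ + comb Γ v‖ ^ 2 := by
  have : v₀ • γ + comb Γ v ≠ 0 := fun h0 ↦ hv (h v₀ v h0)
  positivity

@[fun_prop]
lemma measurable_lr_comp [FiniteDimensional ℝ E] [MeasurableSpace E] [BorelSpace E]
    [FiniteDimensional ℝ F] [MeasurableSpace F] [BorelSpace F] {Ω : Type*} [MeasurableSpace Ω]
    {S : Ω → E} {t : Ω → Fin l → E} {γ : Ω → F} {Γ : Ω → Fin l → F} (hS : Measurable S)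
    (ht : Measurable t) (hγ : Measurable γ) (hΓ : Measurable Γ) :
    Measurable fun ω ↦ lr (S ω) (t ω) (γ ω) (Γ ω) := by
  unfold lr
  refine Measurable.sub (by fun_prop) (Measurable.iInf fun q ↦ ?_)
  unfold ratio
  simp only [comb_apply]
  fun_prop

lemma ratio_nonneg (S : E) (t : Fin l → E) (γ : F) (Γ : Fin l → F)
    (v₀ : ℝ) (v : EuclideanSpace ℝ (Fin l)) : 0 ≤ ratio S t γ Γ v₀ v := by
  unfold ratio; positivity

/-- The minimum over all directions is attained, since `ratio` is invariant under scaling. -/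
lemma exists_minRoot (S : E) (t : Fin l → E) {γ : F} {Γ : Fin l → F} (h : FullRank γ Γ) :
    ∃ (v₀ : ℝ) (v : EuclideanSpace ℝ (Fin l)), ¬ (v₀ = 0 ∧ v = 0) ∧
      ∀ (w₀ : ℝ) (w : EuclideanSpace ℝ (Fin l)), ¬ (w₀ = 0 ∧ w = 0) →
        ratio S t γ Γ v₀ v ≤ ratio S t γ Γ w₀ w := by
  let f : ℝ × EuclideanSpace ℝ (Fin l) → ℝ := fun p ↦ ratio S t γ Γ p.1 p.2
  have hne : ∀ p : ℝ × EuclideanSpace ℝ (Fin l), p ≠ 0 → ¬ (p.1 = 0 ∧ p.2 = 0) := fun p hp h ↦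
    hp (Prod.ext h.1 h.2)
  have hc : ContinuousOn f (Metric.sphere 0 1) := by
    intro p hp
    have hp0 : p ≠ 0 := by
      rintro rfl; simp at hp
    have h1 := h.pos (hne p hp0)
    refine ContinuousAt.continuousWithinAt ?_
    have hct : Continuous (comb t) := (comb t).continuous_of_finiteDimensional
    have hcΓ : Continuous (comb Γ) := (comb Γ).continuous_of_finiteDimensional
    refine ContinuousAt.div (by fun_prop) (by fun_prop) h1.ne'
  obtain ⟨p, hp, hmin⟩ := (isCompact_sphere (0 : ℝ × EuclideanSpace ℝ (Fin l)) 1).exists_isMinOn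
    ⟨((1 : ℝ), 0), by simp [Prod.norm_def]⟩ hc
  have hp0 : p ≠ 0 := by rintro rfl; simp at hp
  refine ⟨p.1, p.2, hne p hp0, fun w₀ w hw ↦ ?_⟩
  set q : ℝ × EuclideanSpace ℝ (Fin l) := (w₀, w) with hq
  have hq0 : q ≠ 0 := fun h0 ↦ hw ⟨congrArg Prod.fst h0, congrArg Prod.snd h0⟩
  have hqn : ‖q‖ ≠ 0 := norm_ne_zero_iff.2 hq0
  have h1 : ‖q‖⁻¹ • q ∈ Metric.sphere (0 : ℝ × EuclideanSpace ℝ (Fin l)) 1 := by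
    simp [norm_smul, hqn]
  refine (hmin h1).trans (le_of_eq ?_)
  show ratio S t γ Γ (‖q‖⁻¹ * w₀) (‖q‖⁻¹ • w) = ratio S t γ Γ w₀ w
  unfold ratio
  rw [map_smul, map_smul, mul_smul, mul_smul, ← smul_add, ← smul_add, norm_smul, norm_smul, mul_pow,
    mul_pow, norm_inv, norm_norm, mul_div_mul_left _ _ (pow_ne_zero 2 (inv_ne_zero hqn))]

lemma iInf_ratio_eq (S : E) (t : Fin l → E) {γ : F} {Γ : Fin l → F} (h : FullRank γ Γ)
    {v₀ : ℝ} {v : EuclideanSpace ℝ (Fin l)} (hv : ¬ (v₀ = 0 ∧ v = 0))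
    (hmin : ∀ (w₀ : ℝ) (w : EuclideanSpace ℝ (Fin l)), ¬ (w₀ = 0 ∧ w = 0) →
        ratio S t γ Γ v₀ v ≤ ratio S t γ Γ w₀ w) :
    ⨅ q : {q : ℚ × (Fin l → ℚ) // q ≠ 0},
      ratio S t γ Γ q.1.1 (WithLp.toLp 2 fun i ↦ (q.1.2 i : ℝ)) = ratio S t γ Γ v₀ v := by
  let e : ℚ × (Fin l → ℚ) → ℝ × EuclideanSpace ℝ (Fin l) := fun q ↦
    ((q.1 : ℝ), WithLp.toLp 2 fun i ↦ (q.2 i : ℝ))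
  have hbdd : BddBelow (Set.range fun q : {q : ℚ × (Fin l → ℚ) // q ≠ 0} ↦
      ratio S t γ Γ q.1.1 (WithLp.toLp 2 fun i ↦ (q.1.2 i : ℝ))) :=
    ⟨0, by rintro _ ⟨q, rfl⟩; exact ratio_nonneg _ _ _ _ _ _⟩
  have hnon : Nonempty {q : ℚ × (Fin l → ℚ) // q ≠ 0} := ⟨⟨(1, 0), by simp⟩⟩
  apply le_antisymm
  · refine le_of_forall_pos_lt_add fun ε hε ↦ ?_
    have hd : DenseRange e := by
      have h1 : DenseRange (Rat.cast : ℚ → ℝ) := Rat.denseRange_cast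
      have h2 : DenseRange (fun q : Fin l → ℚ ↦ fun i ↦ (q i : ℝ)) :=
        DenseRange.piMap fun _ ↦ h1
      have h3 : DenseRange (fun q : Fin l → ℚ ↦
          (WithLp.toLp 2 fun i ↦ (q i : ℝ) : EuclideanSpace ℝ (Fin l))) :=
        (WithLp.toLp_surjective 2).denseRange.comp h2 (PiLp.continuous_toLp 2 _)
      exact h1.prodMap h3
    have hct : Continuous (comb t) := (comb t).continuous_of_finiteDimensional
    have hcΓ : Continuous (comb Γ) := (comb Γ).continuous_of_finiteDimensional
    have hca : ContinuousAt (fun p : ℝ × EuclideanSpace ℝ (Fin l) ↦ ratio S t γ Γ p.1 p.2) (v₀, v) :=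
      ContinuousAt.div (by fun_prop) (by fun_prop) (h.pos hv).ne'
    have hev : ∀ᶠ p in 𝓝 ((v₀, v) : ℝ × EuclideanSpace ℝ (Fin l)),
        ratio S t γ Γ p.1 p.2 < ratio S t γ Γ v₀ v + ε ∧ p ≠ 0 := by
      refine (hca.eventually_lt_const (by simpa using hε)).and (isOpen_ne.mem_nhds ?_)
      intro h0
      exact hv ⟨congrArg Prod.fst h0, congrArg Prod.snd h0⟩
    obtain ⟨O, hO, hOo, hOm⟩ := eventually_nhds_iff.1 hev
    obtain ⟨q, hq⟩ := hd.exists_mem_open hOo ⟨_, hOm⟩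
    have hq2 := hO _ hq
    have hq0 : q ≠ 0 := by
      rintro rfl
      apply hq2.2
      ext <;> simp [e]
    exact (ciInf_le hbdd ⟨q, hq0⟩).trans_lt hq2.1
  · refine le_ciInf fun q ↦ hmin _ _ fun h0 ↦ q.2 ?_
    refine Prod.ext (by exact_mod_cast h0.1) ?_
    ext i
    have := congrArg (fun w : EuclideanSpace ℝ (Fin l) ↦ w i) h0.2
    simpa using this

/-- A lower bound on the statistic is witnessed by a direction; `lt_lr_of_exists` is the converse.
-/
lemma exists_of_le_lr {S : E} {t : Fin l → E} {γ : F} {Γ : Fin l → F} (h : FullRank γ Γ) {y : ℝ}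
    (hy : y ≤ lr S t γ Γ) :
    ∃ (v₀ : ℝ) (v : EuclideanSpace ℝ (Fin l)), ¬ (v₀ = 0 ∧ v = 0) ∧
      ‖v₀ • S + comb t v‖ ^ 2 ≤ (‖S‖ ^ 2 / ‖γ‖ ^ 2 - y) * ‖v₀ • γ + comb Γ v‖ ^ 2 := by
  obtain ⟨v₀, v, hv, hmin⟩ := exists_minRoot S t h
  refine ⟨v₀, v, hv, ?_⟩
  rw [← div_le_iff₀ (h.pos hv)]
  rw [lr, iInf_ratio_eq S t h hv hmin] at hy
  have : ratio S t γ Γ v₀ v ≤ ‖S‖ ^ 2 / ‖γ‖ ^ 2 - y := by linarith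
  exact this

lemma lt_lr_of_exists {S : E} {t : Fin l → E} {γ : F} {Γ : Fin l → F} (h : FullRank γ Γ) {y : ℝ}
    {v₀ : ℝ} {v : EuclideanSpace ℝ (Fin l)}
    (hv : ‖v₀ • S + comb t v‖ ^ 2 < (‖S‖ ^ 2 / ‖γ‖ ^ 2 - y) * ‖v₀ • γ + comb Γ v‖ ^ 2) :
    y < lr S t γ Γ := by
  have hv0 : ¬ (v₀ = 0 ∧ v = 0) := by
    rintro ⟨rfl, rfl⟩; simp at hv
  obtain ⟨w₀, w, hw, hmin⟩ := exists_minRoot S t h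
  rw [lr, iInf_ratio_eq S t h hw hmin]
  have h1 := hmin v₀ v hv0
  have h2 : ratio S t γ Γ v₀ v < ‖S‖ ^ 2 / ‖γ‖ ^ 2 - y := by
    unfold ratio; rwa [div_lt_iff₀ (h.pos hv0)]
  linarith

end Statistic

/-! ### Pathwise comparison in one direction -/

section Domination

variable {E F : Type*} [NormedAddCommGroup E] [InnerProductSpace ℝ E]
  [NormedAddCommGroup F] [InnerProductSpace ℝ F]

lemma norm_smul_add_sq (v₀ : ℝ) (x z : E) :
    ‖v₀ • x + z‖ ^ 2 = v₀ ^ 2 * ‖x‖ ^ 2 + 2 * v₀ * ⟪x, z⟫ + ‖z‖ ^ 2 := by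
  rw [norm_add_sq_real, norm_smul, real_inner_smul_left, mul_pow, Real.norm_eq_abs, sq_abs]
  ring

lemma two_mul_lt_of_sq_lt {α β X a p : ℝ} (hα : 0 < α) (hd : X ^ 2 < α * β)
    (hp : 0 ≤ p) (key : 0 < a ∨ 0 < p) : 2 * (a * (X * p)) < α * a ^ 2 + β * p ^ 2 := by
  have : 0 < α * (α * a ^ 2 + β * p ^ 2 - 2 * (a * (X * p))) := by
    have e3 : α * (α * a ^ 2 + β * p ^ 2 - 2 * (a * (X * p))) =
      (α * a - X * p) ^ 2 + (α * β - X ^ 2) * p ^ 2 := by ring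
    rw [e3]
    have hd' : 0 < α * β - X ^ 2 := by linarith
    rcases eq_or_lt_of_le hp with h0 | h0
    · have ha1 : 0 < a := by
        rcases key with h5 | h5
        · exact h5
        · exact absurd h0 h5.ne
      rw [← h0]; simp; positivity
    · positivity
  have := pos_of_mul_pos_right this hα.le
  linarith

/-- A direction which witnesses that the statistic at `(S, a₂, γ, b)` is at least `y` also witnesses
that the one at `(S', a₁, γ', b')` exceeds `y`. Both inequalities are quadratic in `v₀`. After the
first is multiplied by the slack factor `1 + e`, the cross terms `hX` differ by at most `X p`, and
the gain in the quadratic terms `hq` and in `y ‖γ‖² v₀²` absorbs this by `hfin` and the inequality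
between the geometric and the arithmetic mean. -/
lemma dominate {S S' a₁ a₂ : E} {γ γ' b b' : F} {v₀ y e X B p : ℝ}
    (hγ : 0 < ‖γ‖) (hγ' : 0 < ‖γ'‖) (he : 0 < e) (hy : 0 < y) (hp : 0 ≤ p)
    (hvp : v₀ ≠ 0 ∨ 0 < p)
    (h : ‖v₀ • S + a₂‖ ^ 2 ≤ (‖S‖ ^ 2 / ‖γ‖ ^ 2 - y) * ‖v₀ • γ + b‖ ^ 2)
    (hw : ‖γ'‖ ^ 2 - ‖γ‖ ^ 2 ≤ e / 2 * ‖γ‖ ^ 2)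
    (hX : |((‖S'‖ ^ 2 / ‖γ'‖ ^ 2 - y) * ⟪γ', b'⟫ - ⟪S', a₁⟫) -
      (1 + e) * ((‖S‖ ^ 2 / ‖γ‖ ^ 2 - y) * ⟪γ, b⟫ - ⟪S, a₂⟫)| ≤ X * p)
    (hq : e * B * p ^ 2 ≤ (1 + e) * (‖a₂‖ ^ 2 - (‖S‖ ^ 2 / ‖γ‖ ^ 2 - y) * ‖b‖ ^ 2) -
      (‖a₁‖ ^ 2 - (‖S'‖ ^ 2 / ‖γ'‖ ^ 2 - y) * ‖b'‖ ^ 2))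
    (hfin : 2 * X ^ 2 < e ^ 2 * (y * ‖γ‖ ^ 2) * B) :
    ‖v₀ • S' + a₁‖ ^ 2 < (‖S'‖ ^ 2 / ‖γ'‖ ^ 2 - y) * ‖v₀ • γ' + b'‖ ^ 2 := by
  rw [norm_smul_add_sq, norm_smul_add_sq] at h ⊢
  set A := ‖S‖ ^ 2
  set A' := ‖S'‖ ^ 2
  set g := ‖γ‖ ^ 2 with hg
  set g' := ‖γ'‖ ^ 2 with hg'
  have hg0 : 0 < g := by positivity
  have hg0' : 0 < g' := by positivity
  set L := A / g - y with hL
  set L' := A' / g' - y with hL'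
  have e1 : L * g = A - y * g := by rw [hL]; field_simp
  have e2 : L' * g' = A' - y * g' := by rw [hL']; field_simp
  set c := L * ⟪γ, b⟫ - ⟪S, a₂⟫ with hc
  set c' := L' * ⟪γ', b'⟫ - ⟪S', a₁⟫ with hc'
  have h1 : v₀ ^ 2 * (y * g) + (‖a₂‖ ^ 2 - L * ‖b‖ ^ 2) ≤ 2 * v₀ * c := by
    rw [hc]; linear_combination h + v₀ ^ 2 * e1
  suffices hs : v₀ ^ 2 * (y * g') + (‖a₁‖ ^ 2 - L' * ‖b'‖ ^ 2) < 2 * v₀ * c' by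
    rw [hc'] at hs; linear_combination hs - v₀ ^ 2 * e2
  obtain ⟨hX1, hX2⟩ := abs_le.1 hX
  have hcr : 2 * v₀ * (c' - (1 + e) * c) ≥ - (2 * (|v₀| * (X * p))) := by
    have := abs_mul v₀ (c' - (1 + e) * c)
    have h3 : |v₀| * |c' - (1 + e) * c| ≤ |v₀| * (X * p) :=
      mul_le_mul_of_nonneg_left hX (abs_nonneg _)
    have h4 := neg_abs_le (v₀ * (c' - (1 + e) * c))
    rw [this] at h4
    linarith
  have hw' : v₀ ^ 2 * (y * g') ≤ v₀ ^ 2 * (y * g) * (1 + e / 2) := by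
    have : 0 ≤ v₀ ^ 2 * y := by positivity
    nlinarith
  have hyg : 0 < y * g := by positivity
  have hstrict : 2 * (|v₀| * (X * p)) < e / 2 * (v₀ ^ 2 * (y * g)) + e * B * p ^ 2 := by
    have hsq : |v₀| ^ 2 = v₀ ^ 2 := sq_abs v₀
    rw [← hsq]
    set a := |v₀| with ha
    have ha0 : 0 ≤ a := abs_nonneg _
    have key : 0 < a ∨ 0 < p := by
      rcases hvp with h0 | h0
      · exact Or.inl (abs_pos.2 h0)
      · exact Or.inr h0
    have e4 : e / 2 * (a ^ 2 * (y * g)) = (e / 2 * (y * g)) * a ^ 2 := by ring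
    rw [e4]
    exact two_mul_lt_of_sq_lt (by positivity) (by linarith) hp key
  have h1' := mul_le_mul_of_nonneg_left h1 (show 0 ≤ 1 + e by linarith)
  have e5 : 2 * v₀ * c' = (1 + e) * (2 * v₀ * c) + 2 * v₀ * (c' - (1 + e) * c) := by ring
  rw [e5]
  have h6 : (1 + e) * (v₀ ^ 2 * (y * g) + (‖a₂‖ ^ 2 - L * ‖b‖ ^ 2)) =
      v₀ ^ 2 * (y * g) * (1 + e / 2) + e / 2 * (v₀ ^ 2 * (y * g)) +
        (1 + e) * (‖a₂‖ ^ 2 - L * ‖b‖ ^ 2) := by ring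
  rw [h6] at h1'
  linarith

end Domination

/-! ### Regularity of the Gram matrix and perturbations of the columns -/

section Estimates

variable {l : ℕ} {E F : Type*} [NormedAddCommGroup E] [InnerProductSpace ℝ E]
  [NormedAddCommGroup F] [InnerProductSpace ℝ F]

/-- The Gram matrix of `(γ, Γ)` is within `K μ` of `μ² I`. -/
structure Near (K μ : ℝ) (γ : F) (Γ : Fin l → F) : Prop where
  norm : |‖γ‖ ^ 2 - μ ^ 2| ≤ K * μ
  inner : ∀ v, |⟪γ, comb Γ v⟫| ≤ K * μ * ‖v‖
  comb : ∀ v, |‖comb Γ v‖ ^ 2 - μ ^ 2 * ‖v‖ ^ 2| ≤ K * μ * ‖v‖ ^ 2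

/-- `t₂` arises from `t₁` by a linear change of columns close to the identity, and the addition
of small multiples of a fixed vector `x`. -/
def Rel (δ : ℝ) (x : E) (t₁ t₂ : Fin l → E) : Prop :=
  ∃ (H : EuclideanSpace ℝ (Fin l) →ₗ[ℝ] EuclideanSpace ℝ (Fin l)) (g : EuclideanSpace ℝ (Fin l)),
    (∀ v, ‖H v - v‖ ≤ δ * ‖v‖) ∧ ‖g‖ ≤ δ ∧ ∀ v, comb t₂ v = comb t₁ (H v) + ⟪g, v⟫ • x

lemma Near.fullRank {K μ : ℝ} {γ : F} {Γ : Fin l → F} (h : Near K μ γ Γ) (hμ : 0 < μ)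
    (hK : 4 * K ≤ μ) : FullRank γ Γ := by
  intro v₀ v h0
  have h1 : ‖v₀ • γ + MCLR.comb Γ v‖ ^ 2 = 0 := by rw [h0]; simp
  rw [norm_smul_add_sq] at h1
  have a1 := (abs_le.1 h.norm).1
  have a3 := (abs_le.1 (h.comb v)).1
  have a2 : |v₀ * ⟪γ, MCLR.comb Γ v⟫| ≤ |v₀| * (K * μ * ‖v‖) := by
    rw [abs_mul]; exact mul_le_mul_of_nonneg_left (h.inner v) (abs_nonneg _)
  have a4 := (abs_le.1 a2).1
  have hK0 : 0 ≤ K * μ := (abs_nonneg _).trans h.norm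
  have a5 : 2 * (|v₀| * ‖v‖) ≤ v₀ ^ 2 + ‖v‖ ^ 2 := by
    rw [← sq_abs v₀]; nlinarith [sq_nonneg (|v₀| - ‖v‖)]
  have a6 : K * μ ≤ μ ^ 2 / 4 := by nlinarith
  have a7 : μ ^ 2 / 2 * (v₀ ^ 2 + ‖v‖ ^ 2) ≤ 0 := by
    have b1 : v₀ ^ 2 * (μ ^ 2 - K * μ) ≤ v₀ ^ 2 * ‖γ‖ ^ 2 :=
      mul_le_mul_of_nonneg_left (by linarith) (sq_nonneg _)
    have b2 : K * μ * (2 * (|v₀| * ‖v‖)) ≤ K * μ * (v₀ ^ 2 + ‖v‖ ^ 2) :=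
      mul_le_mul_of_nonneg_left a5 hK0
    have b3 : K * μ * (v₀ ^ 2 + ‖v‖ ^ 2) ≤ μ ^ 2 / 4 * (v₀ ^ 2 + ‖v‖ ^ 2) :=
      mul_le_mul_of_nonneg_right a6 (by positivity)
    linarith
  have a8 : v₀ ^ 2 + ‖v‖ ^ 2 ≤ 0 := by
    by_contra hc
    push Not at hc
    have : 0 < μ ^ 2 / 2 * (v₀ ^ 2 + ‖v‖ ^ 2) := by positivity
    linarith
  have b1 := sq_nonneg v₀
  have b2 := sq_nonneg ‖v‖
  constructor
  · exact pow_eq_zero_iff two_ne_zero |>.1 (by linarith)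
  · exact norm_eq_zero.1 (pow_eq_zero_iff two_ne_zero |>.1 (by linarith))

lemma Near.norm_bounds {K μ : ℝ} {γ : F} {Γ : Fin l → F} (h : Near K μ γ Γ) (hμ : 0 < μ)
    (hK : 4 * K ≤ μ) : μ ^ 2 / 2 ≤ ‖γ‖ ^ 2 ∧ ‖γ‖ ^ 2 ≤ 2 * μ ^ 2 := by
  have a1 := abs_le.1 h.norm
  constructor <;> nlinarith

lemma norm_le_two_mul_of_rel {K μ : ℝ} (hμ : 1 ≤ μ) (hK : 4 * K ≤ μ)
    {v w : EuclideanSpace ℝ (Fin l)} (hw : ‖w - v‖ ≤ K / μ * ‖v‖) : ‖w‖ ≤ 2 * ‖v‖ := by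
  have h1 : K / μ ≤ 1 := by rw [div_le_one (by linarith)]; linarith [norm_nonneg v]
  have h2 : ‖w‖ ≤ ‖w - v‖ + ‖v‖ := by simpa using norm_add_le (w - v) v
  nlinarith [norm_nonneg v]

lemma Near.inner_le {K μ : ℝ} {γ : F} {Γ : Fin l → F} (h : Near K μ γ Γ) (hμ : 1 ≤ μ)
    (hK1 : 1 ≤ K) (hK : 4 * K ≤ μ) {v w : EuclideanSpace ℝ (Fin l)}
    (hw : ‖w - v‖ ≤ K / μ * ‖v‖) : |⟪γ, MCLR.comb Γ w⟫| ≤ 2 * K * μ * ‖v‖ ∧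
    |⟪γ, MCLR.comb Γ w⟫ - ⟪γ, MCLR.comb Γ v⟫| ≤ K ^ 2 * ‖v‖ := by
  have h2 := norm_le_two_mul_of_rel hμ hK hw
  have hKμ : 0 ≤ K * μ := by positivity
  constructor
  · refine (h.inner w).trans ?_
    have := mul_le_mul_of_nonneg_left h2 hKμ
    linarith
  · rw [← inner_sub_right, ← map_sub]
    refine (h.inner _).trans ?_
    have := mul_le_mul_of_nonneg_left hw hKμ
    have e : K * μ * (K / μ * ‖v‖) = K ^ 2 * ‖v‖ := by field_simp
    linarith

lemma Near.comb_le {K μ : ℝ} {γ : F} {Γ : Fin l → F} (h : Near K μ γ Γ) (hμ : 1 ≤ μ)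
    (hK1 : 1 ≤ K) (hK : 4 * K ≤ μ) {v w : EuclideanSpace ℝ (Fin l)}
    (hw : ‖w - v‖ ≤ K / μ * ‖v‖) : |‖MCLR.comb Γ w‖ ^ 2 - ‖MCLR.comb Γ v‖ ^ 2| ≤ 8 * K * μ * ‖v‖ ^ 2 ∧
    μ ^ 2 / 2 * ‖v‖ ^ 2 ≤ ‖MCLR.comb Γ v‖ ^ 2 ∧ ‖MCLR.comb Γ w‖ ^ 2 ≤ 8 * μ ^ 2 * ‖v‖ ^ 2 ∧
    ‖MCLR.comb Γ v‖ ^ 2 ≤ (μ ^ 2 + K * μ) * ‖v‖ ^ 2 := by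
  have h2 := norm_le_two_mul_of_rel hμ hK hw
  have hKμ : 0 ≤ K * μ := by positivity
  have hv0 := norm_nonneg v
  have hw0 := norm_nonneg w
  have hw2 : ‖w‖ ^ 2 ≤ 4 * ‖v‖ ^ 2 := by nlinarith
  have b1 := abs_le.1 (h.comb v)
  have b2 := abs_le.1 (h.comb w)
  have b3 : K * μ * ‖w‖ ^ 2 ≤ K * μ * (4 * ‖v‖ ^ 2) := mul_le_mul_of_nonneg_left hw2 hKμ
  have b4 : |‖w‖ - ‖v‖| ≤ K / μ * ‖v‖ := (abs_norm_sub_norm_le w v).trans hw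
  have b5 : |‖w‖ ^ 2 - ‖v‖ ^ 2| ≤ K / μ * ‖v‖ * (3 * ‖v‖) := by
    rw [sq_sub_sq, mul_comm, abs_mul]
    refine mul_le_mul b4 ?_ (abs_nonneg _) (by positivity)
    rw [abs_of_nonneg (by positivity)]; linarith
  have b6 : |μ ^ 2 * (‖w‖ ^ 2 - ‖v‖ ^ 2)| ≤ 3 * K * μ * ‖v‖ ^ 2 := by
    rw [abs_mul, abs_of_nonneg (sq_nonneg μ)]
    calc μ ^ 2 * |‖w‖ ^ 2 - ‖v‖ ^ 2| ≤ μ ^ 2 * (K / μ * ‖v‖ * (3 * ‖v‖)) :=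
          mul_le_mul_of_nonneg_left b5 (sq_nonneg μ)
      _ = _ := by field_simp
  have b7 := abs_le.1 b6
  have b8 : K * μ * ‖v‖ ^ 2 ≤ μ ^ 2 / 4 * ‖v‖ ^ 2 :=
    mul_le_mul_of_nonneg_right (by nlinarith) (sq_nonneg _)
  refine ⟨abs_le.2 ⟨by linarith, by linarith⟩, by linarith, ?_, by linarith⟩
  have b9 : μ ^ 2 * ‖w‖ ^ 2 ≤ μ ^ 2 * (4 * ‖v‖ ^ 2) := mul_le_mul_of_nonneg_left hw2 (sq_nonneg _)
  linarith [sq_nonneg (μ * ‖v‖)]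

/-- The term `⟪g, v⟫ x` of `Rel` changes the squared length of a column combination by a relative
error `1 / μ` and an absolute error of order `r² / μ`. -/
lemma norm_sub_smul_sq_le {K μ r : ℝ} (hμ : 1 ≤ μ) (hK : 0 ≤ K) {a x : E}
    {g v : EuclideanSpace ℝ (Fin l)} (hg : ‖g‖ ≤ K / μ) (hx : ‖x‖ ≤ K * r) :
    ‖a - ⟪g, v⟫ • x‖ ^ 2 ≤ (1 + 1 / μ) * ‖a‖ ^ 2 + 2 * K ^ 4 * (r ^ 2 / μ) * ‖v‖ ^ 2 := by
  set n := ‖⟪g, v⟫ • x‖ with hn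
  have hμ0 : 0 < μ := by linarith
  have h1 : n ≤ K ^ 2 * (r / μ) * ‖v‖ := by
    rw [hn, norm_smul]
    have : ‖⟪g, v⟫‖ ≤ K / μ * ‖v‖ :=
      (norm_inner_le_norm g v).trans (mul_le_mul_of_nonneg_right hg (norm_nonneg _))
    calc ‖⟪g, v⟫‖ * ‖x‖ ≤ (K / μ * ‖v‖) * (K * r) :=
          mul_le_mul this hx (norm_nonneg _) (by positivity)
      _ = _ := by ring
  have hn0 : 0 ≤ n := norm_nonneg _
  have h2 : n ^ 2 ≤ K ^ 4 * (r ^ 2 / μ ^ 2) * ‖v‖ ^ 2 := by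
    calc n ^ 2 ≤ (K ^ 2 * (r / μ) * ‖v‖) ^ 2 := pow_le_pow_left₀ hn0 h1 2
      _ = _ := by ring
  have h3 : ‖a - ⟪g, v⟫ • x‖ ^ 2 ≤ (‖a‖ + n) ^ 2 := pow_le_pow_left₀ (norm_nonneg _) (norm_sub_le _ _) 2
  have h4 : 2 * ‖a‖ * n ≤ 1 / μ * ‖a‖ ^ 2 + μ * n ^ 2 := by
    have : 0 ≤ (1 / μ) * (‖a‖ - μ * n) ^ 2 := by positivity
    have e : (1 / μ) * (‖a‖ - μ * n) ^ 2 = 1 / μ * ‖a‖ ^ 2 + μ * n ^ 2 - 2 * ‖a‖ * n := by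
      field_simp; ring
    linarith
  have h5 : (μ + 1) * n ^ 2 ≤ 2 * K ^ 4 * (r ^ 2 / μ) * ‖v‖ ^ 2 := by
    calc (μ + 1) * n ^ 2 ≤ (2 * μ) * (K ^ 4 * (r ^ 2 / μ ^ 2) * ‖v‖ ^ 2) :=
          mul_le_mul (by linarith) h2 (sq_nonneg _) (by positivity)
      _ = _ := by field_simp
  nlinarith

end Estimates

/-! ### Pathwise comparison with few instruments -/

section Dominate

variable {l : ℕ} {E F : Type*} [NormedAddCommGroup E] [InnerProductSpace ℝ E]
  [NormedAddCommGroup F] [InnerProductSpace ℝ F]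

lemma nonneg_of_norm_le_mul {S : E} {t : Fin l → E} {γ : F} {Γ : Fin l → F} (h : FullRank γ Γ)
    {L v₀ : ℝ} {v : EuclideanSpace ℝ (Fin l)} (hv : ¬ (v₀ = 0 ∧ v = 0))
    (hL : ‖v₀ • S + comb t v‖ ^ 2 ≤ L * ‖v₀ • γ + comb Γ v‖ ^ 2) : 0 ≤ L := by
  by_contra hc
  push Not at hc
  have := h.pos hv
  have h2 := sq_nonneg ‖v₀ • S + comb t v‖
  nlinarith

/-- The cross term condition of `dominate` in the proof of `lt_lr_smul`, where `θ = r / μ`. -/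
lemma cross_le {D L e θ μ K p ε q₁ q₂ q₃ : ℝ} (hK1 : 1 ≤ K) (hθ0 : 0 ≤ θ) (hθ1 : θ ≤ 1)
    (heθμ : e * (θ * μ) = ε) (hε1 : ε ≤ 1) (he0 : 0 ≤ e) (he1 : e ≤ 1) (hD0 : 0 ≤ D)
    (hDu : D ≤ 3 * e * (2 * K * θ ^ 2)) (hL0 : 0 ≤ L) (hLu : L ≤ 2 * K * θ ^ 2) (hp0 : 0 ≤ p)
    (i1 : |q₁| ≤ 2 * K * μ * p) (i2 : |q₂| ≤ K ^ 2 * p) (i3 : |q₃| ≤ K ^ 2 * θ * p) :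
    |D * q₁ + (1 + e) * L * q₂ + (1 + e) * q₃| ≤ 18 * K ^ 3 * θ * p := by
  have hK23 : K ^ 2 ≤ K ^ 3 := pow_le_pow_right₀ hK1 (by norm_num)
  have t1 : |D * q₁| ≤ 12 * K ^ 3 * θ * p := by
    rw [abs_mul, abs_of_nonneg hD0]
    calc D * |q₁| ≤ (3 * e * (2 * K * θ ^ 2)) * (2 * K * μ * p) :=
          mul_le_mul hDu i1 (abs_nonneg _) (by positivity)
      _ = 12 * K ^ 2 * (e * (θ * μ)) * θ * p := by ring
      _ ≤ 12 * K ^ 2 * 1 * θ * p := by rw [heθμ]; gcongr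
      _ ≤ 12 * K ^ 3 * θ * p := by rw [mul_one]; gcongr
  have t2 : |(1 + e) * L * q₂| ≤ 4 * K ^ 3 * θ * p := by
    rw [abs_mul, abs_of_nonneg (by positivity)]
    calc (1 + e) * L * |q₂| ≤ (2 * (2 * K * θ ^ 2)) * (K ^ 2 * p) :=
          mul_le_mul (mul_le_mul (by linarith) hLu hL0 (by norm_num)) i2
            (abs_nonneg _) (by positivity)
      _ = 4 * K ^ 3 * (θ * θ) * p := by ring
      _ ≤ 4 * K ^ 3 * (θ * 1) * p := by gcongr
      _ = _ := by ring
  have t3 : |(1 + e) * q₃| ≤ 2 * K ^ 3 * θ * p := by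
    rw [abs_mul, abs_of_nonneg (by positivity)]
    calc (1 + e) * |q₃| ≤ 2 * (K ^ 2 * θ * p) :=
          mul_le_mul (by linarith) i3 (abs_nonneg _) (by norm_num)
      _ = 2 * K ^ 2 * θ * p := by ring
      _ ≤ _ := by gcongr
  calc _ ≤ |D * q₁| + |(1 + e) * L * q₂| + |(1 + e) * q₃| := abs_add_three _ _ _
    _ ≤ 18 * K ^ 3 * θ * p := by linarith

/-- The quadratic term condition of `dominate` in the proof of `lt_lr_smul`, where `θ = r / μ`. -/
lemma quad_ge {D L e θ μ r K p ε c₃ N₁ N₂ b₁ b₂ : ℝ} (hK1 : 1 ≤ K) (hr0 : 0 ≤ r) (hθ0 : 0 ≤ θ)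
    (hrθμ : r = θ * μ) (herθ : e * r = ε)
    (hθ2 : 66 * K ^ 4 * θ ≤ ε * c₃ / 8) (h1μ : 1 / μ ≤ e) (hN2 : 0 ≤ N₂)
    (hn : N₁ ≤ (1 + 1 / μ) * N₂ + 2 * K ^ 4 * (θ * r) * p ^ 2)
    (hDl : e * (c₃ / 2 * θ ^ 2) ≤ D) (hD0 : 0 ≤ D)
    (hLL0 : 0 ≤ (1 + e) * L + D) (hLL : (1 + e) * L + D ≤ 8 * K * θ ^ 2)
    (c2 : μ ^ 2 / 2 * p ^ 2 ≤ b₂) (c1 : |b₁ - b₂| ≤ 8 * K * μ * p ^ 2) :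
    e * (c₃ * r ^ 2 / 8) * p ^ 2 ≤
      (1 + e) * (N₂ - L * b₂) - (N₁ - ((1 + e) * L + D) * b₁) := by
  have q1 : e * c₃ * r ^ 2 / 4 * p ^ 2 ≤ D * b₂ := by
    calc e * c₃ * r ^ 2 / 4 * p ^ 2 = (e * (c₃ / 2 * θ ^ 2)) * (μ ^ 2 / 2 * p ^ 2) := by
          rw [hrθμ]; ring
      _ ≤ D * b₂ := mul_le_mul hDl c2 (by positivity) hD0
  have q2 : -(64 * K ^ 4 * θ * r * p ^ 2) ≤ ((1 + e) * L + D) * (b₁ - b₂) := by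
    have h1 : |((1 + e) * L + D) * (b₁ - b₂)| ≤ (8 * K * θ ^ 2) * (8 * K * μ * p ^ 2) := by
      rw [abs_mul, abs_of_nonneg hLL0]
      exact mul_le_mul hLL c1 (abs_nonneg _) (by positivity)
    have h2 : (8 * K * θ ^ 2) * (8 * K * μ * p ^ 2) = 64 * K ^ 2 * (θ * (θ * μ) * p ^ 2) := by ring
    rw [← hrθμ] at h2
    have h3 : K ^ 2 ≤ K ^ 4 := pow_le_pow_right₀ hK1 (by norm_num)
    have h4 : 64 * K ^ 2 * (θ * r * p ^ 2) ≤ 64 * K ^ 4 * (θ * r * p ^ 2) := by gcongr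
    have := (abs_le.1 h1).1
    linarith
  have q3 : 66 * K ^ 4 * θ * r * p ^ 2 ≤ e * c₃ * r ^ 2 / 8 * p ^ 2 := by
    refine mul_le_mul_of_nonneg_right ?_ (sq_nonneg p)
    calc 66 * K ^ 4 * θ * r ≤ ε * c₃ / 8 * r := mul_le_mul_of_nonneg_right hθ2 hr0
      _ = _ := by rw [← herθ]; ring
  have q4 : 1 / μ * N₂ ≤ e * N₂ := mul_le_mul_of_nonneg_right h1μ hN2
  have q5 : (1 + e) * (N₂ - L * b₂) - (N₁ - ((1 + e) * L + D) * b₁) =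
    (1 + e) * N₂ - N₁ + D * b₂ + ((1 + e) * L + D) * (b₁ - b₂) := by ring
  rw [q5]
  linarith

/-- Comparison with few instruments, where `r = √k` and `μ = √m` satisfy `r / μ ≪ 1`: on regular
events, scaling `S` by `1 + ε / r` outweighs the effect of passing from `t₂` to `t₁`. The scaling
raises the coefficient of `‖comb Γ v‖²` by about `ε r / μ²`, hence the gain of order `ε r` in the
quadratic term. -/
lemma lt_lr_smul {K μ r c c₃ ε y : ℝ} {S x : E} {t₁ t₂ : Fin l → E} {γ : F} {Γ : Fin l → F}
    (hμ : 1 ≤ μ) (hr : 1 ≤ r) (hK1 : 1 ≤ K) (hK : 4 * K ≤ μ) (hrμ : r ≤ μ)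
    (hε : 0 < ε) (hε1 : ε ≤ 1) (hc₃ : 0 < c₃) (hc : 0 < c)
    (hθ : r / μ ≤ ε) (hθ2 : 66 * K ^ 4 * (r / μ) ≤ ε * c₃ / 8)
    (hθ3 : 2 * (18 * K ^ 3 * (r / μ)) ^ 2 < ε ^ 2 * c * c₃ / 16)
    (hnear : Near K μ γ Γ) (hS1 : c₃ * r ^ 2 ≤ ‖S‖ ^ 2) (hS2 : ‖S‖ ^ 2 ≤ K * r ^ 2)
    (hSx : |⟪S, x⟫| ≤ K * r) (hx : ‖x‖ ≤ K * r) (hrel : Rel (K / μ) x t₁ t₂)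
    (hyc : c ≤ y * μ ^ 2) (hy : y ≤ lr S t₂ γ Γ) : y < lr ((1 + ε / r) • S) t₁ γ Γ := by
  have hμ0 : 0 < μ := by linarith
  have hr0 : 0 < r := by linarith
  have hK0 : 0 < K := by linarith
  have hfull := hnear.fullRank hμ0 hK
  obtain ⟨hg1, hg2⟩ := hnear.norm_bounds hμ0 hK
  obtain ⟨v₀, v, hv, hle⟩ := exists_of_le_lr hfull hy
  obtain ⟨H, g, hH, hg, hcomb⟩ := hrel
  have hL0 := nonneg_of_norm_le_mul hfull hv hle
  have hw := hH v
  obtain ⟨i1, i2⟩ := hnear.inner_le hμ hK1 hK hw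
  obtain ⟨c1, c2, c3, -⟩ := hnear.comb_le hμ hK1 hK hw
  have ha1 : comb t₁ (H v) = comb t₂ v - ⟪g, v⟫ • x := by rw [hcomb]; simp
  have hn := norm_sub_smul_sq_le (a := comb t₂ v) (v := v) hμ hK0.le hg hx
  rw [← ha1] at hn
  set e := ε / r with he
  have he0 : 0 < e := by positivity
  have he1 : e ≤ 1 := by rw [he, div_le_one hr0]; linarith
  have hg0 : 0 < ‖γ‖ ^ 2 := lt_of_lt_of_le (by positivity) hg1
  have hγ0 : 0 < ‖γ‖ := by by_contra h0; simp at h0; simp [h0] at hg0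
  have hy0 : 0 < y := by
    by_contra h0; push Not at h0
    have : y * μ ^ 2 ≤ 0 := mul_nonpos_of_nonpos_of_nonneg h0 (sq_nonneg _)
    linarith
  have hS' : ‖(1 + e) • S‖ ^ 2 = (1 + e) ^ 2 * ‖S‖ ^ 2 := by
    rw [norm_smul, mul_pow, Real.norm_eq_abs, sq_abs]
  set p := ‖v‖ with hp
  have hp0 : 0 ≤ p := norm_nonneg _
  set A := ‖S‖ ^ 2 with hA
  set G := ‖γ‖ ^ 2 with hG
  set L := A / G - y with hL
  have hL' : (1 + e) ^ 2 * A / G - y = (1 + e) * L + ((1 + e) * e * (A / G) + e * y) := by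
    rw [hL]; ring
  set D := (1 + e) * e * (A / G) + e * y with hD
  have hAG0 : 0 ≤ A / G := by positivity
  have hAG : A / G ≤ 2 * K * (r ^ 2 / μ ^ 2) := by
    rw [div_le_iff₀ hg0]
    calc A ≤ K * r ^ 2 := hS2
      _ = 2 * K * (r ^ 2 / μ ^ 2) * (μ ^ 2 / 2) := by field_simp
      _ ≤ _ := mul_le_mul_of_nonneg_left hg1 (by positivity)
  have hAGl : c₃ / 2 * (r ^ 2 / μ ^ 2) ≤ A / G := by
    rw [le_div_iff₀ hg0]
    calc c₃ / 2 * (r ^ 2 / μ ^ 2) * G ≤ c₃ / 2 * (r ^ 2 / μ ^ 2) * (2 * μ ^ 2) :=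
          mul_le_mul_of_nonneg_left hg2 (by positivity)
      _ = c₃ * r ^ 2 := by field_simp
      _ ≤ _ := hS1
  have hyAG : y ≤ A / G := by linarith
  have hLAG : L ≤ A / G := by linarith
  have hDl : e * (A / G) ≤ D := by
    have h1 := mul_nonneg (mul_nonneg he0.le he0.le) hAG0
    have h2 := mul_nonneg he0.le hy0.le
    rw [hD]; linarith
  have hDu : D ≤ 3 * e * (A / G) := by
    have h1 : (1 + e) * e * (A / G) ≤ 2 * e * (A / G) := by gcongr; linarith
    have h2 := mul_le_mul_of_nonneg_left hyAG he0.le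
    rw [hD]; linarith
  have hD0 : 0 ≤ D := le_trans (by positivity) hDl
  set θ := r / μ with hθd
  have hθ0 : 0 < θ := by positivity
  have hθ1 : θ ≤ 1 := by rw [hθd, div_le_one hμ0]; exact hrμ
  have hrr : r ^ 2 / μ ^ 2 = θ ^ 2 := by rw [hθd, div_pow]
  rw [hrr] at hAG hAGl
  have herθ : e * r = ε := by rw [he]; field_simp
  have hrθμ : r = θ * μ := by rw [hθd]; field_simp
  have heθμ : e * (θ * μ) = ε := by rw [← hrθμ]; exact herθ
  refine lt_lr_of_exists hfull (v₀ := v₀) (v := H v) ?_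
  have hvp : v₀ ≠ 0 ∨ 0 < p := by
    by_contra hcon
    push Not at hcon
    refine hv ⟨hcon.1, norm_eq_zero.1 (le_antisymm hcon.2 hp0)⟩
  refine dominate (a₂ := comb t₂ v) (b := comb Γ v) (y := y) (e := e) (X := 18 * K ^ 3 * θ)
    (B := c₃ * r ^ 2 / 8) (p := p) hγ0 hγ0 he0 hy0 hp0 hvp hle ?_ ?_ ?_ ?_
  · rw [sub_self]; positivity
  · rw [hS', hL', real_inner_smul_left, ha1, inner_sub_right, real_inner_smul_right]
    have hrw : ((1 + e) * L + D) * ⟪γ, comb Γ (H v)⟫ - (1 + e) * (⟪S, comb t₂ v⟫ - ⟪g, v⟫ * ⟪S, x⟫) -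
        (1 + e) * (L * ⟪γ, comb Γ v⟫ - ⟪S, comb t₂ v⟫) =
        D * ⟪γ, comb Γ (H v)⟫ + (1 + e) * L * (⟪γ, comb Γ (H v)⟫ - ⟪γ, comb Γ v⟫) +
          (1 + e) * (⟪g, v⟫ * ⟪S, x⟫) := by ring
    rw [hrw]
    have h1 : |⟪g, v⟫| ≤ K / μ * p :=
      (abs_real_inner_le_norm g v).trans (mul_le_mul_of_nonneg_right hg hp0)
    refine cross_le hK1 hθ0.le hθ1 heθμ hε1 he0.le he1 hD0
      (hDu.trans (mul_le_mul_of_nonneg_left hAG (by positivity))) hL0 (hLAG.trans hAG) hp0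
      i1 i2 ?_
    rw [abs_mul]
    calc |⟪g, v⟫| * |⟪S, x⟫| ≤ (K / μ * p) * (K * r) := mul_le_mul h1 hSx (abs_nonneg _) (by positivity)
      _ = K ^ 2 * θ * p := by rw [hθd]; ring
  · rw [hS', hL']
    have h1μ : 1 / μ ≤ e := by
      rw [he, div_le_div_iff₀ hμ0 hr0]
      rw [hθd, div_le_iff₀ hμ0] at hθ; linarith
    have hrm : r ^ 2 / μ = θ * r := by rw [hθd]; ring
    rw [hrm] at hn
    refine quad_ge hK1 hr0.le hθ0.le hrθμ herθ hθ2 h1μ (sq_nonneg _) hn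
      ((mul_le_mul_of_nonneg_left hAGl he0.le).trans hDl) hD0 (by positivity) ?_ c2 c1
    rw [← hL']
    have : (1 + e) ^ 2 ≤ 2 ^ 2 := by gcongr; linarith
    have h3 := mul_le_mul_of_nonneg_right this hAG0
    rw [mul_div_assoc]; linarith
  · have hyG : c / 2 ≤ y * G := by
      have := mul_le_mul_of_nonneg_left hg1 hy0.le
      linarith
    calc 2 * (18 * K ^ 3 * θ) ^ 2 < ε ^ 2 * c * c₃ / 16 := hθ3
      _ = e ^ 2 * (c / 2) * (c₃ * r ^ 2 / 8) := by rw [← herθ]; ring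
      _ ≤ _ := by gcongr

end Dominate

/-! ### Pathwise comparison with strong instruments -/

section DominateStretch

/-- The cross term condition of `dominate` in the proof of `lt_lr_stretch`, where `θ = r / μ`. -/
lemma strong_cross_le {D L ε θ μ κ K p q₁ q₂ q₃ : ℝ} (hμ : 1 ≤ μ) (hK1 : 1 ≤ K) (hκ : 1 ≤ κ)
    (hθκ : θ ≤ κ) (hε0 : 0 ≤ ε) (hε1 : ε ≤ 1)
    (hD : |D| ≤ 24 * K ^ 2 * κ ^ 2 / μ ^ 2) (hL0 : 0 ≤ L) (hLu : L ≤ 4 * K * κ ^ 2)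
    (hp0 : 0 ≤ p) (i1 : |q₁| ≤ 2 * K * μ * p) (i2 : |q₂| ≤ K ^ 2 * p) (i3 : |q₃| ≤ K ^ 2 * θ * p) :
    |(1 + ε) * (D * q₁ + L * q₂ + q₃)| ≤ 106 * K ^ 3 * κ ^ 2 * p := by
  have hK23 : K ^ 2 ≤ K ^ 3 := pow_le_pow_right₀ hK1 (by norm_num)
  have hμ0 : 0 < μ := by linarith
  have t1 : |D * q₁| ≤ 48 * K ^ 3 * κ ^ 2 * p := by
    rw [abs_mul]
    calc |D| * |q₁| ≤ (24 * K ^ 2 * κ ^ 2 / μ ^ 2) * (2 * K * μ * p) :=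
          mul_le_mul hD i1 (abs_nonneg _) (by positivity)
      _ = 48 * K ^ 3 * κ ^ 2 * p * (1 / μ) := by field_simp; ring
      _ ≤ 48 * K ^ 3 * κ ^ 2 * p * 1 := by
          gcongr; rw [div_le_one hμ0]; exact hμ
      _ = _ := mul_one _
  have t2 : |L * q₂| ≤ 4 * K ^ 3 * κ ^ 2 * p := by
    rw [abs_mul, abs_of_nonneg hL0]
    calc L * |q₂| ≤ (4 * K * κ ^ 2) * (K ^ 2 * p) :=
          mul_le_mul hLu i2 (abs_nonneg _) (by positivity)
      _ = _ := by ring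
  have t3 : |q₃| ≤ K ^ 3 * κ ^ 2 * p := by
    have : κ ≤ κ ^ 2 := by nlinarith
    calc |q₃| ≤ K ^ 2 * θ * p := i3
      _ ≤ K ^ 3 * κ ^ 2 * p := by
        refine mul_le_mul_of_nonneg_right ?_ hp0
        calc K ^ 2 * θ ≤ K ^ 2 * κ ^ 2 := by gcongr; linarith
          _ ≤ _ := by gcongr
  rw [abs_mul, abs_of_nonneg (by positivity)]
  calc (1 + ε) * |D * q₁ + L * q₂ + q₃| ≤ 2 * (|D * q₁| + |L * q₂| + |q₃|) :=
        mul_le_mul (by linarith) (abs_add_three _ _ _) (abs_nonneg _) (by norm_num)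
    _ ≤ _ := by linarith

lemma const_sum_le {K κ : ℝ} (hK1 : 1 ≤ K) (hκ : 1 ≤ κ) :
    κ + 9 * K ^ 2 * κ + 2 * K ^ 4 * κ + 32 * K ^ 2 * κ + 192 * K ^ 2 * κ ^ 2 ≤
      236 * K ^ 4 * κ ^ 2 := by
  have h0 : κ ≤ κ ^ 2 := by nlinarith
  have h1 : K ^ 2 ≤ K ^ 4 := pow_le_pow_right₀ hK1 (by norm_num)
  have h2 : 1 ≤ K ^ 4 := one_le_pow₀ hK1
  have k1 : K ^ 2 * κ ≤ K ^ 4 * κ ^ 2 := mul_le_mul h1 h0 (by linarith) (by positivity)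
  have k2 : K ^ 4 * κ ≤ K ^ 4 * κ ^ 2 := by gcongr
  have k3 : K ^ 2 * κ ^ 2 ≤ K ^ 4 * κ ^ 2 := by gcongr
  have k4 : 1 * κ ≤ K ^ 4 * κ ^ 2 := mul_le_mul h2 h0 (by linarith) (by positivity)
  linarith

/-- The quadratic term condition of `dominate` in the proof of `lt_lr_stretch`, where `θ = r / μ`.
-/
lemma strong_quad_ge {D L ε θ μ κ r a K p N₁ N₂ b₁ b₂ : ℝ} (hμ : 1 ≤ μ) (hr : 1 ≤ r) (hK1 : 1 ≤ K)
    (hκ : 1 ≤ κ) (hθκ : θ ≤ κ) (hrθμ : r = θ * μ) (hε1 : ε ≤ 1)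
    (ha0 : 0 ≤ a)
    (hμε : 1 / μ ≤ ε / 4) (haε : 236 * K ^ 4 * κ ^ 2 ≤ ε * a / 4)
    (hN2 : (r ^ 2 + a * r) * p ^ 2 ≤ N₂)
    (hn : N₁ ≤ (1 + 1 / μ) * N₂ + 2 * K ^ 4 * (θ * r) * p ^ 2)
    (hD : |D| ≤ 24 * K ^ 2 * κ ^ 2 / μ ^ 2) (hL0 : 0 ≤ L) (hLu : L ≤ 4 * K * θ ^ 2)
    (hLb : L * b₂ ≤ (r ^ 2 + 9 * K ^ 2 * κ * r) * p ^ 2)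
    (c1 : |b₁ - b₂| ≤ 8 * K * μ * p ^ 2) (c3 : b₁ ≤ 8 * μ ^ 2 * p ^ 2) (hb1 : 0 ≤ b₁) :
    ε * (a * r / 2) * p ^ 2 ≤ (1 + ε) * (N₂ - L * b₂) - (N₁ - (L + D) * b₁) := by
  have hμ0 : 0 < μ := by linarith
  have hr0 : 0 < r := by linarith
  have hε0 : 0 ≤ ε := by
    have : 0 < 1 / μ := by positivity
    linarith
  have hP : 0 ≤ r * p ^ 2 := by positivity
  have q1 : -(32 * K ^ 2 * κ * (r * p ^ 2)) ≤ L * (b₁ - b₂) := by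
    have h1 : |L * (b₁ - b₂)| ≤ (4 * K * θ ^ 2) * (8 * K * μ * p ^ 2) := by
      rw [abs_mul, abs_of_nonneg hL0]
      exact mul_le_mul hLu c1 (abs_nonneg _) (by positivity)
    have h2 : (4 * K * θ ^ 2) * (8 * K * μ * p ^ 2) = 32 * K ^ 2 * θ * ((θ * μ) * p ^ 2) := by ring
    rw [← hrθμ] at h2
    have h3 : 32 * K ^ 2 * θ * (r * p ^ 2) ≤ 32 * K ^ 2 * κ * (r * p ^ 2) := by gcongr
    have := (abs_le.1 h1).1
    linarith only [this, h2, h3]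
  have q2 : -(192 * K ^ 2 * κ ^ 2 * (r * p ^ 2)) ≤ D * b₁ := by
    have h1 : |D * b₁| ≤ (24 * K ^ 2 * κ ^ 2 / μ ^ 2) * (8 * μ ^ 2 * p ^ 2) := by
      rw [abs_mul, abs_of_nonneg hb1]
      exact mul_le_mul hD c3 hb1 (by positivity)
    have h2 : (24 * K ^ 2 * κ ^ 2 / μ ^ 2) * (8 * μ ^ 2 * p ^ 2) = 192 * K ^ 2 * κ ^ 2 * (1 * p ^ 2) := by
      field_simp; ring
    have h3 : 192 * K ^ 2 * κ ^ 2 * (1 * p ^ 2) ≤ 192 * K ^ 2 * κ ^ 2 * (r * p ^ 2) := by gcongr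
    have := (abs_le.1 h1).1
    linarith only [this, h2, h3]
  have q3 : (ε - 1 / μ) * ((r ^ 2 + a * r) * p ^ 2) ≤ (ε - 1 / μ) * N₂ :=
    mul_le_mul_of_nonneg_left hN2 (by linarith)
  have q4 : 1 / μ * (r ^ 2 * p ^ 2) ≤ κ * (r * p ^ 2) := by
    calc 1 / μ * (r ^ 2 * p ^ 2) = θ * (r * p ^ 2) := by rw [hrθμ]; field_simp
      _ ≤ _ := by gcongr
  have q5 : 1 / μ * (a * (r * p ^ 2)) ≤ ε / 4 * (a * (r * p ^ 2)) := by gcongr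
  have q6 : ε * (L * b₂) ≤ ε * (r ^ 2 * p ^ 2) + 9 * K ^ 2 * κ * (r * p ^ 2) := by
    have h1 := mul_le_mul_of_nonneg_left hLb hε0
    have h2 : ε * (9 * K ^ 2 * κ * (r * p ^ 2)) ≤ 1 * (9 * K ^ 2 * κ * (r * p ^ 2)) := by gcongr
    linarith only [h1, h2]
  have q7 : 2 * K ^ 4 * (θ * r) * p ^ 2 ≤ 2 * K ^ 4 * κ * (r * p ^ 2) := by
    calc 2 * K ^ 4 * (θ * r) * p ^ 2 = 2 * K ^ 4 * θ * (r * p ^ 2) := by ring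
      _ ≤ _ := by gcongr
  have k5 : (κ + 9 * K ^ 2 * κ + 2 * K ^ 4 * κ + 32 * K ^ 2 * κ + 192 * K ^ 2 * κ ^ 2) * (r * p ^ 2) ≤
      ε * a / 4 * (r * p ^ 2) :=
    mul_le_mul_of_nonneg_right ((const_sum_le hK1 hκ).trans haε) hP
  have e1 : (1 + ε) * (N₂ - L * b₂) - (N₁ - (L + D) * b₁) =
      (1 + ε) * N₂ - N₁ - ε * (L * b₂) + L * (b₁ - b₂) + D * b₁ := by ring
  have hh : 0 ≤ ε * a / 4 * (r * p ^ 2) := by positivity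
  rw [e1]
  linarith only [q1, q2, q3, q4, q5, q6, q7, k5, hh, hn]

variable {l : ℕ} {E F : Type*} [NormedAddCommGroup E] [InnerProductSpace ℝ E]
  [NormedAddCommGroup F] [InnerProductSpace ℝ F]

lemma exists_comb_of_mem_span {t : Fin l → E} {a : E} (ha : a ∈ Submodule.span ℝ (Set.range t)) :
    ∃ v, comb t v = a := by
  obtain ⟨c, hc⟩ := (Submodule.mem_span_range_iff_exists_fun ℝ).1 ha
  exact ⟨WithLp.toLp 2 c, by rw [comb_apply]; exact hc⟩

variable [FiniteDimensional ℝ E] [FiniteDimensional ℝ F]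

lemma norm_stretch_sq (U : Submodule ℝ E) (e : ℝ) (S : E) :
    ‖stretch U e S‖ ^ 2 = ‖S‖ ^ 2 + (2 * e + e ^ 2) * ‖U.starProjection S‖ ^ 2 := by
  have h1 : ⟪S, U.starProjection S⟫ = ‖U.starProjection S‖ ^ 2 := by
    rw [← real_inner_self_eq_norm_sq, Submodule.inner_starProjection_left_eq_right,
      Submodule.starProjection_eq_self_iff.2 (Submodule.starProjection_apply_mem U S)]
  rw [stretch, norm_add_sq_real, real_inner_smul_right, h1, norm_smul, mul_pow, Real.norm_eq_abs,
    sq_abs]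
  ring

lemma inner_stretch (U : Submodule ℝ E) (e : ℝ) (S : E) {a : E} (ha : a ∈ U) :
    ⟪stretch U e S, a⟫ = (1 + e) * ⟪S, a⟫ := by
  rw [stretch, inner_add_left, real_inner_smul_left, Submodule.inner_starProjection_left_eq_right,
    Submodule.starProjection_eq_self_iff.2 ha]
  ring

lemma FullRank.stretch {γ : F} {Γ : Fin l → F} (h : FullRank γ Γ) (e : ℝ) :
    FullRank (stretch (Submodule.span ℝ (Set.range Γ)) e γ) Γ := by
  intro v₀ v h0
  obtain ⟨w, hw⟩ := exists_comb_of_mem_span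
    (Submodule.starProjection_apply_mem (Submodule.span ℝ (Set.range Γ)) γ)
  have h1 : v₀ • γ + comb Γ (v + (v₀ * e) • w) = 0 := by
    rw [map_add, map_smul, hw, ← h0, MCLR.stretch, smul_add, smul_smul]; abel
  obtain ⟨h2, h3⟩ := h _ _ h1
  refine ⟨h2, ?_⟩
  rw [h2] at h3; simpa using h3

/-- Comparison with strong instruments, where `r = √k` and `μ = √m` may be of the same order: on
regular events, stretching `S` along the span of `t₁` and `γ` along the span of `Γ` by `1 + ε`
outweighs the effect of passing from `t₂` to `t₁`. The stretch multiplies the inner products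
`⟪S, t₁ i⟫` and `⟪γ, Γ i⟫` by `1 + ε`, and leaves `‖S‖² / ‖γ‖²` nearly fixed. The quadratic gain
`ε (‖comb t₂ v‖² - L ‖comb Γ v‖²)` is at least of order `ε a r ‖v‖²`, since `L ‖comb Γ v‖²` is about
`r² ‖v‖²`. -/
lemma lt_lr_stretch {K μ r κ a c ε y : ℝ} {S x : E} {t₁ t₂ : Fin l → E} {γ : F} {Γ : Fin l → F}
    (hμ : 1 ≤ μ) (hr : 1 ≤ r) (hK1 : 1 ≤ K) (hK : 12 * K ≤ μ) (hκ : 1 ≤ κ) (hrμ : r ≤ κ * μ)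
    (hε : 0 < ε) (hε1 : ε ≤ 1) (hc : 0 < c) (ha0 : 0 ≤ a)
    (hμε : 1 / μ ≤ ε / 4) (haε : 236 * K ^ 4 * κ ^ 2 ≤ ε * a / 4)
    (haX : 2 * (106 * K ^ 3 * κ ^ 2) ^ 2 < ε ^ 2 * (c / 2) * (a / 2))
    (hnear : Near K μ γ Γ) (hS : |‖S‖ ^ 2 - r ^ 2| ≤ K * r)
    (hPS : ‖(Submodule.span ℝ (Set.range t₁)).starProjection S‖ ^ 2 ≤ K)
    (hPγ : ‖(Submodule.span ℝ (Set.range Γ)).starProjection γ‖ ^ 2 ≤ K)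
    (hSx : |⟪S, x⟫| ≤ K * r) (hx : ‖x‖ ≤ K * r) (hrel : Rel (K / μ) x t₁ t₂)
    (ht₂ : ∀ v, (r ^ 2 + a * r) * ‖v‖ ^ 2 ≤ ‖comb t₂ v‖ ^ 2)
    (hyc : c ≤ y * μ ^ 2) (hy : y ≤ lr S t₂ γ Γ) :
    y < lr (stretch (Submodule.span ℝ (Set.range t₁)) ε S) t₁
      (stretch (Submodule.span ℝ (Set.range Γ)) ε γ) Γ := by
  have hμ0 : 0 < μ := by linarith
  have hr0 : 0 < r := by linarith
  have hK0 : 0 < K := by linarith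
  have hK4 : 4 * K ≤ μ := by linarith
  have hfull := hnear.fullRank hμ0 hK4
  obtain ⟨hg1, hg2⟩ := hnear.norm_bounds hμ0 hK4
  obtain ⟨v₀, v, hv, hle⟩ := exists_of_le_lr hfull hy
  obtain ⟨H, g, hH, hg, hcomb⟩ := hrel
  have hL0 := nonneg_of_norm_le_mul hfull hv hle
  have hw := hH v
  obtain ⟨i1, i2⟩ := hnear.inner_le hμ hK1 hK4 hw
  obtain ⟨c1, c2, c3, c4⟩ := hnear.comb_le hμ hK1 hK4 hw
  have ha1 : comb t₁ (H v) = comb t₂ v - ⟪g, v⟫ • x := by rw [hcomb]; simp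
  have hn := norm_sub_smul_sq_le (a := comb t₂ v) (v := v) hμ hK0.le hg hx
  rw [← ha1] at hn
  have hg0 : 0 < ‖γ‖ ^ 2 := lt_of_lt_of_le (by positivity) hg1
  have hγ0 : 0 < ‖γ‖ := by by_contra h0; simp at h0; simp [h0] at hg0
  have hy0 : 0 < y := by
    by_contra h0; push Not at h0
    have : y * μ ^ 2 ≤ 0 := mul_nonpos_of_nonpos_of_nonneg h0 (sq_nonneg _)
    linarith
  have hS' := norm_stretch_sq (Submodule.span ℝ (Set.range t₁)) ε S
  have hγ' := norm_stretch_sq (Submodule.span ℝ (Set.range Γ)) ε γ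
  have hSi := inner_stretch (Submodule.span ℝ (Set.range t₁)) ε S (comb_mem_span t₁ (H v))
  have hγi := inner_stretch (Submodule.span ℝ (Set.range Γ)) ε γ (comb_mem_span Γ (H v))
  have hfull' := hfull.stretch ε
  set S' := stretch (Submodule.span ℝ (Set.range t₁)) ε S
  set γ' := stretch (Submodule.span ℝ (Set.range Γ)) ε γ
  set π₁ := ‖(Submodule.span ℝ (Set.range t₁)).starProjection S‖ ^ 2
  set π₂ := ‖(Submodule.span ℝ (Set.range Γ)).starProjection γ‖ ^ 2
  have hπ1 : 0 ≤ π₁ := sq_nonneg _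
  have hπ2 : 0 ≤ π₂ := sq_nonneg _
  have hη0 : 0 ≤ 2 * ε + ε ^ 2 := by positivity
  have hη : 2 * ε + ε ^ 2 ≤ 3 * ε := by linarith only [mul_le_mul_of_nonneg_left hε1 hε.le]
  set p := ‖v‖ with hp
  have hp0 : 0 ≤ p := norm_nonneg _
  set A := ‖S‖ ^ 2 with hA
  set G := ‖γ‖ ^ 2 with hG
  set A' := ‖S'‖ ^ 2 with hA'
  set G' := ‖γ'‖ ^ 2 with hG'
  have hA0 : 0 ≤ A := sq_nonneg _
  have hA1 : A ≤ A' := by rw [hS']; linarith only [mul_nonneg hη0 hπ1]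
  have hA2 : A' ≤ A + 3 * K := by
    have : (2 * ε + ε ^ 2) * π₁ ≤ 3 * K := mul_le_mul (by linarith) hPS hπ1 (by norm_num)
    linarith
  have hG1 : G ≤ G' := by rw [hγ']; linarith only [mul_nonneg hη0 hπ2]
  have hG2 : G' ≤ G + 3 * ε * K := by
    have : (2 * ε + ε ^ 2) * π₂ ≤ 3 * ε * K := mul_le_mul hη hPγ hπ2 (by positivity)
    linarith
  have hG0' : 0 < G' := lt_of_lt_of_le hg0 hG1
  have hγ0' : 0 < ‖γ'‖ := by
    rcases eq_or_lt_of_le (norm_nonneg γ') with h0 | h0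
    · rw [hG', ← h0] at hG0'; simp at hG0'
    · exact h0
  set L := A / G - y with hL
  set D := A' / G' - A / G with hD
  have hL' : A' / G' - y = L + D := by rw [hL, hD]; ring
  set θ := r / μ with hθd
  have hθ0 : 0 < θ := by positivity
  have hθκ : θ ≤ κ := by rw [hθd, div_le_iff₀ hμ0]; exact hrμ
  have hrθμ : r = θ * μ := by rw [hθd]; field_simp
  have hSb := abs_le.1 hS
  have hAr : A ≤ 2 * K * r ^ 2 := by
    have h1 : 1 * r ^ 2 ≤ K * r ^ 2 := by gcongr
    have h2 : K * (r * 1) ≤ K * (r * r) := by gcongr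
    linarith only [h1, h2, hSb.2]
  have hAG0 : 0 ≤ A / G := by positivity
  have hAG : A / G ≤ 4 * K * θ ^ 2 := by
    rw [div_le_iff₀ hg0]
    calc A ≤ 2 * K * r ^ 2 := hAr
      _ = 4 * K * θ ^ 2 * (μ ^ 2 / 2) := by rw [hrθμ]; ring
      _ ≤ _ := mul_le_mul_of_nonneg_left hg1 (by positivity)
  have hLAG : L ≤ A / G := by linarith
  have hDabs : |D| ≤ 24 * K ^ 2 * κ ^ 2 / μ ^ 2 := by
    rw [abs_le]
    constructor
    · have h1 : A / G' - A / G ≤ D := by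
        rw [hD]; gcongr
      have h2 : A / G' - A / G = -(A / G * ((G' - G) / G')) := by field_simp; ring
      have h3 : (G' - G) / G' ≤ 6 * K / μ ^ 2 := by
        rw [div_le_div_iff₀ hG0' (by positivity)]
        have : G' - G ≤ 3 * K := by
          have : 3 * ε * K ≤ 3 * 1 * K := by gcongr
          linarith only [this, hG2]
        calc (G' - G) * μ ^ 2 ≤ 3 * K * (2 * G') := by
              refine mul_le_mul this (by linarith) (by positivity) (by positivity)
          _ = _ := by ring
      have h4 : A / G * ((G' - G) / G') ≤ (4 * K * κ ^ 2) * (6 * K / μ ^ 2) := by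
        refine mul_le_mul (hAG.trans ?_) h3 (div_nonneg (by linarith) hG0'.le) (by positivity)
        gcongr
      have h5 : (4 * K * κ ^ 2) * (6 * K / μ ^ 2) = 24 * K ^ 2 * κ ^ 2 / μ ^ 2 := by ring
      linarith
    · have h1 : D ≤ A' / G - A / G := by
        rw [hD]; gcongr
      rw [← sub_div] at h1
      refine h1.trans ?_
      rw [div_le_div_iff₀ hg0 (by positivity)]
      have h2 : 1 ≤ K * κ ^ 2 := by
        have := one_le_pow₀ hκ (n := 2)
        exact one_le_mul_of_one_le_of_one_le hK1 this
      calc (A' - A) * μ ^ 2 ≤ (3 * K) * (2 * G) := by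
            refine mul_le_mul (by linarith) (by linarith) (by positivity) (by positivity)
        _ = 6 * K * G * 1 := by ring
        _ ≤ 6 * K * G * (K * κ ^ 2) := by gcongr
        _ ≤ 24 * K ^ 2 * κ ^ 2 * G := by linarith only [show 0 ≤ K ^ 2 * κ ^ 2 * G by positivity]
  refine lt_lr_of_exists hfull' (v₀ := v₀) (v := H v) ?_
  have hvp : v₀ ≠ 0 ∨ 0 < p := by
    by_contra hcon
    push Not at hcon
    refine hv ⟨hcon.1, norm_eq_zero.1 (le_antisymm hcon.2 hp0)⟩
  refine dominate (a₂ := comb t₂ v) (b := comb Γ v) (y := y) (e := ε) (X := 106 * K ^ 3 * κ ^ 2)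
    (B := a * r / 2) (p := p) hγ0 hγ0' hε hy0 hp0 hvp hle ?_ ?_ ?_ ?_
  · have h1 : 12 * K ≤ μ ^ 2 := by linarith only [mul_le_mul_of_nonneg_left hμ hμ0.le, hK]
    have : ε * (6 * K) ≤ ε * (μ ^ 2 / 2) := by gcongr; linarith
    have h3 : ε * (μ ^ 2 / 2) ≤ ε * G := by gcongr
    linarith
  · rw [hL', hSi, hγi, ha1, inner_sub_right, real_inner_smul_right]
    have hrw : (L + D) * ((1 + ε) * ⟪γ, comb Γ (H v)⟫) -
          (1 + ε) * (⟪S, comb t₂ v⟫ - ⟪g, v⟫ * ⟪S, x⟫) -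
        (1 + ε) * (L * ⟪γ, comb Γ v⟫ - ⟪S, comb t₂ v⟫) =
        (1 + ε) * (D * ⟪γ, comb Γ (H v)⟫ + L * (⟪γ, comb Γ (H v)⟫ - ⟪γ, comb Γ v⟫) +
          ⟪g, v⟫ * ⟪S, x⟫) := by ring
    rw [hrw]
    have h1 : |⟪g, v⟫| ≤ K / μ * p :=
      (abs_real_inner_le_norm g v).trans (mul_le_mul_of_nonneg_right hg hp0)
    refine strong_cross_le hμ hK1 hκ hθκ hε.le hε1 hDabs hL0 ((hLAG.trans hAG).trans (by gcongr)) hp0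
      i1 i2 ?_
    rw [abs_mul]
    calc |⟪g, v⟫| * |⟪S, x⟫| ≤ (K / μ * p) * (K * r) := mul_le_mul h1 hSx (abs_nonneg _) (by positivity)
      _ = K ^ 2 * θ * p := by rw [hθd]; ring
  · rw [hL']
    have hrm : r ^ 2 / μ = θ * r := by rw [hθd]; ring
    rw [hrm] at hn
    refine strong_quad_ge hμ hr hK1 hκ hθκ hrθμ hε1 ha0 hμε haε (ht₂ v) hn hDabs hL0
      (hLAG.trans hAG) ?_ c1 c3 (sq_nonneg _)
    have h1 : A / G * (μ ^ 2 + K * μ) ≤ r ^ 2 + 9 * K ^ 2 * κ * r := by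
      have hGl : μ ^ 2 - K * μ ≤ G := by have := (abs_le.1 hnear.norm).1; linarith
      have h2 : (μ ^ 2 + K * μ) ≤ (1 + 4 * K / μ) * G := by
        calc μ ^ 2 + K * μ ≤ (1 + 4 * K / μ) * (μ ^ 2 - K * μ) := by
              have : (1 + 4 * K / μ) * (μ ^ 2 - K * μ) = μ ^ 2 + 3 * K * μ - 4 * K ^ 2 := by
                field_simp; ring
              rw [this]; linarith only [mul_le_mul_of_nonneg_left hK4 hK0.le, mul_pos hK0 hμ0]
          _ ≤ _ := mul_le_mul_of_nonneg_left hGl (by positivity)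
      calc A / G * (μ ^ 2 + K * μ) ≤ A / G * ((1 + 4 * K / μ) * G) := by gcongr
        _ = A * (1 + 4 * K / μ) := by field_simp
        _ ≤ (r ^ 2 + K * r) * (1 + 4 * K / μ) := by
            refine mul_le_mul_of_nonneg_right (by linarith) (by positivity)
        _ = r ^ 2 + K * r + 4 * K * θ * r + 4 * K ^ 2 * θ := by rw [hθd]; ring
        _ ≤ _ := by
            have k1 : 4 * K * θ * r ≤ 4 * K ^ 2 * κ * r := by
              have : K ≤ K ^ 2 := by linarith only [mul_le_mul_of_nonneg_left hK1 hK0.le]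
              gcongr
            have k2 : 4 * K ^ 2 * θ ≤ 4 * K ^ 2 * κ * r := by
              calc 4 * K ^ 2 * θ ≤ 4 * K ^ 2 * κ := by gcongr
                _ = 4 * K ^ 2 * κ * 1 := by ring
                _ ≤ _ := by gcongr
            have k3 : K * r ≤ K ^ 2 * κ * r := by
              refine mul_le_mul_of_nonneg_right ?_ hr0.le
              have h5 : K * 1 ≤ K * (K * κ) :=
                mul_le_mul_of_nonneg_left (one_le_mul_of_one_le_of_one_le hK1 hκ) hK0.le
              linarith only [h5]
            linarith
    calc L * ‖comb Γ v‖ ^ 2 ≤ A / G * ((μ ^ 2 + K * μ) * p ^ 2) :=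
          mul_le_mul hLAG c4 (sq_nonneg _) hAG0
      _ = A / G * (μ ^ 2 + K * μ) * p ^ 2 := by ring
      _ ≤ _ := mul_le_mul_of_nonneg_right h1 (sq_nonneg _)
  · have hyG : c / 2 ≤ y * G := by
      have := mul_le_mul_of_nonneg_left hg1 hy0.le
      linarith
    calc 2 * (106 * K ^ 3 * κ ^ 2) ^ 2 < ε ^ 2 * (c / 2) * (a / 2) := haX
      _ ≤ ε ^ 2 * (y * G) * (a * r / 2) := by
          gcongr
          linarith only [mul_le_mul_of_nonneg_left hr ha0]

end DominateStretch

/-! ### Entrywise regularity of the Gram matrix -/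

section Gram

variable {l : ℕ} {F : Type*} [NormedAddCommGroup F] [InnerProductSpace ℝ F]

/-- The entrywise, hence measurable, form of `Near`. -/
def GramNear (K μ : ℝ) (γ : F) (Γ : Fin l → F) : Prop :=
  |‖γ‖ ^ 2 - μ ^ 2| ≤ K * μ ∧ (∀ i, |⟪γ, Γ i⟫| ≤ K * μ) ∧ (∀ i, |‖Γ i‖ ^ 2 - μ ^ 2| ≤ K * μ) ∧
    ∀ i j, i ≠ j → |⟪Γ i, Γ j⟫| ≤ K * μ

lemma measurableSet_gramNear [FiniteDimensional ℝ F] [MeasurableSpace F] [BorelSpace F]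
    {Ω : Type*} [MeasurableSpace Ω] (K μ : ℝ)
    {γ : Ω → F} {Γ : Ω → Fin l → F} (hγ : Measurable γ) (hΓ : Measurable Γ) :
    MeasurableSet {ω | GramNear K μ (γ ω) (Γ ω)} := by
  have hΓi : ∀ i, Measurable fun ω ↦ Γ ω i := fun i ↦ (measurable_pi_apply i).comp hΓ
  have : {ω | GramNear K μ (γ ω) (Γ ω)} = {ω | |‖γ ω‖ ^ 2 - μ ^ 2| ≤ K * μ} ∩
      ((⋂ i, {ω | |⟪γ ω, Γ ω i⟫| ≤ K * μ}) ∩ ((⋂ i, {ω | |‖Γ ω i‖ ^ 2 - μ ^ 2| ≤ K * μ}) ∩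
        ⋂ i, ⋂ j, ⋂ (_ : i ≠ j), {ω | |⟪Γ ω i, Γ ω j⟫| ≤ K * μ})) := by
    ext ω; simp [GramNear]
  rw [this]
  refine (measurableSet_le (by fun_prop) (by fun_prop)).inter
    ((MeasurableSet.iInter fun i ↦ measurableSet_le ?_ (by fun_prop)).inter
    ((MeasurableSet.iInter fun i ↦ measurableSet_le ?_ (by fun_prop)).inter
    (MeasurableSet.iInter fun i ↦ MeasurableSet.iInter fun j ↦ MeasurableSet.iInter fun _ ↦
      measurableSet_le ?_ (by fun_prop))))
  · have := hΓi i; fun_prop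
  · have := hΓi i; fun_prop
  · have := hΓi i; have := hΓi j; fun_prop

lemma GramNear.near {K μ : ℝ} {γ : F} {Γ : Fin l → F} (h : GramNear K μ γ Γ) :
    Near ((l + 1) ^ 2 * K) μ γ Γ := by
  obtain ⟨h1, h2, h3, h4⟩ := h
  have hKμ : 0 ≤ K * μ := (abs_nonneg _).trans h1
  have hl : (0 : ℝ) ≤ l := Nat.cast_nonneg l
  have hv : ∀ (v : EuclideanSpace ℝ (Fin l)) i, |v i| ≤ ‖v‖ := fun v i ↦ by
    simpa using PiLp.norm_apply_le v i
  refine ⟨h1.trans ?_, fun v ↦ ?_, fun v ↦ ?_⟩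
  · nlinarith [mul_nonneg hl hKμ, mul_nonneg (mul_nonneg hl hl) hKμ]
  · rw [comb_apply, inner_sum]
    calc |∑ i, ⟪γ, v i • Γ i⟫| ≤ ∑ i, |⟪γ, v i • Γ i⟫| := Finset.abs_sum_le_sum_abs _ _
      _ ≤ ∑ i : Fin l, K * μ * ‖v‖ := by
          refine Finset.sum_le_sum fun i _ ↦ ?_
          rw [real_inner_smul_right, abs_mul, mul_comm]
          exact mul_le_mul (h2 i) (hv v i) (abs_nonneg _) hKμ
      _ = l * (K * μ * ‖v‖) := by simp
      _ ≤ ((l + 1) ^ 2) * (K * μ * ‖v‖) := by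
          refine mul_le_mul_of_nonneg_right ?_ (by positivity)
          nlinarith
      _ = _ := by ring
  · have e : ‖comb Γ v‖ ^ 2 - μ ^ 2 * ‖v‖ ^ 2 =
        ∑ i, ∑ j, v i * v j * (⟪Γ i, Γ j⟫ - if i = j then μ ^ 2 else 0) := by
      rw [← real_inner_self_eq_norm_sq, comb_apply, sum_inner, EuclideanSpace.real_norm_sq_eq,
        Finset.mul_sum, ← Finset.sum_sub_distrib]
      refine Finset.sum_congr rfl fun i _ ↦ ?_
      simp_rw [mul_sub, Finset.sum_sub_distrib, inner_sum, real_inner_smul_left, real_inner_smul_right]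
      simp [mul_assoc]
      ring
    rw [e]
    calc _ ≤ ∑ i, |∑ j, v i * v j * (⟪Γ i, Γ j⟫ - if i = j then μ ^ 2 else 0)| :=
          Finset.abs_sum_le_sum_abs _ _
      _ ≤ ∑ i, ∑ j, |v i * v j * (⟪Γ i, Γ j⟫ - if i = j then μ ^ 2 else 0)| :=
          Finset.sum_le_sum fun i _ ↦ Finset.abs_sum_le_sum_abs _ _
      _ ≤ ∑ i : Fin l, ∑ j : Fin l, ‖v‖ * ‖v‖ * (K * μ) := by
          refine Finset.sum_le_sum fun i _ ↦ Finset.sum_le_sum fun j _ ↦ ?_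
          rw [abs_mul, abs_mul]
          refine mul_le_mul (mul_le_mul (hv v i) (hv v j) (abs_nonneg _) (norm_nonneg _)) ?_
            (abs_nonneg _) (by positivity)
          split_ifs with hij
          · subst hij; rw [real_inner_self_eq_norm_sq]; exact h3 i
          · rw [sub_zero]; exact h4 i j hij
      _ = (l : ℝ) ^ 2 * (K * μ * ‖v‖ ^ 2) := by simp; ring
      _ ≤ ((l + 1) ^ 2) * (K * μ * ‖v‖ ^ 2) := by
          refine mul_le_mul_of_nonneg_right ?_ (by positivity)
          nlinarith
      _ = _ := by ring

end Gram

/-! ### The Gaussian model -/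

section Model

variable {l : ℕ} {E F : Type*} [NormedAddCommGroup E] [InnerProductSpace ℝ E] [FiniteDimensional ℝ E]
  [MeasurableSpace E] [BorelSpace E]
  [NormedAddCommGroup F] [InnerProductSpace ℝ F] [FiniteDimensional ℝ F]
  [MeasurableSpace F] [BorelSpace F]

variable (l E F) in
/-- The joint law of `(Γ, S, γ)`, which are independent with standard normal columns. -/
noncomputable def model : Measure ((Fin l → F) × E × F) :=
  (Measure.pi fun _ : Fin l ↦ stdGaussian F).prod ((stdGaussian E).prod (stdGaussian F))

instance : IsProbabilityMeasure (model l E F) := by unfold model; infer_instance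

lemma measurePreserving_gamma :
    MeasurePreserving (fun ω : (Fin l → F) × E × F ↦ ω.2.2) (model l E F) (stdGaussian F) :=
  (measurePreserving_snd (μ := stdGaussian E)).comp measurePreserving_snd

lemma measurePreserving_S :
    MeasurePreserving (fun ω : (Fin l → F) × E × F ↦ ω.2.1) (model l E F) (stdGaussian E) :=
  (measurePreserving_fst (ν := stdGaussian F)).comp measurePreserving_snd

lemma measurePreserving_Gamma (i : Fin l) :
    MeasurePreserving (fun ω : (Fin l → F) × E × F ↦ ω.1 i) (model l E F) (stdGaussian F) :=
  (measurePreserving_eval (fun _ : Fin l ↦ stdGaussian F) i).comp measurePreserving_fst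

lemma measurePreserving_Gamma_gamma (i : Fin l) :
    MeasurePreserving (fun ω : (Fin l → F) × E × F ↦ (ω.1 i, ω.2.2)) (model l E F)
      ((stdGaussian F).prod (stdGaussian F)) :=
  (measurePreserving_eval (fun _ : Fin l ↦ stdGaussian F) i).prod
    (measurePreserving_snd (μ := stdGaussian E))

lemma measurePreserving_Gamma_pair {i j : Fin l} (hij : i ≠ j) :
    MeasurePreserving (fun ω : (Fin l → F) × E × F ↦ (ω.1 i, ω.1 j)) (model l E F)
      ((stdGaussian F).prod (stdGaussian F)) := by
  have h : MeasurePreserving (fun x : Fin l → F ↦ (x i, x j)) (Measure.pi fun _ ↦ stdGaussian F)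
      ((stdGaussian F).prod (stdGaussian F)) := by
    refine ⟨by fun_prop, ?_⟩
    have hind : iIndepFun (fun (i : Fin l) (x : Fin l → F) ↦ x i)
        (Measure.pi fun _ : Fin l ↦ stdGaussian F) :=
      iIndepFun_pi (μ := fun _ : Fin l ↦ stdGaussian F) (X := fun _ x ↦ x) fun _ ↦ by fun_prop
    have := (indepFun_iff_map_prod_eq_prod_map_map (measurable_pi_apply i).aemeasurable
      (measurable_pi_apply j).aemeasurable).1
      (hind.indepFun hij)
    rw [this, (measurePreserving_eval (fun _ : Fin l ↦ stdGaussian F) i).map_eq,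
      (measurePreserving_eval (fun _ : Fin l ↦ stdGaussian F) j).map_eq]
  exact h.comp measurePreserving_fst

lemma model_gramNear {K : ℝ} (hK : 0 < K) :
    (model l E F).real {ω | ¬ GramNear K (√(Module.finrank ℝ F)) ω.2.2 ω.1} ≤
      (l + 1) ^ 2 * ((1 + chiVar) / K ^ 2) := by
  set m : ℝ := (Module.finrank ℝ F : ℝ) with hm
  have hm0 : 0 ≤ m := Nat.cast_nonneg _
  have hV := chiVar_nonneg
  set δ := (1 + chiVar) / K ^ 2 with hδ
  have hδ0 : 0 ≤ δ := by positivity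
  have hn : ∀ {f : (Fin l → F) × E × F → F}, MeasurePreserving f (model l E F) (stdGaussian F) →
      (model l E F).real {ω | ¬ |‖f ω‖ ^ 2 - √m ^ 2| ≤ K * √m} ≤ δ := by
    intro f hf
    have h1 := prob_norm_sq_sub F hK
    rw [← hf.measureReal_preimage (measurableSet_lt (by fun_prop) (by fun_prop)).nullMeasurableSet] at h1
    rw [Real.sq_sqrt hm0]
    simp only [not_le]
    refine h1.trans ?_
    rw [hδ]; gcongr; linarith
  have hi : ∀ {f : (Fin l → F) × E × F → F × F},
      MeasurePreserving f (model l E F) ((stdGaussian F).prod (stdGaussian F)) →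
      (model l E F).real {ω | ¬ |⟪(f ω).1, (f ω).2⟫| ≤ K * √m} ≤ δ := by
    intro f hf
    have h1 := prob_prod_inner (F := F) hK
    rw [← hf.measureReal_preimage (measurableSet_lt (by fun_prop) (by fun_prop)).nullMeasurableSet] at h1
    simp only [not_le]
    refine h1.trans ?_
    rw [hδ]; gcongr; linarith
  have hsub : {ω : (Fin l → F) × E × F | ¬ GramNear K (√m) ω.2.2 ω.1} ⊆
      {ω | ¬ |‖ω.2.2‖ ^ 2 - √m ^ 2| ≤ K * √m} ∪ ((⋃ i : Fin l, {ω | ¬ |⟪ω.1 i, ω.2.2⟫| ≤ K * √m}) ∪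
      ⋃ i : Fin l, ⋃ j : Fin l, {ω | ¬ (if i = j then |‖ω.1 i‖ ^ 2 - √m ^ 2| ≤ K * √m
        else |⟪ω.1 i, ω.1 j⟫| ≤ K * √m)}) := by
    intro ω hω
    by_contra hc
    simp only [Set.mem_union, Set.mem_iUnion, Set.mem_ofPred_eq, not_or, not_exists, not_not] at hc
    obtain ⟨c1, c2, c3⟩ := hc
    refine hω ⟨c1, fun i ↦ by rw [real_inner_comm]; exact c2 i, fun i ↦ by simpa using c3 i i,
      fun i j hij ↦ by simpa [hij] using c3 i j⟩
  refine (measureReal_mono hsub).trans ?_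
  refine (measureReal_union_le _ _).trans ?_
  have b1 := hn (measurePreserving_gamma (l := l) (E := E) (F := F))
  have b2 : (model l E F).real (⋃ i : Fin l, {ω | ¬ |⟪ω.1 i, ω.2.2⟫| ≤ K * √m}) ≤ l * δ := by
    refine (measureReal_iUnion_fintype_le _).trans ?_
    refine (Finset.sum_le_sum fun i _ ↦ hi (measurePreserving_Gamma_gamma i)).trans ?_
    simp
  have b3 : (model l E F).real (⋃ i : Fin l, ⋃ j : Fin l,
      {ω | ¬ (if i = j then |‖ω.1 i‖ ^ 2 - √m ^ 2| ≤ K * √m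
        else |⟪ω.1 i, ω.1 j⟫| ≤ K * √m)}) ≤ l ^ 2 * δ := by
    refine (measureReal_iUnion_fintype_le _).trans ?_
    have : ∀ i j : Fin l, (model l E F).real {ω | ¬ (if i = j then |‖ω.1 i‖ ^ 2 - √m ^ 2| ≤ K * √m
        else |⟪ω.1 i, ω.1 j⟫| ≤ K * √m)} ≤ δ := by
      intro i j
      by_cases hij : i = j
      · subst hij
        simpa using hn (measurePreserving_Gamma (E := E) i)
      · simpa [hij] using hi (measurePreserving_Gamma_pair (E := E) hij)
    refine (Finset.sum_le_sum fun i _ ↦ (measureReal_iUnion_fintype_le _).trans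
      (Finset.sum_le_sum fun j _ ↦ this i j)).trans ?_
    simp; apply le_of_eq; ring
  have b4 := (measureReal_union_le (μ := model l E F) (⋃ i : Fin l, {ω | ¬ |⟪ω.1 i, ω.2.2⟫| ≤ K * √m})
    (⋃ i : Fin l, ⋃ j : Fin l,
      {ω | ¬ (if i = j then |‖ω.1 i‖ ^ 2 - √m ^ 2| ≤ K * √m
        else |⟪ω.1 i, ω.1 j⟫| ≤ K * √m)}))
  have hl : (0 : ℝ) ≤ l := Nat.cast_nonneg l
  nlinarith [mul_nonneg hl hδ0]

lemma model_le_of_section_S {A : Set ((Fin l → F) × E × F)} (hA : MeasurableSet A) {δ : ℝ}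
    (hδ : 0 ≤ δ) (h : ∀ Γ γ, (stdGaussian E).real {S | (Γ, S, γ) ∈ A} ≤ δ) :
    (model l E F).real A ≤ δ := by
  refine ENNReal.toReal_le_of_le_ofReal hδ ?_
  rw [model, Measure.prod_apply hA]
  calc _ ≤ ∫⁻ _, ENNReal.ofReal δ ∂(Measure.pi fun _ : Fin l ↦ stdGaussian F) := by
        refine lintegral_mono fun Γ ↦ ?_
        rw [Measure.prod_apply_symm (measurable_prodMk_left hA)]
        calc _ ≤ ∫⁻ _, ENNReal.ofReal δ ∂(stdGaussian F) := by
              refine lintegral_mono fun γ ↦ ?_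
              have := ENNReal.ofReal_le_ofReal (h Γ γ)
              rw [ofReal_measureReal] at this
              exact this
          _ = _ := by simp
    _ = _ := by simp

end Model

/-! ### Choice of constants -/

section Constants

lemma exists_div_sq_le (A : ℝ) {η : ℝ} (hη : 0 < η) : ∃ K : ℝ, 1 ≤ K ∧ A / K ^ 2 ≤ η := by
  refine ⟨1 + |A| / η, by have : 0 ≤ |A| / η := by positivity
                          linarith, ?_⟩
  have h0 : 0 ≤ |A| / η := by positivity
  rw [div_le_iff₀ (by positivity)]
  have h1 : |A| / η ≤ (1 + |A| / η) ^ 2 := by nlinarith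
  calc A ≤ |A| := le_abs_self A
    _ = η * (|A| / η) := by field_simp
    _ ≤ _ := mul_le_mul_of_nonneg_left h1 hη.le

lemma exists_mul_sqrt_le (A : ℝ) {b η : ℝ} (hb : 0 < b) (hη : 0 < η) :
    ∃ c : ℝ, 0 < c ∧ c ≤ b ∧ A * √c ≤ η := by
  refine ⟨min b ((η / (|A| + 1)) ^ 2), by positivity, min_le_left _ _, ?_⟩
  have h1 : √(min b ((η / (|A| + 1)) ^ 2)) ≤ η / (|A| + 1) := by
    rw [Real.sqrt_le_left (by positivity)]; exact min_le_right _ _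
  calc A * √(min b ((η / (|A| + 1)) ^ 2)) ≤ |A| * (η / (|A| + 1)) :=
        mul_le_mul (le_abs_self A) h1 (Real.sqrt_nonneg _) (abs_nonneg _)
    _ ≤ (|A| + 1) * (η / (|A| + 1)) := by
        refine mul_le_mul_of_nonneg_right (by linarith) (by positivity)
    _ = η := by field_simp

lemma pos_of_sq_pos {x : ℝ} (hx : 0 ≤ x) (h : 0 < x ^ 2) : 0 < x :=
  lt_of_le_of_ne hx (by rintro rfl; simp at h)

end Constants

/-! ### Anticoncentration -/

section SmallBall

variable {l : ℕ} {E F : Type*} [NormedAddCommGroup E] [InnerProductSpace ℝ E] [FiniteDimensional ℝ E]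
  [MeasurableSpace E] [BorelSpace E]
  [NormedAddCommGroup F] [InnerProductSpace ℝ F] [FiniteDimensional ℝ F]
  [MeasurableSpace F] [BorelSpace F]

lemma stdGaussian_real : stdGaussian ℝ = gaussianReal 0 1 := by
  apply Measure.ext_of_charFun
  ext t
  rw [charFun_stdGaussian, charFun_gaussianReal]
  congr 1
  rw [← Complex.ofReal_pow, Real.norm_eq_abs, sq_abs]
  push_cast
  simp [neg_div]

/-- A standard normal vector has an independent standard normal component in any given unit
direction `u`. -/
lemma map_line_add_stdGaussian {u : E} (hu : ‖u‖ = 1) :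
    ((gaussianReal 0 1).prod (stdGaussian E)).map
      (fun p ↦ p.1 • u + (p.2 - ⟪p.2, u⟫ • u)) = stdGaussian E := by
  let A : ℝ →L[ℝ] E := ContinuousLinearMap.toSpanSingleton ℝ u
  let B : E →L[ℝ] E := ContinuousLinearMap.id ℝ E - (innerSL ℝ u).smulRight u
  have hA : ∀ y, A.adjoint y = ⟪u, y⟫ := fun y ↦ by
    refine ext_inner_left ℝ fun x ↦ ?_
    rw [ContinuousLinearMap.adjoint_inner_right]
    simp [A, real_inner_smul_left, mul_comm]
  have hB : ∀ y, B.adjoint y = y - ⟪u, y⟫ • u := fun y ↦ by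
    refine ext_inner_left ℝ fun x ↦ ?_
    rw [ContinuousLinearMap.adjoint_inner_right]
    simp [B, inner_sub_left, inner_sub_right, real_inner_smul_left, real_inner_smul_right]
    rw [real_inner_comm x u]; ring
  have h := map_add_prod_stdGaussian A B fun y ↦ by
    rw [hA, hB, norm_sub_sq_real, real_inner_smul_right, norm_smul, hu, Real.norm_eq_abs,
      real_inner_comm y u, mul_one, sq_abs]
    ring
  rw [stdGaussian_real] at h
  refine Eq.trans ?_ h
  congr 1
  ext p
  simp [A, B, real_inner_comm p.2 u]

/-- An anticoncentration bound: the map is a small quadratic perturbation of `S ↦ -⟪S, u⟫`. -/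
lemma prob_quadratic_small {u : E} (hu : ‖u‖ = 1) {β g y K δ : ℝ} (hg : 0 < g) (hδ : 0 ≤ δ)
    (hβ : 2 * K * |β| / g ≤ 1 / 2) :
    (stdGaussian E).real {S | |⟪S, u⟫| ≤ K ∧ |(‖S‖ ^ 2 / g - y) * β - ⟪S, u⟫| ≤ δ} ≤ 4 * δ := by
  set A := {S : E | |⟪S, u⟫| ≤ K ∧ |(‖S‖ ^ 2 / g - y) * β - ⟪S, u⟫| ≤ δ} with hA
  have hA1 : MeasurableSet {S : E | |⟪S, u⟫| ≤ K} := measurableSet_le (by fun_prop) (by fun_prop)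
  have hA2 : MeasurableSet {S : E | |(‖S‖ ^ 2 / g - y) * β - ⟪S, u⟫| ≤ δ} :=
    measurableSet_le (by fun_prop) (by fun_prop)
  have hAm : MeasurableSet A := hA1.inter hA2
  have hfm : Measurable fun p : ℝ × E ↦ p.1 • u + (p.2 - ⟪p.2, u⟫ • u) := by fun_prop
  have huu : ⟪u, u⟫ = 1 := by rw [real_inner_self_eq_norm_sq, hu]; norm_num
  rw [← map_line_add_stdGaussian hu]
  refine ENNReal.toReal_le_of_le_ofReal (by positivity) ?_
  rw [Measure.map_apply hfm hAm, Measure.prod_apply_symm (hfm hAm)]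
  calc _ ≤ ∫⁻ _, ENNReal.ofReal (4 * δ) ∂(stdGaussian E) := by
        refine lintegral_mono fun S ↦ ?_
        rw [← ofReal_measureReal]
        refine ENNReal.ofReal_le_ofReal (gaussianReal_le_of_diam (by positivity) ?_)
        have key : ∀ x : ℝ, ⟪x • u + (S - ⟪S, u⟫ • u), u⟫ = x := fun x ↦ by
          rw [inner_add_left, inner_sub_left, real_inner_smul_left, real_inner_smul_left, huu]; ring
        have key2 : ∀ x : ℝ, ‖x • u + (S - ⟪S, u⟫ • u)‖ ^ 2 = x ^ 2 + ‖S - ⟪S, u⟫ • u‖ ^ 2 :=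
            fun x ↦ by
          have : ⟪u, S - ⟪S, u⟫ • u⟫ = 0 := by
            rw [inner_sub_right, real_inner_smul_right, huu, real_inner_comm]; ring
          rw [norm_smul_add_sq, hu, this]; ring
        rintro x ⟨hx1, hx2⟩ z ⟨hz1, hz2⟩
        simp only [key, key2] at hx1 hx2 hz1 hz2
        set ρ := ‖S - ⟪S, u⟫ • u‖ ^ 2
        have e : (((x ^ 2 + ρ) / g - y) * β - x) - (((z ^ 2 + ρ) / g - y) * β - z) =
            (x - z) * ((x + z) * β / g - 1) := by field_simp; ring
        have h1 : |(x - z) * ((x + z) * β / g - 1)| ≤ 2 * δ := by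
          rw [← e]; exact (abs_sub _ _).trans (by linarith)
        have h2 : |(x + z) * β / g| ≤ 1 / 2 := by
          rw [abs_div, abs_mul, abs_of_pos hg]
          refine le_trans ?_ hβ
          gcongr
          exact (abs_add_le _ _).trans (by linarith)
        have h3 : 1 / 2 ≤ |(x + z) * β / g - 1| := by
          have := abs_le.1 h2
          rw [abs_sub_comm]
          exact le_trans (by linarith) (le_abs_self _)
        rw [abs_mul] at h1
        nlinarith [abs_nonneg (x - z)]
    _ = _ := by simp

end SmallBall

/-! ### Two lower bounds for the statistic -/

section Directions

variable {l : ℕ} {E F : Type*} [NormedAddCommGroup E] [InnerProductSpace ℝ E]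
  [NormedAddCommGroup F] [InnerProductSpace ℝ F]

/-- The direction of the column `t i` alone. -/
lemma lt_lr_of_norm_sq_lt {S : E} {t : Fin l → E} {γ : F} {Γ : Fin l → F} (h : FullRank γ Γ)
    {y : ℝ} (i : Fin l) (hv : ‖t i‖ ^ 2 < (‖S‖ ^ 2 / ‖γ‖ ^ 2 - y) * ‖Γ i‖ ^ 2) :
    y < lr S t γ Γ := by
  refine lt_lr_of_exists h (v₀ := 0) (v := EuclideanSpace.single i 1) ?_
  simpa [comb_apply] using hv

/-- If the statistic does not exceed `y`, then no direction `S + s • t i` witnesses the contrary;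
the optimal `s` gives the bound. -/
lemma sq_le_of_lr_le {S : E} {t : Fin l → E} {γ : F} {Γ : Fin l → F} (h : FullRank γ Γ)
    {y : ℝ} (i : Fin l) (hγ : 0 < ‖γ‖) (ha : 0 < ‖t i‖) (hL : 0 ≤ ‖S‖ ^ 2 / ‖γ‖ ^ 2 - y)
    (hlr : ¬ y < lr S t γ Γ) :
    ((‖S‖ ^ 2 / ‖γ‖ ^ 2 - y) * ⟪γ, Γ i⟫ - ⟪S, t i⟫) ^ 2 ≤ y * ‖γ‖ ^ 2 * ‖t i‖ ^ 2 := by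
  by_contra hc
  push Not at hc
  apply hlr
  set L := ‖S‖ ^ 2 / ‖γ‖ ^ 2 - y with hLd
  set q := L * ⟪γ, Γ i⟫ - ⟪S, t i⟫ with hq
  set s := q / ‖t i‖ ^ 2 with hs
  refine lt_lr_of_exists h (v₀ := 1) (v := EuclideanSpace.single i s) ?_
  have e1 : comb t (EuclideanSpace.single i s) = s • t i := by simp [comb_apply]
  have e2 : comb Γ (EuclideanSpace.single i s) = s • Γ i := by simp [comb_apply]
  rw [e1, e2, norm_smul_add_sq, norm_smul_add_sq, real_inner_smul_right, real_inner_smul_right,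
    norm_smul, norm_smul, mul_pow, mul_pow, Real.norm_eq_abs, sq_abs, ← hLd]
  have e3 : L * ‖γ‖ ^ 2 = ‖S‖ ^ 2 - y * ‖γ‖ ^ 2 := by rw [hLd]; field_simp
  have e4 : s * ‖t i‖ ^ 2 = q := by rw [hs]; field_simp
  have e5 : y * ‖γ‖ ^ 2 < s * q := by
    rw [hs, div_mul_eq_mul_div, lt_div_iff₀ (by positivity), ← sq]; exact hc
  have e6 : 0 ≤ L * (s ^ 2 * ‖Γ i‖ ^ 2) := by positivity
  have e7 : s ^ 2 * ‖t i‖ ^ 2 = s * q := by rw [← e4]; ring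
  have e8 : s * q = L * s * ⟪γ, Γ i⟫ - s * ⟪S, t i⟫ := by rw [hq]; ring
  linarith only [e3, e5, e6, e7, e8]

end Directions

/-! ### Small-ball estimate for the statistic -/

section Uniform

variable {l : ℕ}

/-- Euclidean space of dimension `k`. -/
abbrev Eu (k : ℕ) := EuclideanSpace ℝ (Fin k)

/-- With `s = ‖S‖²`, `g = ‖γ‖²` and `G = ‖Γ i‖²`, the gap `L = s / g - y` left by a threshold
`y = c / m` is of order at least `1 / m`, and `L G` is bounded below. -/
lemma gap_bound {K μ c c₃ s g G y L : ℝ} (hμ : 0 < μ) (hK : 4 * K ≤ μ) (hc : 4 * c ≤ c₃)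
    (hc₃ : 0 < c₃) (hs : c₃ ≤ s) (hg : 0 < g) (hg2 : g ≤ 2 * μ ^ 2) (hy : y = c / μ ^ 2)
    (hG : μ ^ 2 - K * μ ≤ G) (hL : L = s / g - y) :
    c₃ / (4 * μ ^ 2) ≤ L ∧ c₃ / 8 < L * G := by
  have h1 : c₃ / (2 * μ ^ 2) ≤ s / g := by
    apply div_le_div₀ (by linarith) hs hg hg2
  have h2 : c / μ ^ 2 ≤ c₃ / 4 / μ ^ 2 := by gcongr; linarith
  have h3 : c₃ / (2 * μ ^ 2) = c₃ / (4 * μ ^ 2) + c₃ / 4 / μ ^ 2 := by field_simp; norm_num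
  have h4 : c₃ / (4 * μ ^ 2) ≤ L := by rw [hL, hy]; linarith
  refine ⟨h4, ?_⟩
  have h5 : 3 / 4 * μ ^ 2 ≤ G := by nlinarith
  calc c₃ / 8 < c₃ / (4 * μ ^ 2) * (3 / 4 * μ ^ 2) := by
        have : c₃ / (4 * μ ^ 2) * (3 / 4 * μ ^ 2) = c₃ * (3 / 16) := by field_simp; norm_num
        rw [this]; linarith
    _ ≤ L * G := mul_le_mul h4 h5 (by positivity) (le_trans (by positivity) h4)

set_option maxHeartbeats 800000 in
/-- Small-ball estimate: the statistic is unlikely to be small compared with `1 / m`, uniformly in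
`t` and `k`. If the first column of `t` is short, its direction alone makes the statistic of order
`1 / m`. Otherwise, by `sq_le_of_lr_le`, a small statistic forces `S` into a thin set, to which
`prob_quadratic_small` applies. -/
lemma exists_smallBall (hl : 0 < l) {η : ℝ} (hη : 0 < η) :
    ∃ c : ℝ, 0 < c ∧ ∃ m₀ : ℝ, ∀ k m : ℕ, 1 ≤ k → m₀ ≤ m → ∀ t : Fin l → Eu k,
      (model l (Eu k) (Eu m)).real {ω | ¬ (c / m < lr ω.2.1 t ω.2.2 ω.1)} ≤ η := by
  obtain ⟨K, hK1, hK⟩ := exists_div_sq_le ((l + 1 : ℝ) ^ 2 * (1 + chiVar)) (η := η / 4) (by positivity)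
  obtain ⟨K', hK'1, hK'⟩ := exists_div_sq_le chiVar (η := η / 8) (by positivity)
  obtain ⟨c₃, hc₃, hc₃2, hc₃3⟩ := exists_mul_sqrt_le (4 * K') (b := 1 / 2) (η := η / 8)
    (by positivity) (by positivity)
  obtain ⟨K₀, hK₀1, hK₀⟩ := exists_div_sq_le 1 (η := η / 4) (by positivity)
  obtain ⟨c, hc, hc2, hc3⟩ := exists_mul_sqrt_le (4 * √2) (b := c₃ / 4) (η := η / 4)
    (by positivity) (by positivity)
  set K₁ := (l + 1 : ℝ) ^ 2 * K with hK₁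
  have hK₁0 : 1 ≤ K₁ := by
    have : (0 : ℝ) ≤ l := Nat.cast_nonneg l
    nlinarith
  set M := 4 * K₁ + 8 * K₀ * K₁ / √(c₃ / 8) + 1 with hM
  have hM0 : 0 ≤ 8 * K₀ * K₁ / √(c₃ / 8) := by positivity
  refine ⟨c, hc, M ^ 2, fun k m hk hm t ↦ ?_⟩
  set μ := √(m : ℝ) with hμ
  have hμM : M ≤ μ := Real.le_sqrt_of_sq_le hm
  have hμ1 : 0 < μ := by linarith
  have hμ4 : 4 * K₁ ≤ μ := by linarith
  have hμm : μ ^ 2 = m := Real.sq_sqrt (Nat.cast_nonneg m)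
  have hkr : (1 : ℝ) ≤ k := by exact_mod_cast hk
  have hB1 : (model l (Eu k) (Eu m)).real {ω | ¬ GramNear K μ ω.2.2 ω.1} ≤ η / 4 := by
    have := model_gramNear (l := l) (E := Eu k) (F := Eu m) (K := K) (by linarith)
    rw [finrank_euclideanSpace_fin, ← mul_div_assoc] at this
    exact this.trans hK
  have hB2 : (model l (Eu k) (Eu m)).real {ω | ‖ω.2.1‖ ^ 2 < c₃ * k} ≤ η / 4 := by
    have := prob_norm_sq_small (E := Eu k) (K := K') (by linarith) hc₃ hc₃2 (by simpa using hk)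
    rw [finrank_euclideanSpace_fin] at this
    rw [← (measurePreserving_S (l := l) (F := Eu m)).measureReal_preimage
      (measurableSet_lt (by fun_prop) (by fun_prop)).nullMeasurableSet] at this
    refine this.trans ?_
    linarith
  have pos_of_near : ∀ {γ : Eu m} {Γ : Fin l → Eu m}, GramNear K μ γ Γ →
      0 < ‖γ‖ ∧ μ ^ 2 / 2 ≤ ‖γ‖ ^ 2 ∧ ‖γ‖ ^ 2 ≤ 2 * μ ^ 2 := by
    intro γ Γ h
    have h1 := h.near.norm_bounds hμ1 (by linarith)
    refine ⟨?_, h1⟩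
    have : 0 < ‖γ‖ ^ 2 := lt_of_lt_of_le (by positivity) h1.1
    exact pos_of_sq_pos (norm_nonneg _) this
  let i₀ : Fin l := ⟨0, hl⟩
  have hgap : ∀ {ω : (Fin l → Eu m) × Eu k × Eu m}, GramNear K μ ω.2.2 ω.1 →
      c₃ * k ≤ ‖ω.2.1‖ ^ 2 → c₃ / (4 * μ ^ 2) ≤ ‖ω.2.1‖ ^ 2 / ‖ω.2.2‖ ^ 2 - c / m ∧
        c₃ / 8 < (‖ω.2.1‖ ^ 2 / ‖ω.2.2‖ ^ 2 - c / m) * ‖ω.1 i₀‖ ^ 2 := by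
    intro ω h hS
    obtain ⟨p1, p2, p3⟩ := pos_of_near h
    refine gap_bound (K := K) (c := c) (s := ‖ω.2.1‖ ^ 2) (g := ‖ω.2.2‖ ^ 2) hμ1
      (le_trans ?_ hμ4) (by linarith) hc₃ ?_ (by positivity) p3 (by rw [hμm]) ?_ rfl
    · rw [hK₁]
      have : (1 : ℝ) ≤ (l + 1) ^ 2 := by
        have : (0 : ℝ) ≤ l := Nat.cast_nonneg l
        nlinarith
      nlinarith
    · exact le_trans (by nlinarith) hS
    · have := (abs_le.1 (h.2.2.1 i₀)).1
      linarith
  have hfull : ∀ {ω : (Fin l → Eu m) × Eu k × Eu m}, GramNear K μ ω.2.2 ω.1 →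
      FullRank ω.2.2 ω.1 := fun h ↦ h.near.fullRank hμ1 (by linarith)
  rcases le_or_gt (‖t i₀‖ ^ 2) (c₃ / 8) with hcase | hcase
  · have hsub : {ω : (Fin l → Eu m) × Eu k × Eu m | ¬ (c / m < lr ω.2.1 t ω.2.2 ω.1)} ⊆
        {ω | ¬ GramNear K μ ω.2.2 ω.1} ∪ {ω | ‖ω.2.1‖ ^ 2 < c₃ * k} := by
      intro ω hω
      by_contra hcon
      simp only [Set.mem_union, Set.mem_ofPred_eq, not_or, not_not, not_lt] at hcon
      exact hω (lt_lr_of_norm_sq_lt (hfull hcon.1) i₀ (hcase.trans_lt (hgap hcon.1 hcon.2).2))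
    have := (measureReal_mono (μ := model l (Eu k) (Eu m)) hsub).trans (measureReal_union_le _ _)
    linarith
  · have ha : 0 < ‖t i₀‖ := by
      have : 0 < ‖t i₀‖ ^ 2 := by linarith
      exact pos_of_sq_pos (norm_nonneg _) this
    have ha2 : √(c₃ / 8) ≤ ‖t i₀‖ := by
      rw [Real.sqrt_le_left ha.le]; exact hcase.le
    set w : Eu k := ‖t i₀‖⁻¹ • t i₀ with hw
    have hw1 : ‖w‖ = 1 := by rw [hw, norm_smul, norm_inv, norm_norm]; field_simp
    have hB3 : (model l (Eu k) (Eu m)).real {ω | K₀ < |⟪ω.2.1, w⟫|} ≤ η / 4 := by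
      have := prob_inner w (K := K₀) (by linarith)
      rw [hw1, mul_one] at this
      rw [← (measurePreserving_S (l := l) (F := Eu m)).measureReal_preimage
        (measurableSet_lt (by fun_prop) (by fun_prop)).nullMeasurableSet] at this
      exact this.trans hK₀
    set δ := √2 * √c with hδ
    set A : Set ((Fin l → Eu m) × Eu k × Eu m) := {ω | GramNear K μ ω.2.2 ω.1} ∩
      ({ω | |⟪ω.2.1, w⟫| ≤ K₀} ∩ {ω | |(‖ω.2.1‖ ^ 2 / ‖ω.2.2‖ ^ 2 - c / m) *
        (⟪ω.2.2, ω.1 i₀⟫ / ‖t i₀‖) - ⟪ω.2.1, w⟫| ≤ δ}) with hA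
    have hAm : MeasurableSet A := (measurableSet_gramNear K μ (by fun_prop) (by fun_prop)).inter
      ((measurableSet_le (by fun_prop) (by fun_prop)).inter
        (measurableSet_le (by fun_prop) (by fun_prop)))
    have hB4 : (model l (Eu k) (Eu m)).real A ≤ η / 4 := by
      refine model_le_of_section_S hAm (by positivity) fun Γ γ ↦ ?_
      by_cases hG : GramNear K μ γ Γ
      · obtain ⟨p1, p2, p3⟩ := pos_of_near hG
        refine (measureReal_mono (s₂ := {S | |⟪S, w⟫| ≤ K₀ ∧ |(‖S‖ ^ 2 / ‖γ‖ ^ 2 - c / m) *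
          (⟪γ, Γ i₀⟫ / ‖t i₀‖) - ⟪S, w⟫| ≤ δ}) (fun S hS ↦ ⟨hS.2.1, hS.2.2⟩)).trans ?_
        refine (prob_quadratic_small hw1 (by positivity) (by positivity) ?_).trans
          (le_trans (le_of_eq (by rw [hδ]; ring)) hc3)
        have hin : |⟪γ, Γ i₀⟫| ≤ K₁ * μ := by
          have := hG.near.inner (EuclideanSpace.single i₀ 1)
          simpa [comb_apply] using this
        rw [abs_div, abs_norm, div_le_iff₀ (by positivity)]
        have q1 : |⟪γ, Γ i₀⟫| / ‖t i₀‖ ≤ K₁ * μ / √(c₃ / 8) := by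
          apply div_le_div₀ (by positivity) hin (by positivity) ha2
        have q2 : 8 * K₀ * K₁ / √(c₃ / 8) ≤ μ := by linarith
        calc 2 * K₀ * (|⟪γ, Γ i₀⟫| / ‖t i₀‖) ≤ 2 * K₀ * (K₁ * μ / √(c₃ / 8)) := by gcongr
          _ = (8 * K₀ * K₁ / √(c₃ / 8)) * μ / 4 := by ring
          _ ≤ μ * μ / 4 := by gcongr
          _ ≤ 1 / 2 * ‖γ‖ ^ 2 := by linarith only [p2, sq μ]
      · have : {S | (Γ, S, γ) ∈ A} = ∅ := by
          ext S; simp only [Set.mem_ofPred_eq, Set.mem_empty_iff_false, iff_false]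
          exact fun h ↦ hG h.1
        rw [this]; simp; positivity
    have hsub : {ω : (Fin l → Eu m) × Eu k × Eu m | ¬ (c / m < lr ω.2.1 t ω.2.2 ω.1)} ⊆
        ({ω | ¬ GramNear K μ ω.2.2 ω.1} ∪ {ω | ‖ω.2.1‖ ^ 2 < c₃ * k}) ∪
          ({ω | K₀ < |⟪ω.2.1, w⟫|} ∪ A) := by
      intro ω hω
      by_contra hcon
      simp only [Set.mem_union, Set.mem_ofPred_eq, not_or, not_not, not_lt] at hcon
      obtain ⟨⟨h1, h2⟩, h3, h4⟩ := hcon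
      obtain ⟨p1, p2, p3⟩ := pos_of_near h1
      refine h4 ⟨h1, h3, ?_⟩
      have hsq := sq_le_of_lr_le (hfull h1) i₀ p1 ha
        (le_trans (by positivity) (hgap h1 h2).1) hω
      show |(‖ω.2.1‖ ^ 2 / ‖ω.2.2‖ ^ 2 - c / m) * (⟪ω.2.2, ω.1 i₀⟫ / ‖t i₀‖) - ⟪ω.2.1, w⟫| ≤ δ
      have e1 : (‖ω.2.1‖ ^ 2 / ‖ω.2.2‖ ^ 2 - c / m) * (⟪ω.2.2, ω.1 i₀⟫ / ‖t i₀‖) - ⟪ω.2.1, w⟫ =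
          ((‖ω.2.1‖ ^ 2 / ‖ω.2.2‖ ^ 2 - c / m) * ⟪ω.2.2, ω.1 i₀⟫ - ⟪ω.2.1, t i₀⟫) / ‖t i₀‖ := by
        rw [hw, real_inner_smul_right]; field_simp
      rw [e1, abs_div, abs_norm, div_le_iff₀ ha]
      refine abs_le_of_sq_le_sq (hsq.trans ?_) (by positivity)
      rw [mul_pow, hδ, mul_pow, Real.sq_sqrt (by norm_num), Real.sq_sqrt hc.le]
      refine mul_le_mul_of_nonneg_right ?_ (by positivity)
      rw [div_mul_eq_mul_div, div_le_iff₀ (by rw [← hμm]; positivity), ← hμm]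
      nlinarith only [p3, hc]
    have := ((measureReal_mono (μ := model l (Eu k) (Eu m)) hsub).trans (measureReal_union_le _ _)).trans
      (add_le_add (measureReal_union_le _ _) (measureReal_union_le _ _))
    linarith

end Uniform

/-! ### Comparison of product measures by sections -/

section Sections

variable {X Y : Type*} [MeasurableSpace X] [MeasurableSpace Y] {ρ : Measure X} {σ : Measure Y}
  [IsProbabilityMeasure ρ] [IsProbabilityMeasure σ]

lemma prod_real_le_add {A B : Set (X × Y)} (hA : MeasurableSet A) (hB : MeasurableSet B) {τ : ℝ}
    (hτ : 0 ≤ τ) (h : ∀ x, σ.real {y | (x, y) ∈ A} ≤ σ.real {y | (x, y) ∈ B} + τ) :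
    (ρ.prod σ).real A ≤ (ρ.prod σ).real B + τ := by
  have key : (ρ.prod σ) A ≤ (ρ.prod σ) B + ENNReal.ofReal τ := by
    rw [Measure.prod_apply hA, Measure.prod_apply hB]
    calc _ ≤ ∫⁻ x, σ {y | (x, y) ∈ B} + ENNReal.ofReal τ ∂ρ := by
          refine lintegral_mono fun x ↦ ?_
          have := ENNReal.ofReal_le_ofReal (h x)
          rw [ENNReal.ofReal_add measureReal_nonneg hτ, ofReal_measureReal, ofReal_measureReal]
            at this
          exact this
      _ = _ := by rw [lintegral_add_right _ measurable_const]; simp; rfl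
  have := ENNReal.toReal_mono (by finiteness) key
  rwa [ENNReal.toReal_add (by finiteness) (by finiteness), ENNReal.toReal_ofReal hτ] at this

lemma prod_real_le_add_symm {A B : Set (X × Y)} (hA : MeasurableSet A) (hB : MeasurableSet B)
    {τ : ℝ} (hτ : 0 ≤ τ) (h : ∀ y, ρ.real {x | (x, y) ∈ A} ≤ ρ.real {x | (x, y) ∈ B} + τ) :
    (ρ.prod σ).real A ≤ (ρ.prod σ).real B + τ := by
  have := prod_real_le_add (ρ := σ) (σ := ρ) (measurable_swap hA) (measurable_swap hB) hτ h
  rwa [Measure.measurePreserving_swap.measureReal_preimage hA.nullMeasurableSet,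
    Measure.measurePreserving_swap.measureReal_preimage hB.nullMeasurableSet] at this

/-- Replacing both coordinates of a product law by transformed ones costs at most the sum of the
one-sided total variation bounds. -/
lemma prod_real_map_le {f : X → X} {g : Y → Y} (hf : Measurable f) (hg : Measurable g) {τ : ℝ}
    (hτ : 0 ≤ τ) (h₁ : ∀ B, MeasurableSet B → ρ.real {x | f x ∈ B} ≤ ρ.real B + τ)
    (h₂ : ∀ B, MeasurableSet B → σ.real {x | g x ∈ B} ≤ σ.real B + τ) {B : Set (X × Y)}
    (hB : MeasurableSet B) :
    (ρ.prod σ).real {p | (f p.1, g p.2) ∈ B} ≤ (ρ.prod σ).real B + 2 * τ := by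
  have hB1 : MeasurableSet {p : X × Y | (p.1, g p.2) ∈ B} :=
    (show Measurable fun p : X × Y ↦ (p.1, g p.2) by fun_prop) hB
  have hB2 : MeasurableSet {p : X × Y | (f p.1, g p.2) ∈ B} :=
    (show Measurable fun p : X × Y ↦ (f p.1, g p.2) by fun_prop) hB
  have e1 := prod_real_le_add_symm (ρ := ρ) (σ := σ) hB2 hB1 hτ
    fun y ↦ h₁ {x | (x, g y) ∈ B} (measurable_prodMk_right hB)
  have e2 := prod_real_le_add (ρ := ρ) (σ := σ) hB1 hB hτ
    fun x ↦ h₂ {y | (x, y) ∈ B} (measurable_prodMk_left hB)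
  linarith

end Sections

/-! ### Monotonicity in the constants -/

section Mono

variable {l : ℕ} {E F : Type*} [NormedAddCommGroup E] [InnerProductSpace ℝ E]
  [NormedAddCommGroup F] [InnerProductSpace ℝ F]

lemma Near.mono {K K' μ : ℝ} {γ : F} {Γ : Fin l → F} (h : Near K μ γ Γ) (hμ : 0 ≤ μ)
    (hK : K ≤ K') : Near K' μ γ Γ where
  norm := h.norm.trans (by gcongr)
  inner v := (h.inner v).trans (by gcongr)
  comb v := (h.comb v).trans (by gcongr)

lemma Rel.mono {δ δ' : ℝ} {x : E} {t₁ t₂ : Fin l → E} (h : Rel δ x t₁ t₂) (hδ : δ ≤ δ') :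
    Rel δ' x t₁ t₂ := by
  obtain ⟨H, g, h1, h2, h3⟩ := h
  exact ⟨H, g, fun v ↦ (h1 v).trans (by gcongr), h2.trans hδ, h3⟩

end Mono

/-! ### Domination of laws with few instruments -/

section Domination

variable {l : ℕ}

/-- The four regularity events behind the pathwise comparison have high probability. -/
lemma exists_good (l : ℕ) (C : ℝ) (hC : 0 ≤ C) {η : ℝ} (hη : 0 < η) :
    ∃ K : ℝ, 1 ≤ K ∧ C ≤ K ∧ l / K ≤ η ∧ ∀ (k m : ℕ), 1 ≤ k → ∀ (x : Eu k), ‖x‖ ≤ C * √k →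
      (model l (Eu k) (Eu m)).real {ω | ¬ Near K (√m) ω.2.2 ω.1} ≤ η ∧
      (model l (Eu k) (Eu m)).real {ω | ¬ |‖ω.2.1‖ ^ 2 - √k ^ 2| ≤ K * √k} ≤ η ∧
      (model l (Eu k) (Eu m)).real {ω | ¬ ‖ω.2.1‖ ^ 2 ≤ K * √k ^ 2} ≤ η ∧
      (model l (Eu k) (Eu m)).real {ω | ¬ |⟪ω.2.1, x⟫| ≤ K * √k} ≤ η := by
  have hV := chiVar_nonneg
  obtain ⟨K₀, hK1, hK⟩ := exists_div_sq_le ((l + 1 : ℝ) ^ 2 * (1 + chiVar)) hη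
  have hl : (0 : ℝ) ≤ l := Nat.cast_nonneg l
  have hL : (1 : ℝ) ≤ (l + 1) ^ 2 := by nlinarith
  have hKsq : K₀ ≤ K₀ ^ 2 := by nlinarith
  have b1 : chiVar / K₀ ^ 2 ≤ η := le_trans (by gcongr; nlinarith only [hL, hV, hl]) hK
  have b2 : 1 / K₀ ^ 2 ≤ η := le_trans (by gcongr; nlinarith only [hL, hV, hl]) hK
  have b3 : l / K₀ ^ 2 ≤ η := le_trans (by gcongr; nlinarith only [hL, hV, hl]) hK
  set K := 2 * ((l + 1) ^ 2 * (1 + C)) * K₀ ^ 2 with hKd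
  have hLC : 1 ≤ (l + 1 : ℝ) ^ 2 * (1 + C) := by nlinarith
  have hL1 : (l + 1 : ℝ) ^ 2 ≤ (l + 1 : ℝ) ^ 2 * (1 + C) := by nlinarith
  have hL2 : 1 + C ≤ (l + 1 : ℝ) ^ 2 * (1 + C) := by nlinarith
  have k1 : (l + 1 : ℝ) ^ 2 * K₀ ≤ K := by
    calc (l + 1 : ℝ) ^ 2 * K₀ ≤ (l + 1 : ℝ) ^ 2 * (1 + C) * K₀ ^ 2 := by gcongr
      _ ≤ K := by rw [hKd]; linarith only [mul_nonneg (zero_le_one.trans hLC) (sq_nonneg K₀)]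
  have k2 : K₀ ^ 2 * (1 + C) ≤ K := by
    calc K₀ ^ 2 * (1 + C) ≤ K₀ ^ 2 * ((l + 1 : ℝ) ^ 2 * (1 + C)) := by gcongr
      _ ≤ K := by rw [hKd]; linarith only [mul_nonneg (zero_le_one.trans hLC) (sq_nonneg K₀)]
  have k3 : 1 + K₀ ≤ K := by
    calc 1 + K₀ ≤ 2 * 1 * K₀ ^ 2 := by nlinarith only [hK1]
      _ ≤ K := by rw [hKd]; gcongr
  refine ⟨K, by linarith, by nlinarith only [k2, hK1, hC, hKsq],
    le_trans (div_le_div_of_nonneg_left hl (by positivity)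
      (by nlinarith only [k2, hC, sq_nonneg K₀])) b3, fun k m hk x hx ↦ ?_⟩
  have hk0 : (0 : ℝ) ≤ k := Nat.cast_nonneg k
  have hkr : (1 : ℝ) ≤ k := by exact_mod_cast hk
  have hsk : √(k : ℝ) ≤ k := by
    rw [Real.sqrt_le_left hk0]; nlinarith
  have hS : (model l (Eu k) (Eu m)).real {ω | K₀ * √k < |‖ω.2.1‖ ^ 2 - k|} ≤ η := by
    have := prob_norm_sq_sub (Eu k) (K := K₀) (by linarith)
    rw [finrank_euclideanSpace_fin, ← (measurePreserving_S (l := l) (F := Eu m)).measureReal_preimage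
      (measurableSet_lt (by fun_prop) (by fun_prop)).nullMeasurableSet] at this
    exact this.trans b1
  refine ⟨?_, (measureReal_mono fun ω hω ↦ ?_).trans hS, (measureReal_mono fun ω hω ↦ ?_).trans hS, ?_⟩
  · have := model_gramNear (l := l) (E := Eu k) (F := Eu m) (K := K₀) (by linarith)
    rw [finrank_euclideanSpace_fin, ← mul_div_assoc] at this
    refine (measureReal_mono fun ω hω ↦ ?_).trans (this.trans hK)
    show ¬ GramNear K₀ (√m) ω.2.2 ω.1
    have hω' : ¬ Near K (√m) ω.2.2 ω.1 := hω
    exact fun hG ↦ hω' (hG.near.mono (by positivity) k1)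
  · rw [Set.mem_ofPred_eq, not_le, Real.sq_sqrt hk0] at hω
    refine lt_of_le_of_lt ?_ hω
    gcongr; linarith
  · rw [Set.mem_ofPred_eq, not_le, Real.sq_sqrt hk0] at hω
    show K₀ * √k < |‖ω.2.1‖ ^ 2 - k|
    refine lt_of_lt_of_le ?_ (le_abs_self _)
    have : (1 + K₀) * k ≤ K * k := by gcongr
    nlinarith only [this, hω, hsk, hK1]
  · have := prob_inner x (K := K₀) (by linarith)
    rw [← (measurePreserving_S (l := l) (F := Eu m)).measureReal_preimage
        (measurableSet_lt (by fun_prop) (by fun_prop)).nullMeasurableSet] at this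
    refine (measureReal_mono fun ω hω ↦ ?_).trans (this.trans b2)
    rw [Set.mem_ofPred_eq, not_le] at hω
    refine lt_of_le_of_lt ?_ hω
    calc K₀ * ‖x‖ ≤ K₀ * (C * √k) := by gcongr
      _ = (K₀ * C) * √k := by ring
      _ ≤ K * √k := by gcongr; nlinarith only [k2, hKsq, hC, hK1, sq_nonneg K₀]

lemma mul_sq_sub_one_le {k ε : ℝ} (hk : 1 ≤ k) (hε : 0 ≤ ε) (hε1 : ε ≤ 1) :
    k * ((1 + ε / √k) ^ 2 - 1) ^ 2 ≤ (3 * ε) ^ 2 := by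
  have hr : 1 ≤ √k := Real.one_le_sqrt.2 hk
  have e1 : (1 + ε / √k) ^ 2 - 1 = (ε * (2 + ε / √k)) / √k := by field_simp; ring
  rw [e1, div_pow, Real.sq_sqrt (by linarith), mul_div_cancel₀ _ (by linarith)]
  have : ε / √k ≤ 1 := by rw [div_le_one (by positivity)]; linarith
  have h2 : 0 ≤ ε / √k := by positivity
  refine pow_le_pow_left₀ (by positivity) ?_ 2
  nlinarith

set_option maxHeartbeats 400000 in
/-- Domination of the law of the statistic when the number of instruments is small relative to the
degrees of freedom. Thresholds below `c / m` are covered by `exists_smallBall`. Above, `lt_lr_smul`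
compares `t₂` with `t₁` at a scaled `S`, and the scaling costs little in total variation. -/
lemma exists_domination_of_small (hl : 0 < l) (C : ℝ) (hC : 0 ≤ C) {η : ℝ} (hη : 0 < η) :
    ∃ θ₀ : ℝ, 0 < θ₀ ∧ ∃ m₀ : ℝ, ∀ k m : ℕ, 1 ≤ k → m₀ ≤ m → k ≤ θ₀ * m →
      ∀ (t₁ t₂ : Fin l → Eu k) (x : Eu k), Rel (C / √m) x t₁ t₂ → ‖x‖ ≤ C * √k → ∀ y : ℝ,
      (model l (Eu k) (Eu m)).real {ω | y ≤ lr ω.2.1 t₂ ω.2.2 ω.1} ≤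
        (model l (Eu k) (Eu m)).real {ω | y < lr ω.2.1 t₁ ω.2.2 ω.1} + η := by
  obtain ⟨K, hK1, hCK, -, hgood⟩ := exists_good l C hC (η := η / 8) (by positivity)
  obtain ⟨K', hK'1, hK'⟩ := exists_div_sq_le chiVar (η := η / 16) (by positivity)
  obtain ⟨c₃, hc₃, hc₃2, hc₃3⟩ := exists_mul_sqrt_le (4 * K') (b := 1 / 2) (η := η / 16)
    (by positivity) (by positivity)
  obtain ⟨c, hc, m₁, hsb⟩ := exists_smallBall hl hη
  set ε := min 1 η / 40 with hεd
  have hε : 0 < ε := by have : 0 < min 1 η := lt_min one_pos hη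
                        positivity
  have hε1 : ε ≤ 1 / 40 := by have := min_le_left 1 η
                              linarith
  have hε2 : 5 * ε ≤ η / 8 := by have := min_le_right 1 η
                                 linarith
  set X := 18 * K ^ 3 with hX
  -- the ratio `√k / √m` has to stay below `θ`
  set θ := min (min ε (ε * c₃ / 8 / (66 * K ^ 4))) (min 1 (ε ^ 2 * c * c₃ / 16 / (4 * X ^ 2))) with hθ
  have hK0 : 0 < K := by linarith
  have hθ0 : 0 < θ := by positivity
  refine ⟨θ ^ 2, by positivity, max (max m₁ 1) ((4 * K) ^ 2), fun k m hk hm hkm t₁ t₂ x hrel hx y ↦ ?_⟩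
  have hm1 : m₁ ≤ m := le_trans (le_trans (le_max_left _ _) (le_max_left _ _)) hm
  have hm2 : (1 : ℝ) ≤ m := le_trans (le_trans (le_max_right _ _) (le_max_left _ _)) hm
  have hm3 : (4 * K) ^ 2 ≤ m := le_trans (le_max_right _ _) hm
  rcases lt_or_ge y (c / m) with hy | hy
  · -- small thresholds are exceeded by both statistics
    have h1 := hsb k m hk hm1 t₁
    have hmeas : MeasurableSet {ω : (Fin l → Eu m) × Eu k × Eu m | y < lr ω.2.1 t₁ ω.2.2 ω.1} :=
      measurableSet_lt (by fun_prop) (by fun_prop)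
    have h2 := probReal_compl_eq_one_sub (μ := model l (Eu k) (Eu m)) hmeas
    have h3 : (model l (Eu k) (Eu m)).real
        {ω : (Fin l → Eu m) × Eu k × Eu m | y < lr ω.2.1 t₁ ω.2.2 ω.1}ᶜ ≤ η :=
      (measureReal_mono fun ω hω h ↦ (show ¬ _ from hω) (hy.trans h)).trans h1
    have h4 : (model l (Eu k) (Eu m)).real {ω | y ≤ lr ω.2.1 t₂ ω.2.2 ω.1} ≤ 1 := measureReal_le_one
    linarith
  obtain ⟨g1, -, g2, g3⟩ := hgood k m hk x hx
  have g4 : (model l (Eu k) (Eu m)).real {ω | ‖ω.2.1‖ ^ 2 < c₃ * k} ≤ η / 8 := by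
    have := prob_norm_sq_small (E := Eu k) (K := K') (by linarith) hc₃ hc₃2 (by simpa using hk)
    rw [finrank_euclideanSpace_fin, ← (measurePreserving_S (l := l) (F := Eu m)).measureReal_preimage
      (measurableSet_lt (by fun_prop) (by fun_prop)).nullMeasurableSet] at this
    refine this.trans ?_
    linarith
  have hkr : (1 : ℝ) ≤ k := by exact_mod_cast hk
  have hk0 : (0 : ℝ) ≤ k := by linarith
  have hsqk : √(k : ℝ) ^ 2 = k := Real.sq_sqrt hk0
  have hsqm : √(m : ℝ) ^ 2 = m := Real.sq_sqrt (by linarith)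
  have hr : 1 ≤ √(k : ℝ) := Real.one_le_sqrt.2 hkr
  have hμ : 1 ≤ √(m : ℝ) := Real.one_le_sqrt.2 hm2
  have hKμ : 4 * K ≤ √(m : ℝ) := Real.le_sqrt_of_sq_le hm3
  have hrμ : √(k : ℝ) ≤ θ * √(m : ℝ) := by
    rw [← Real.sqrt_sq hθ0.le, ← Real.sqrt_mul (by positivity)]
    exact Real.sqrt_le_sqrt hkm
  have hq : √(k : ℝ) / √(m : ℝ) ≤ θ := by rwa [div_le_iff₀ (by positivity)]
  have hθ1 : θ ≤ ε := le_trans (min_le_left _ _) (min_le_left _ _)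
  have hθ2 : 66 * K ^ 4 * θ ≤ ε * c₃ / 8 := by
    have : θ ≤ _ := le_trans (min_le_left _ _) (min_le_right _ _)
    rwa [le_div_iff₀ (by positivity), mul_comm] at this
  have hθ3 : θ ≤ 1 := le_trans (min_le_right _ _) (min_le_left _ _)
  have hθ4 : 2 * (X * θ) ^ 2 < ε ^ 2 * c * c₃ / 16 := by
    have : θ ≤ _ := le_trans (min_le_right _ _) (min_le_right _ _)
    rw [le_div_iff₀ (by positivity)] at this
    have h5 : θ ^ 2 ≤ θ := by nlinarith only [hθ0, hθ3]
    have h6 : 0 < ε ^ 2 * c * c₃ / 16 := by positivity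
    have h7 : X ^ 2 * θ ^ 2 ≤ X ^ 2 * θ := by gcongr
    rw [mul_pow]
    linarith only [this, h6, h7]
  have hq0 : 0 ≤ √(k : ℝ) / √(m : ℝ) := by positivity
  set B : Set ((Fin l → Eu m) × Eu k × Eu m) := {ω | y < lr ω.2.1 t₁ ω.2.2 ω.1} with hB
  have hBm : MeasurableSet B := measurableSet_lt (by fun_prop) (by fun_prop)
  set B' : Set ((Fin l → Eu m) × Eu k × Eu m) :=
    {ω | y < lr ((1 + ε / √k) • ω.2.1) t₁ ω.2.2 ω.1} with hB'
  have hBm' : MeasurableSet B' := measurableSet_lt (by fun_prop) (by fun_prop)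
  set d := 1 + ε / √(k : ℝ) with hd
  have hd0 : 0 < d := by positivity
  have hTV : (k : ℝ) * (d ^ 2 - 1) ^ 2 ≤ (3 * ε) ^ 2 := mul_sq_sub_one_le hkr hε.le (by linarith only [hε1])
  have hTV2 : (d ^ 2 - 1) ^ 2 ≤ 1 / 2 := by
    have : (d ^ 2 - 1) ^ 2 ≤ k * (d ^ 2 - 1) ^ 2 := by
      nlinarith only [sq_nonneg (d ^ 2 - 1), hkr]
    nlinarith only [this, hTV, hε, hε1]
  have hBB : (model l (Eu k) (Eu m)).real B' ≤ (model l (Eu k) (Eu m)).real B + 5 * ε := by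
    refine prod_real_le_add hBm' hBm (by positivity) fun Γ ↦
      prod_real_le_add_symm (measurable_prodMk_left hBm') (measurable_prodMk_left hBm)
        (by positivity) fun γ ↦ ?_
    have := stdGaussian_smul_le (E := Eu k) hd0 (by
      rw [finrank_euclideanSpace_fin]; nlinarith only [hTV, hε, hε1]) hTV2
      (B := {S | (Γ, S, γ) ∈ B}) (measurable_prodMk_right (measurable_prodMk_left hBm))
    refine this.trans (add_le_add_right ?_ _)
    rw [finrank_euclideanSpace_fin, Real.sqrt_le_left (by positivity)]
    nlinarith only [hTV, sq_nonneg ε]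
  have hsub : {ω : (Fin l → Eu m) × Eu k × Eu m | y ≤ lr ω.2.1 t₂ ω.2.2 ω.1} ⊆
      B' ∪ (({ω | ¬ Near K (√m) ω.2.2 ω.1} ∪ {ω | ¬ ‖ω.2.1‖ ^ 2 ≤ K * √k ^ 2}) ∪
        ({ω | ¬ |⟪ω.2.1, x⟫| ≤ K * √k} ∪ {ω | ‖ω.2.1‖ ^ 2 < c₃ * k})) := by
    intro ω hω
    by_contra hcon
    simp only [Set.mem_union, Set.mem_ofPred_eq, not_or, not_not] at hcon
    obtain ⟨h0, ⟨h1, h2⟩, h3, h4⟩ := hcon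
    refine h0 (lt_lr_smul (K := K) (c₃ := c₃) (c := c) (x := x) (t₂ := t₂) hμ hr hK1 hKμ ?_ hε
      (by linarith) hc₃ hc
      (hq.trans hθ1) ?_ ?_ h1 ?_ h2 h3 (hx.trans (by gcongr)) (hrel.mono (by gcongr)) ?_ hω)
    · exact hrμ.trans (mul_le_of_le_one_left (Real.sqrt_nonneg _) hθ3)
    · exact le_trans (by gcongr) hθ2
    · exact lt_of_le_of_lt (by gcongr) hθ4
    · rw [hsqk]; exact not_lt.1 h4
    · rw [hsqm]; rwa [div_le_iff₀ (by linarith only [hm2])] at hy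
  have f1 := (measureReal_mono (μ := model l (Eu k) (Eu m)) hsub).trans (measureReal_union_le _ _)
  have f2 := (measureReal_union_le (μ := model l (Eu k) (Eu m))
    ({ω | ¬ Near K (√m) ω.2.2 ω.1} ∪ {ω | ¬ ‖ω.2.1‖ ^ 2 ≤ K * √k ^ 2})
    ({ω | ¬ |⟪ω.2.1, x⟫| ≤ K * √k} ∪ {ω | ‖ω.2.1‖ ^ 2 < c₃ * k})).trans
    (add_le_add (measureReal_union_le _ _) (measureReal_union_le _ _))
  linarith

end Domination

/-! ### Domination of laws with strong instruments -/

section StrongDomination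

variable {l : ℕ}

lemma finrank_span_range_le {E : Type*} [NormedAddCommGroup E] [InnerProductSpace ℝ E]
    (t : Fin l → E) : (Module.finrank ℝ (Submodule.span ℝ (Set.range t)) : ℝ) ≤ l := by
  have := finrank_range_le_card (R := ℝ) t
  rw [Fintype.card_fin] at this
  exact_mod_cast this

lemma stdGaussian_stretch_span_le {E : Type*} [NormedAddCommGroup E] [InnerProductSpace ℝ E]
    [FiniteDimensional ℝ E] [MeasurableSpace E] [BorelSpace E] (t : Fin l → E) {e : ℝ}
    (he : 0 ≤ e) (he1 : 40 * ((l + 1) * e) ≤ 1) {B : Set E} (hB : MeasurableSet B) :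
    (stdGaussian E).real {x | stretch (Submodule.span ℝ (Set.range t)) e x ∈ B} ≤
      (stdGaussian E).real B + 5 * ((l + 1) * e) := by
  have hl : (0 : ℝ) ≤ l := Nat.cast_nonneg l
  have hf := finrank_span_range_le t
  have h0 : e ≤ (l + 1) * e := by nlinarith only [hl, he]
  have h1 : ((1 + e) ^ 2 - 1) ^ 2 ≤ 9 * e ^ 2 := by
    have : (1 + e) ^ 2 - 1 = e * (2 + e) := by ring
    rw [this, mul_pow]
    have : (2 + e) ^ 2 ≤ 9 := by nlinarith only [he, h0, he1]
    nlinarith only [this, sq_nonneg e]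
  have h2 : (Module.finrank ℝ (Submodule.span ℝ (Set.range t)) : ℝ) * ((1 + e) ^ 2 - 1) ^ 2 ≤
      9 * ((l + 1) * e) ^ 2 := by
    calc _ ≤ (l : ℝ) * (9 * e ^ 2) := by gcongr
      _ ≤ (l + 1 : ℝ) ^ 2 * (9 * e ^ 2) := by gcongr; nlinarith only [hl]
      _ = _ := by ring
  have h3 : 9 * ((l + 1 : ℝ) * e) ^ 2 ≤ 1 / 2 := by
    have : 0 ≤ (l + 1 : ℝ) * e := by positivity
    nlinarith only [this, he1]
  refine (stdGaussian_stretch_le _ he (h2.trans h3) (h1.trans ?_) hB).trans ?_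
  · nlinarith only [h0, he, he1]
  · gcongr
    rw [Real.sqrt_le_left (by positivity)]
    nlinarith only [h2, sq_nonneg ((l + 1 : ℝ) * e)]

lemma prod_real_proj_le {E F : Type*} [NormedAddCommGroup E] [InnerProductSpace ℝ E]
    [FiniteDimensional ℝ E] [MeasurableSpace E] [BorelSpace E]
    [NormedAddCommGroup F] [InnerProductSpace ℝ F]
    [FiniteDimensional ℝ F] [MeasurableSpace F] [BorelSpace F] (t : Fin l → E) (Γ : Fin l → F)
    {K η : ℝ} (hK : 0 < K) (hη : l / K ≤ η) :
    ((stdGaussian E).prod (stdGaussian F)).real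
      ({p | K < ‖(Submodule.span ℝ (Set.range t)).starProjection p.1‖ ^ 2} ∪
        {p | K < ‖(Submodule.span ℝ (Set.range Γ)).starProjection p.2‖ ^ 2}) ≤ 2 * η := by
  have h1 := prob_projection (Submodule.span ℝ (Set.range t)) hK
  have h2 := prob_projection (Submodule.span ℝ (Set.range Γ)) hK
  rw [← (measurePreserving_fst (μ := stdGaussian E) (ν := stdGaussian F)).measureReal_preimage
    (measurableSet_lt (by fun_prop) (by fun_prop)).nullMeasurableSet] at h1
  rw [← (measurePreserving_snd (μ := stdGaussian E) (ν := stdGaussian F)).measureReal_preimage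
    (measurableSet_lt (by fun_prop) (by fun_prop)).nullMeasurableSet] at h2
  have h3 : (Module.finrank ℝ (Submodule.span ℝ (Set.range t)) : ℝ) / K ≤ l / K := by
    exact div_le_div_of_nonneg_right (finrank_span_range_le t) hK.le
  have h4 : (Module.finrank ℝ (Submodule.span ℝ (Set.range Γ)) : ℝ) / K ≤ l / K := by
    exact div_le_div_of_nonneg_right (finrank_span_range_le Γ) hK.le
  exact (measureReal_union_le _ _).trans
    ((add_le_add (h1.trans (h3.trans hη)) (h2.trans (h4.trans hη))).trans (by linarith))

set_option maxHeartbeats 400000 in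
/-- Domination of the law of the statistic when all linear combinations of the columns of `t₂` are
sufficiently longer than a standard normal vector. Above the thresholds covered by
`exists_smallBall`, `lt_lr_stretch` compares `t₂` with `t₁` at a stretched `S` and `γ`; given `Γ`,
the subspaces of the two stretches are fixed and of dimension at most `l`. -/
lemma exists_domination_of_strong (hl : 0 < l) (C : ℝ) (hC : 0 ≤ C) {κ : ℝ} (hκ : 1 ≤ κ) {η : ℝ}
    (hη : 0 < η) :
    ∃ A₀ : ℝ, ∃ m₀ : ℝ, ∀ k m : ℕ, ∀ A : ℝ, 1 ≤ k → m₀ ≤ m → k ≤ κ ^ 2 * m → A₀ ≤ A →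
      ∀ (t₁ t₂ : Fin l → Eu k) (x : Eu k), Rel (C / √m) x t₁ t₂ → ‖x‖ ≤ C * √k →
      (∀ v, (k + A * √k) * ‖v‖ ^ 2 ≤ ‖comb t₂ v‖ ^ 2) → ∀ y : ℝ,
      (model l (Eu k) (Eu m)).real {ω | y ≤ lr ω.2.1 t₂ ω.2.2 ω.1} ≤
        (model l (Eu k) (Eu m)).real {ω | y < lr ω.2.1 t₁ ω.2.2 ω.1} + η := by
  obtain ⟨K, hK1, hCK, hlK, hgood⟩ := exists_good l C hC (η := η / 8) (by positivity)
  obtain ⟨c, hc, m₁, hsb⟩ := exists_smallBall hl hη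
  have hl0 : (0 : ℝ) ≤ l := Nat.cast_nonneg l
  set ε := min 1 η / (80 * (l + 1)) with hεd
  have hε : 0 < ε := by have : 0 < min 1 η := lt_min one_pos hη
                        positivity
  have hεe : 80 * ((l + 1) * ε) = min 1 η := by rw [hεd]; field_simp
  have hε1 : 40 * ((l + 1) * ε) ≤ 1 := by
    have := min_le_left 1 η
    have : 0 ≤ (l + 1) * ε := by positivity
    linarith
  have hε2 : 5 * ((l + 1) * ε) ≤ η / 16 := by
    have := min_le_right 1 η
    linarith
  have hε3 : ε ≤ 1 := by
    have : 0 ≤ l * ε := by positivity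
    linarith
  set X := 106 * K ^ 3 * κ ^ 2 with hX
  have hK0 : 0 < K := by linarith
  refine ⟨4 * (236 * K ^ 4 * κ ^ 2) / ε + (8 * X ^ 2 + 1) / (ε ^ 2 * c),
    max (max m₁ 1) (max ((12 * K) ^ 2) ((4 / ε) ^ 2)),
    fun k m A hk hm hkm hA t₁ t₂ x hrel hx ht y ↦ ?_⟩
  have hm1 : m₁ ≤ m := le_trans (le_trans (le_max_left _ _) (le_max_left _ _)) hm
  have hm2 : (1 : ℝ) ≤ m := le_trans (le_trans (le_max_right _ _) (le_max_left _ _)) hm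
  have hm3 : (12 * K) ^ 2 ≤ m := le_trans (le_trans (le_max_left _ _) (le_max_right _ _)) hm
  have hm4 : (4 / ε) ^ 2 ≤ m := le_trans (le_trans (le_max_right _ _) (le_max_right _ _)) hm
  rcases lt_or_ge y (c / m) with hy | hy
  · -- small thresholds are exceeded by both statistics
    have h1 := hsb k m hk hm1 t₁
    have hmeas : MeasurableSet {ω : (Fin l → Eu m) × Eu k × Eu m | y < lr ω.2.1 t₁ ω.2.2 ω.1} :=
      measurableSet_lt (by fun_prop) (by fun_prop)
    have h2 := probReal_compl_eq_one_sub (μ := model l (Eu k) (Eu m)) hmeas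
    have h3 : (model l (Eu k) (Eu m)).real
        {ω : (Fin l → Eu m) × Eu k × Eu m | y < lr ω.2.1 t₁ ω.2.2 ω.1}ᶜ ≤ η :=
      (measureReal_mono fun ω hω h ↦ (show ¬ _ from hω) (hy.trans h)).trans h1
    have h4 : (model l (Eu k) (Eu m)).real {ω | y ≤ lr ω.2.1 t₂ ω.2.2 ω.1} ≤ 1 := measureReal_le_one
    linarith
  obtain ⟨g1, g2, -, g3⟩ := hgood k m hk x hx
  have hkr : (1 : ℝ) ≤ k := by exact_mod_cast hk
  have hk0 : (0 : ℝ) ≤ k := by linarith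
  have hsqk : √(k : ℝ) ^ 2 = k := Real.sq_sqrt hk0
  have hsqm : √(m : ℝ) ^ 2 = m := Real.sq_sqrt (by linarith)
  have hr : 1 ≤ √(k : ℝ) := Real.one_le_sqrt.2 hkr
  have hμ : 1 ≤ √(m : ℝ) := Real.one_le_sqrt.2 hm2
  have hKμ : 12 * K ≤ √(m : ℝ) := Real.le_sqrt_of_sq_le hm3
  have hεμ : 1 / √(m : ℝ) ≤ ε / 4 := by
    have : 4 / ε ≤ √(m : ℝ) := Real.le_sqrt_of_sq_le hm4
    rw [div_le_iff₀ (by positivity)] at this ⊢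
    linarith
  have hrμ : √(k : ℝ) ≤ κ * √(m : ℝ) := by
    rw [← Real.sqrt_sq (zero_le_one.trans hκ), ← Real.sqrt_mul (by positivity)]
    exact Real.sqrt_le_sqrt hkm
  have hA1 : 4 * (236 * K ^ 4 * κ ^ 2) / ε ≤ A := le_trans (le_add_of_nonneg_right (by positivity)) hA
  have hA2 : (8 * X ^ 2 + 1) / (ε ^ 2 * c) ≤ A := le_trans (le_add_of_nonneg_left (by positivity)) hA
  have hA0 : 0 ≤ A := le_trans (by positivity) hA1
  rw [div_le_iff₀ (by positivity)] at hA1 hA2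
  set B : Set ((Fin l → Eu m) × Eu k × Eu m) := {ω | y < lr ω.2.1 t₁ ω.2.2 ω.1} with hB
  have hBm : MeasurableSet B := measurableSet_lt (by fun_prop) (by fun_prop)
  -- a measurable hull, so that the sections of the good event are measurable
  set N := toMeasurable (model l (Eu k) (Eu m)) ({ω | ¬ Near K (√m) ω.2.2 ω.1} ∪
    ({ω | ¬ |‖ω.2.1‖ ^ 2 - √k ^ 2| ≤ K * √k} ∪ {ω | ¬ |⟪ω.2.1, x⟫| ≤ K * √k})) with hN
  have hNm : MeasurableSet N := measurableSet_toMeasurable _ _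
  have hNle : (model l (Eu k) (Eu m)).real N ≤ 3 * (η / 8) := by
    rw [hN, measureReal_def, measure_toMeasurable, ← measureReal_def]
    have f2 := (measureReal_union_le (μ := model l (Eu k) (Eu m)) {ω | ¬ Near K (√m) ω.2.2 ω.1}
      ({ω | ¬ |‖ω.2.1‖ ^ 2 - √k ^ 2| ≤ K * √k} ∪ {ω | ¬ |⟪ω.2.1, x⟫| ≤ K * √k}))
    have f3 := (measureReal_union_le (μ := model l (Eu k) (Eu m))
      {ω | ¬ |‖ω.2.1‖ ^ 2 - √k ^ 2| ≤ K * √k} {ω | ¬ |⟪ω.2.1, x⟫| ≤ K * √k})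
    linarith
  set A' := {ω : (Fin l → Eu m) × Eu k × Eu m | y ≤ lr ω.2.1 t₂ ω.2.2 ω.1} with hA'
  have hAm : MeasurableSet (A' \ N) :=
    (measurableSet_le (by fun_prop) (by fun_prop)).diff hNm
  have key : (model l (Eu k) (Eu m)).real (A' \ N) ≤ (model l (Eu k) (Eu m)).real B + 3 * (η / 8) := by
    refine prod_real_le_add hAm hBm (by positivity) fun Γ ↦ ?_
    have hBΓ : MeasurableSet {p | (Γ, p) ∈ B} := measurable_prodMk_left hBm
    have hsub : {p | (Γ, p) ∈ A' \ N} ⊆ {p | (stretch (Submodule.span ℝ (Set.range t₁)) ε p.1,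
        stretch (Submodule.span ℝ (Set.range Γ)) ε p.2) ∈ {p | (Γ, p) ∈ B}} ∪
        ({p | K < ‖(Submodule.span ℝ (Set.range t₁)).starProjection p.1‖ ^ 2} ∪
        {p | K < ‖(Submodule.span ℝ (Set.range Γ)).starProjection p.2‖ ^ 2}) := by
      rintro ⟨S, γ⟩ ⟨hp, hpN⟩
      have hpN' := Set.notMem_subset (subset_toMeasurable _ _) hpN
      by_contra hcon
      simp only [Set.mem_union, Set.mem_ofPred_eq, not_or, not_not, not_lt] at hcon hpN'
      obtain ⟨h0, h1, h2⟩ := hcon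
      obtain ⟨h3, h4, h5⟩ := hpN'
      refine h0 (lt_lr_stretch (K := K) (κ := κ) (a := A) (c := c) (x := x) (t₂ := t₂) hμ hr hK1 hKμ
        hκ hrμ hε hε3 hc hA0 hεμ ?_ ?_ h3 h4 h1 h2 h5 (hx.trans (by gcongr))
        (hrel.mono (by gcongr)) ?_ ?_ hp)
      · linarith only [hA1]
      · rw [← hX]; linarith only [hA2]
      · rw [hsqk]; exact ht
      · rw [hsqm]; rwa [div_le_iff₀ (by linarith only [hm2])] at hy
    refine (measureReal_mono hsub).trans ((measureReal_union_le _ _).trans ?_)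
    have e1 := prod_real_proj_le (E := Eu k) (F := Eu m) t₁ Γ hK0 hlK
    have e2 := prod_real_map_le (ρ := stdGaussian (Eu k)) (σ := stdGaussian (Eu m))
      (measurable_stretch (Submodule.span ℝ (Set.range t₁)) ε)
      (measurable_stretch (Submodule.span ℝ (Set.range Γ)) ε) (τ := 5 * ((l + 1) * ε))
      (by positivity) (fun B hB ↦ stdGaussian_stretch_span_le t₁ hε.le hε1 hB)
      (fun B hB ↦ stdGaussian_stretch_span_le Γ hε.le hε1 hB) hBΓ
    linarith only [e1, e2, hε2]
  have fin : (model l (Eu k) (Eu m)).real A' ≤ (model l (Eu k) (Eu m)).real (A' \ N) +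
      (model l (Eu k) (Eu m)).real N :=
    (measureReal_mono fun ω hω ↦ by by_cases h : ω ∈ N <;> simp_all).trans (measureReal_union_le _ _)
  linarith only [fin, key, hNle, hη]

end StrongDomination

/-! ### Conservative p-values -/

section Size

/-- The upper tail function of a law, evaluated at a variable with this law, is stochastically
larger than a uniform variable. -/
lemma measure_Ici_le {ν : Measure ℝ} [IsProbabilityMeasure ν] {u : ℝ} (hu : 0 ≤ u) :
    ν.real {x | ν.real (Set.Ici x) ≤ u} ≤ u := by
  set D := {x | ν.real (Set.Ici x) ≤ u} with hD
  have hup : ∀ {x z}, x ∈ D → x ≤ z → z ∈ D := fun {x z} hx hxz ↦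
    (measureReal_mono (Set.Ici_subset_Ici.2 hxz)).trans (show ν.real (Set.Ici x) ≤ u from hx)
  have hDm : MeasurableSet D :=
    Set.OrdConnected.measurableSet ⟨fun x hx z _ w hw ↦ hup hx hw.1⟩
  refine ENNReal.toReal_le_of_le_ofReal hu ?_
  rw [hDm.measure_eq_iSup_isCompact]
  refine iSup_le fun K ↦ iSup_le fun hKD ↦ iSup_le fun hK ↦ ?_
  rcases K.eq_empty_or_nonempty with rfl | hne
  · simp
  obtain ⟨x, hx, hmin⟩ := hK.exists_isLeast hne
  have h1 : ν.real (Set.Ici x) ≤ u := hKD hx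
  calc ν K ≤ ν (Set.Ici x) := measure_mono fun z hz ↦ hmin hz
    _ = ENNReal.ofReal (ν.real (Set.Ici x)) := (ofReal_measureReal).symm
    _ ≤ _ := ENNReal.ofReal_le_ofReal h1

/-- The conservative `p`-value `ρ (f ≥ f ω)` is stochastically larger than a uniform variable. -/
lemma prob_pvalue_le {Ω : Type*} [MeasurableSpace Ω] {ρ : Measure Ω} [IsProbabilityMeasure ρ]
    {f : Ω → ℝ} (hf : Measurable f) {u : ℝ} (hu : 0 ≤ u) :
    ρ.real {ω | ρ.real {ω' | f ω ≤ f ω'} ≤ u} ≤ u := by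
  have : IsProbabilityMeasure (ρ.map f) := Measure.isProbabilityMeasure_map hf.aemeasurable
  have h := measure_Ici_le (ν := ρ.map f) hu
  refine le_trans ?_ h
  have e : ∀ x, (ρ.map f).real (Set.Ici x) = ρ.real {ω' | x ≤ f ω'} := fun x ↦
    map_measureReal_apply hf measurableSet_Ici
  simp_rw [e]
  have hup : ∀ {x z}, ρ.real {ω' | x ≤ f ω'} ≤ u → x ≤ z → ρ.real {ω' | z ≤ f ω'} ≤ u :=
    fun {x z} hx hxz ↦ (measureReal_mono fun ω hω ↦ hxz.trans hω).trans hx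
  have hDm : MeasurableSet {x | ρ.real {ω' | x ≤ f ω'} ≤ u} :=
    Set.OrdConnected.measurableSet ⟨fun x hx z _ w hw ↦ hup hx hw.1⟩
  rw [map_measureReal_apply hf hDm]
  rfl

/-- The bound on the `p`-value integrated over an independent parameter. -/
lemma prod_prob_pvalue_le {X Ω : Type*} [MeasurableSpace X] [MeasurableSpace Ω] {ν : Measure X}
    [IsProbabilityMeasure ν] {ρ : Measure Ω} [IsProbabilityMeasure ρ] {f : X × Ω → ℝ}
    (hf : Measurable f) {u : ℝ} (hu : 0 ≤ u) :
    (ν.prod ρ).real {p | ρ.real {ω' | f p ≤ f (p.1, ω')} ≤ u} ≤ u := by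
  have hA : MeasurableSet {q : (X × Ω) × Ω | f q.1 ≤ f (q.1.1, q.2)} :=
    measurableSet_le (by fun_prop) (by fun_prop)
  have hm : Measurable fun p : X × Ω ↦ ρ.real {ω' | f p ≤ f (p.1, ω')} :=
    (measurable_measure_prodMk_left hA).ennreal_toReal
  have := prod_real_le_add (ρ := ν) (σ := ρ) (B := ∅) (measurableSet_le hm measurable_const)
    MeasurableSet.empty hu fun x ↦ by
      have := prob_pvalue_le (ρ := ρ) (f := fun ω ↦ f (x, ω)) (by fun_prop) hu
      simpa using this
  simpa using this

end Size

/-! ### Symmetry of the perturbation and stability of strength -/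

section Relation

variable {l : ℕ} {E : Type*} [NormedAddCommGroup E] [InnerProductSpace ℝ E]

/-- The relation is symmetric up to a factor `2`: the inverse of the linear change of columns is
again close to the identity. -/
lemma Rel.symm {δ : ℝ} {x : E} {t₁ t₂ : Fin l → E} (h : Rel δ x t₁ t₂) (hδ0 : 0 ≤ δ)
    (hδ : δ ≤ 1 / 2) : Rel (2 * δ) x t₂ t₁ := by
  obtain ⟨H, g, h1, h2, h3⟩ := h
  have hlow : ∀ v, ‖v‖ ≤ 2 * ‖H v‖ := fun v ↦ by
    have e1 := norm_sub_norm_le v (v - H v)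
    rw [sub_sub_cancel, norm_sub_rev v] at e1
    nlinarith only [e1, h1 v, hδ, norm_nonneg v, norm_nonneg (H v)]
  have hinj : Function.Injective H := by
    rw [injective_iff_map_eq_zero]
    intro v hv
    have := hlow v
    rw [hv, norm_zero, mul_zero] at this
    exact norm_le_zero_iff.1 this
  let G := (LinearEquiv.ofInjectiveEndo H hinj).symm
  have hHG : ∀ w, H (G w) = w := fun w ↦ (LinearEquiv.ofInjectiveEndo H hinj).apply_symm_apply w
  have hG : ∀ w, ‖G w‖ ≤ 2 * ‖w‖ := fun w ↦ by
    have := hlow (G w); rwa [hHG] at this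
  refine ⟨G, -(LinearMap.adjoint (G : EuclideanSpace ℝ (Fin l) →ₗ[ℝ] _) g), fun w ↦ ?_, ?_, fun w ↦ ?_⟩
  · have e1 := h1 (G w)
    rw [hHG, norm_sub_rev] at e1
    calc ‖G w - w‖ ≤ δ * ‖G w‖ := e1
      _ ≤ δ * (2 * ‖w‖) := by gcongr; exact hG w
      _ = _ := by ring
  · set g' := LinearMap.adjoint (G : EuclideanSpace ℝ (Fin l) →ₗ[ℝ] _) g with hg'
    rw [norm_neg]
    have e1 : ‖g'‖ ^ 2 ≤ δ * (2 * ‖g'‖) := by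
      rw [← real_inner_self_eq_norm_sq]
      nth_rewrite 1 [hg']
      rw [LinearMap.adjoint_inner_left]
      refine (real_inner_le_norm _ _).trans ?_
      exact mul_le_mul h2 (hG g') (norm_nonneg _) hδ0
    by_contra hc
    push Not at hc
    nlinarith only [e1, hc, hδ0]
  · have e1 := h3 (G w)
    rw [hHG] at e1
    rw [inner_neg_left, LinearMap.adjoint_inner_left, neg_smul]
    show comb t₁ w = comb t₂ (G w) + -(⟪g, G w⟫ • x)
    rw [e1]; abel

/-- The numerical part of `Rel.strong`: a length `N = √(k + A √k)` loses at most half of the excess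
`A √k` in its square when it is multiplied by `1 - δ` and a constant is subtracted from it. -/
lemma strong_real {k N δ A C κ s : ℝ} (hs : s ^ 2 = k) (hs1 : 1 ≤ s) (hN : N ^ 2 = k + A * s)
    (hN0 : 0 ≤ N) (hδ : δ ≤ 1 / 8) (hδs : δ * s ≤ C * κ) (hA1 : 1 ≤ A)
    (hA : 16 * (C * κ) ≤ A) (hA2 : 512 * (C ^ 2 * κ) ^ 2 ≤ A) :
    0 ≤ N * (1 - δ) - C ^ 2 * κ ∧ k + A / 2 * s ≤ (N * (1 - δ) - C ^ 2 * κ) ^ 2 := by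
  set D := C ^ 2 * κ with hDd
  set P := C * κ
  have hDN : 16 * D * N ≤ A * s := by
    refine abs_le_of_sq_le_sq' ?_ (by positivity) |>.2
    have e1 : (16 * D * N) ^ 2 = 256 * D ^ 2 * (s ^ 2 + A * s) := by
      rw [mul_pow, hN, hs]; ring
    rw [e1]
    have h1 : s ^ 2 + A * s ≤ 2 * (A * s ^ 2) := by
      nlinarith only [mul_nonneg (sub_nonneg.2 hA1) (sq_nonneg s),
        mul_nonneg (mul_nonneg (zero_le_one.trans hA1) (zero_le_one.trans hs1)) (sub_nonneg.2 hs1)]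
    calc 256 * D ^ 2 * (s ^ 2 + A * s) ≤ 256 * D ^ 2 * (2 * (A * s ^ 2)) := by gcongr
      _ = (512 * D ^ 2) * (A * s ^ 2) := by ring
      _ ≤ A * (A * s ^ 2) := by gcongr
      _ = _ := by ring
  have hδN : δ * N ^ 2 ≤ P * s + A * s / 8 := by
    rw [hN, ← hs]
    have : δ * (A * s) ≤ 1 / 8 * (A * s) := by gcongr
    have h2 : δ * s * s ≤ P * s := by gcongr
    nlinarith only [this, h2]
  have hN1 : 1 ≤ N := by
    by_contra hc
    push Not at hc
    nlinarith
  constructor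
  · -- `16 D N ≤ A s ≤ N²`
    have h3 : 16 * D * N ≤ N * N := by nlinarith only [hDN, hN, hs, sq_nonneg s]
    have h4 : 16 * D ≤ N := le_of_mul_le_mul_right h3 (by linarith)
    nlinarith
  · have e2 : (N * (1 - δ) - D) ^ 2 = N ^ 2 - 2 * (δ * N ^ 2) - 2 * (D * N) +
        (δ * N + D) ^ 2 := by ring
    rw [e2]
    have h5 : 16 * (P * s) ≤ A * s := by nlinarith
    nlinarith only [sq_nonneg (δ * N + D), hδN, hDN, h5, hN]

/-- A perturbation of the columns retains half of the excess of their squared length over `k`. -/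
lemma Rel.strong {δ A C κ k : ℝ} {x : E} {t₁ t₂ : Fin l → E} (h : Rel δ x t₁ t₂) (hδ0 : 0 ≤ δ)
    (hδ : δ ≤ 1 / 8) (hk : 1 ≤ k) (hδk : δ * √k ≤ C * κ) (hC : 0 ≤ C)
    (hx : ‖x‖ ≤ C * √k) (hA1 : 1 ≤ A) (hA : 16 * (C * κ) ≤ A) (hA2 : 512 * (C ^ 2 * κ) ^ 2 ≤ A)
    (ht : ∀ v, (k + A * √k) * ‖v‖ ^ 2 ≤ ‖comb t₁ v‖ ^ 2) (v : EuclideanSpace ℝ (Fin l)) :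
    (k + A / 2 * √k) * ‖v‖ ^ 2 ≤ ‖comb t₂ v‖ ^ 2 := by
  obtain ⟨H, g, h1, h2, h3⟩ := h
  have hs1 : 1 ≤ √k := Real.one_le_sqrt.2 hk
  have hs : √k ^ 2 = k := Real.sq_sqrt (by linarith)
  set N := √(k + A * √k) with hN
  have hN0 : 0 ≤ k + A * √k := by positivity
  have hN2 : N ^ 2 = k + A * √k := Real.sq_sqrt hN0
  obtain ⟨r1, r2⟩ := strong_real hs hs1 hN2 (Real.sqrt_nonneg _) hδ hδk hA1 hA hA2
  have b1 : N * ‖H v‖ ≤ ‖comb t₁ (H v)‖ := by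
    refine abs_le_of_sq_le_sq' ?_ (norm_nonneg _) |>.2
    rw [mul_pow, hN2]; exact ht (H v)
  have b2 : (1 - δ) * ‖v‖ ≤ ‖H v‖ := by
    have e1 := norm_sub_norm_le v (v - H v)
    rw [sub_sub_cancel, norm_sub_rev v] at e1
    linarith [h1 v]
  have b3 : ‖⟪g, v⟫ • x‖ ≤ C ^ 2 * κ * ‖v‖ := by
    rw [norm_smul]
    calc ‖⟪g, v⟫‖ * ‖x‖ ≤ (δ * ‖v‖) * (C * √k) := by
          refine mul_le_mul ((norm_inner_le_norm _ _).trans (by gcongr)) hx (norm_nonneg _)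
            (by positivity)
      _ = C * (δ * √k) * ‖v‖ := by ring
      _ ≤ C * (C * κ) * ‖v‖ := by gcongr
      _ = _ := by ring
  have b4 : (N * (1 - δ) - C ^ 2 * κ) * ‖v‖ ≤ ‖comb t₂ v‖ := by
    have e1 := norm_sub_norm_le (comb t₁ (H v)) (-(⟪g, v⟫ • x))
    rw [sub_neg_eq_add, ← h3, norm_neg] at e1
    have e2 : N * ((1 - δ) * ‖v‖) ≤ N * ‖H v‖ := by gcongr
    linarith
  calc (k + A / 2 * √k) * ‖v‖ ^ 2 ≤ (N * (1 - δ) - C ^ 2 * κ) ^ 2 * ‖v‖ ^ 2 := by gcongr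
    _ = ((N * (1 - δ) - C ^ 2 * κ) * ‖v‖) ^ 2 := by ring
    _ ≤ _ := pow_le_pow_left₀ (by positivity) b4 2

end Relation

/-! ### Matrices and their columns -/

section Columns

variable {p q l : ℕ}

/-- The first column of a matrix, as a Euclidean vector. -/
noncomputable def colHead (X : Matrix (Fin p) (Fin (l + 1)) ℝ) : Eu p := WithLp.toLp 2 fun r ↦ X r 0

/-- The remaining columns of a matrix, as Euclidean vectors. -/
noncomputable def colTail (X : Matrix (Fin p) (Fin (l + 1)) ℝ) : Fin l → Eu p :=
  fun i ↦ WithLp.toLp 2 fun r ↦ X r i.succ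

/-- All columns of a matrix, as Euclidean vectors. -/
noncomputable def colVec (t : Matrix (Fin p) (Fin l) ℝ) : Fin l → Eu p :=
  fun i ↦ WithLp.toLp 2 fun r ↦ t r i

@[simp] lemma colHead_cols (S : Fin p → ℝ) (t : Matrix (Fin p) (Fin l) ℝ) :
    colHead (cols S t) = WithLp.toLp 2 S := by ext r; simp [colHead, cols]

@[simp] lemma colTail_cols (S : Fin p → ℝ) (t : Matrix (Fin p) (Fin l) ℝ) :
    colTail (cols S t) = colVec t := by ext i r; simp [colTail, cols, colVec]

lemma toLp_mulVec (t : Matrix (Fin p) (Fin l) ℝ) (v : Fin l → ℝ) :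
    WithLp.toLp 2 (t *ᵥ v) = comb (colVec t) (WithLp.toLp 2 v) := by
  ext r
  simp [comb_apply, colVec, Matrix.mulVec, dotProduct, mul_comm]

lemma toLp_mulVec_cons (X : Matrix (Fin p) (Fin (l + 1)) ℝ) (v₀ : ℝ) (v : Fin l → ℝ) :
    WithLp.toLp 2 (X *ᵥ vecCons v₀ v) = v₀ • colHead X + comb (colTail X) (WithLp.toLp 2 v) := by
  ext r
  simp [comb_apply, colHead, colTail, Matrix.mulVec, dotProduct, Fin.sum_univ_succ, mul_comm]

lemma dotProduct_gram_mulVec (X : Matrix (Fin p) (Fin l) ℝ) (w : Fin l → ℝ) :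
    w ⬝ᵥ ((Xᵀ * X) *ᵥ w) = ‖(WithLp.toLp 2 (X *ᵥ w) : Eu p)‖ ^ 2 := by
  rw [← Matrix.mulVec_mulVec, Matrix.dotProduct_mulVec, Matrix.vecMul_transpose,
    EuclideanSpace.real_norm_sq_eq]
  simp [dotProduct, sq]

lemma gram_zero_zero (X : Matrix (Fin p) (Fin (l + 1)) ℝ) : (Xᵀ * X) 0 0 = ‖colHead X‖ ^ 2 := by
  rw [EuclideanSpace.real_norm_sq_eq]
  simp [Matrix.mul_apply, colHead, sq]

lemma vecCons_eq_zero_iff {v₀ : ℝ} {v : Fin l → ℝ} : vecCons v₀ v = 0 ↔ v₀ = 0 ∧ v = 0 := by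
  constructor
  · intro h
    exact ⟨by simpa using congrFun h 0, by ext i; simpa using congrFun h i.succ⟩
  · rintro ⟨rfl, rfl⟩; simp

lemma posSemidef_gram (X : Matrix (Fin p) (Fin l) ℝ) : (Xᵀ * X).PosSemidef := by
  have := Matrix.posSemidef_conjTranspose_mul_self X
  rwa [Matrix.conjTranspose_eq_transpose_of_trivial] at this

lemma posDef_gram_iff_fullRank (G : Matrix (Fin q) (Fin (l + 1)) ℝ) :
    (Gᵀ * G).PosDef ↔ FullRank (colHead G) (colTail G) := by
  constructor
  · intro h v₀ v hv
    by_contra hc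
    have hw : vecCons v₀ v.ofLp ≠ 0 := by
      rw [Ne, vecCons_eq_zero_iff]
      exact fun h0 ↦ hc ⟨h0.1, by ext i; simpa using congrFun h0.2 i⟩
    have := h.dotProduct_mulVec_pos hw
    rw [star_trivial, dotProduct_gram_mulVec, toLp_mulVec_cons] at this
    simp [hv] at this
  · intro h
    refine Matrix.PosDef.of_dotProduct_mulVec_pos (posSemidef_gram G).1 fun w hw ↦ ?_
    rw [star_trivial, dotProduct_gram_mulVec]
    obtain ⟨v₀, v, rfl⟩ : ∃ v₀ v, w = vecCons v₀ v := ⟨_, _, (Matrix.cons_head_tail w).symm⟩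
    rw [toLp_mulVec_cons]
    refine h.pos fun h0 ↦ hw ?_
    rw [vecCons_eq_zero_iff]
    exact ⟨h0.1, by simpa using h0.2⟩

/-- The smallest root of the determinantal equation is the minimum of the ratio of the two
quadratic forms. -/
lemma sInf_root_eq (X : Matrix (Fin p) (Fin (l + 1)) ℝ) (G : Matrix (Fin q) (Fin (l + 1)) ℝ)
    (h : FullRank (colHead G) (colTail G)) :
    sInf {x : ℝ | (Xᵀ * X - x • (Gᵀ * G)).det = 0} =
      ⨅ q : {q : ℚ × (Fin l → ℚ) // q ≠ 0},
        ratio (colHead X) (colTail X) (colHead G) (colTail G) q.1.1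
          (WithLp.toLp 2 fun i ↦ (q.1.2 i : ℝ)) := by
  obtain ⟨v₀, v, hv, hmin⟩ := exists_minRoot (colHead X) (colTail X) h
  rw [iInf_ratio_eq _ _ h hv hmin]
  set L := ratio (colHead X) (colTail X) (colHead G) (colTail G) v₀ v with hL
  have hquad : ∀ (x : ℝ) (w : Fin (l + 1) → ℝ), w ⬝ᵥ ((Xᵀ * X - x • (Gᵀ * G)) *ᵥ w) =
      ‖(WithLp.toLp 2 (X *ᵥ w) : Eu p)‖ ^ 2 - x * ‖(WithLp.toLp 2 (G *ᵥ w) : Eu q)‖ ^ 2 := by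
    intro x w
    rw [Matrix.sub_mulVec, dotProduct_sub, Matrix.smul_mulVec, dotProduct_smul,
      dotProduct_gram_mulVec, dotProduct_gram_mulVec, smul_eq_mul]
  apply IsLeast.csInf_eq
  constructor
  · show (Xᵀ * X - L • (Gᵀ * G)).det = 0
    have hPSD : (Xᵀ * X - L • (Gᵀ * G)).PosSemidef := by
      refine Matrix.PosSemidef.of_dotProduct_mulVec_nonneg ?_ fun w ↦ ?_
      · refine (posSemidef_gram X).1.sub ?_
        have := (posSemidef_gram G).1
        rw [Matrix.IsHermitian, Matrix.conjTranspose_smul, this, star_trivial]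
      · obtain ⟨w₀, w, rfl⟩ : ∃ v₀ v, w = vecCons v₀ v := ⟨_, _, (Matrix.cons_head_tail w).symm⟩
        rw [star_trivial, hquad, toLp_mulVec_cons, toLp_mulVec_cons, sub_nonneg]
        by_cases hw : w₀ = 0 ∧ w = 0
        · simp [hw.1, hw.2]
        · have hw' : ¬ (w₀ = 0 ∧ (WithLp.toLp 2 w : EuclideanSpace ℝ (Fin l)) = 0) := by
            simpa using hw
          have := hmin w₀ (WithLp.toLp 2 w) hw'
          rwa [ratio, le_div_iff₀ (h.pos hw')] at this
    refine Matrix.exists_mulVec_eq_zero_iff.1 ⟨vecCons v₀ v.ofLp, ?_,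
      (hPSD.dotProduct_mulVec_zero_iff _).1 ?_⟩
    · rw [Ne, vecCons_eq_zero_iff]
      exact fun h0 ↦ hv ⟨h0.1, by ext i; simpa using congrFun h0.2 i⟩
    · rw [star_trivial, hquad, toLp_mulVec_cons, toLp_mulVec_cons, WithLp.toLp_ofLp, hL, ratio,
        div_mul_cancel₀ _ (h.pos hv).ne', sub_self]
  · intro x hx
    obtain ⟨w, hw, hw0⟩ := Matrix.exists_mulVec_eq_zero_iff.2 (show _ = _ from hx)
    obtain ⟨w₀, w, rfl⟩ : ∃ v₀ v, w = vecCons v₀ v := ⟨_, _, (Matrix.cons_head_tail w).symm⟩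
    have h1 := hquad x (vecCons w₀ w)
    rw [hw0, dotProduct_zero, toLp_mulVec_cons, toLp_mulVec_cons] at h1
    have hw' : ¬ (w₀ = 0 ∧ (WithLp.toLp 2 w : EuclideanSpace ℝ (Fin l)) = 0) := by
      rw [Ne, vecCons_eq_zero_iff] at hw
      simpa using hw
    refine (hmin w₀ (WithLp.toLp 2 w) hw').trans (le_of_eq ?_)
    rw [ratio, div_eq_iff (h.pos hw').ne']
    linarith

/-- A measurable version of `psi1`, in which the determinantal root is replaced by an infimum over
rational directions. -/
noncomputable def psiRat (X : Matrix (Fin p) (Fin (l + 1)) ℝ)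
    (W : Matrix (Fin (l + 1)) (Fin (l + 1)) ℝ) : ℝ :=
  (Xᵀ * X) 0 0 / W 0 0 - ⨅ q : {q : ℚ × (Fin l → ℚ) // q ≠ 0},
    let w : Fin (l + 1) → ℝ := vecCons (q.1.1 : ℝ) fun i ↦ (q.1.2 i : ℝ)
    (w ⬝ᵥ ((Xᵀ * X) *ᵥ w)) / (w ⬝ᵥ (W *ᵥ w))

lemma psiRat_gram (X : Matrix (Fin p) (Fin (l + 1)) ℝ) (G : Matrix (Fin q) (Fin (l + 1)) ℝ) :
    psiRat X (Gᵀ * G) = lr (colHead X) (colTail X) (colHead G) (colTail G) := by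
  unfold psiRat lr ratio
  simp only [dotProduct_gram_mulVec, toLp_mulVec_cons, gram_zero_zero]

lemma psi1_gram (X : Matrix (Fin p) (Fin (l + 1)) ℝ) (G : Matrix (Fin q) (Fin (l + 1)) ℝ)
    (h : FullRank (colHead G) (colTail G)) :
    psi1 (Xᵀ * X) (Gᵀ * G) = lr (colHead X) (colTail X) (colHead G) (colTail G) := by
  rw [psi1, sInf_root_eq X G h, lr, gram_zero_zero, gram_zero_zero]

open scoped MatrixOrder in
lemma exists_eq_transpose_mul_self {X : Matrix (Fin p) (Fin p) ℝ} (hX : X.PosSemidef) :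
    ∃ B : Matrix (Fin p) (Fin p) ℝ, X = Bᵀ * B := by
  obtain ⟨B, hB⟩ := CStarAlgebra.nonneg_iff_eq_star_mul_self.1 hX.nonneg
  exact ⟨B, by simpa [Matrix.star_eq_conjTranspose] using hB⟩

lemma psi1_eq_psiRat (X : Matrix (Fin p) (Fin (l + 1)) ℝ)
    {W : Matrix (Fin (l + 1)) (Fin (l + 1)) ℝ} (hW : W.PosDef) :
    psi1 (Xᵀ * X) W = psiRat X W := by
  obtain ⟨B, rfl⟩ := exists_eq_transpose_mul_self hW.posSemidef
  rw [psi1_gram X B ((posDef_gram_iff_fullRank B).1 hW), psiRat_gram]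

end Columns

/-! ### Columns of matrices with independent normal rows -/

section Laws

lemma toLp_isometry_transpose (n p : ℕ) : ∃ T : PiLp 2 (fun _ : Fin n ↦ Eu p) ≃ₗᵢ[ℝ]
    PiLp 2 (fun _ : Fin p ↦ Eu n), ∀ R i r, T R i r = R r i := by
  refine ⟨⟨⟨⟨⟨fun R ↦ WithLp.toLp 2 fun i ↦ WithLp.toLp 2 fun r ↦ R r i, fun R R' ↦ ?_⟩, fun c R ↦ ?_⟩,
    fun R ↦ WithLp.toLp 2 fun i ↦ WithLp.toLp 2 fun r ↦ R r i, fun R ↦ ?_, fun R ↦ ?_⟩, fun R ↦ ?_⟩,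
    fun R i r ↦ rfl⟩
  · ext; simp
  · ext; simp
  · ext; simp
  · ext; simp
  · refine (sq_eq_sq₀ (norm_nonneg _) (norm_nonneg _)).1 ?_
    rw [PiLp.norm_sq_eq_of_L2, PiLp.norm_sq_eq_of_L2]
    simp_rw [EuclideanSpace.real_norm_sq_eq]
    rw [Finset.sum_comm]
    rfl

/-- If the rows of a matrix are independent standard normal vectors, so are its columns. -/
lemma map_transpose_pi_stdGaussian (n p : ℕ) :
    (Measure.pi fun _ : Fin n ↦ stdGaussian (Eu p)).map
      (fun R (i : Fin p) ↦ (WithLp.toLp 2 fun r ↦ R r i : Eu n)) =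
    Measure.pi fun _ : Fin p ↦ stdGaussian (Eu n) := by
  obtain ⟨T, hT⟩ := toLp_isometry_transpose n p
  have h1 := map_pi_stdGaussian (E := Eu p) (ι := Fin n)
  have h2 := map_pi_stdGaussian (E := Eu n) (ι := Fin p)
  have h3 := stdGaussian_map T
  rw [← h1, ← h2, Measure.map_map (by fun_prop) (by fun_prop)] at h3
  have h4 := congrArg (fun μ ↦ μ.map (WithLp.ofLp (p := 2))) h3
  simp only at h4
  rw [Measure.map_map (by fun_prop) (by fun_prop), Measure.map_map (by fun_prop) (by fun_prop)] at h4
  have e1 : (WithLp.ofLp (p := 2)) ∘ ((WithLp.toLp 2) : (Fin p → Eu n) → _) = id := rfl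
  rw [e1, Measure.map_id] at h4
  rw [← h4]
  congr 1
  ext R i r
  exact (hT _ _ _).symm

/-- The law of the columns of a matrix with independent standard normal entries, together with an
independent standard normal vector. -/
lemma map_model (k m l : ℕ) :
    ((Measure.pi fun _ : Fin k ↦ gaussianReal 0 1).prod
      (Measure.pi fun _ : Fin m ↦ Measure.pi fun _ : Fin (l + 1) ↦ gaussianReal 0 1)).map
      (fun x ↦ (colTail (Matrix.of x.2), (WithLp.toLp 2 x.1 : Eu k), colHead (Matrix.of x.2))) =
    model l (Eu k) (Eu m) := by
  have h1 : MeasurePreserving (WithLp.toLp 2) (Measure.pi fun _ : Fin k ↦ gaussianReal 0 1)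
    (stdGaussian (Eu k)) := ⟨by fun_prop, map_pi_eq_stdGaussian⟩
  have h2 : MeasurePreserving (WithLp.toLp 2) (Measure.pi fun _ : Fin (l + 1) ↦ gaussianReal 0 1)
    (stdGaussian (Eu (l + 1))) := ⟨by fun_prop, map_pi_eq_stdGaussian⟩
  have h3 := measurePreserving_pi (fun _ : Fin m ↦ _) (fun _ ↦ _) fun _ : Fin m ↦ h2
  have h4 : MeasurePreserving _ _ _ := ⟨by fun_prop, map_transpose_pi_stdGaussian m (l + 1)⟩
  have h5 := measurePreserving_piFinSuccAbove (fun _ : Fin (l + 1) ↦ stdGaussian (Eu m)) 0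
  have h6 := h5.comp (h4.comp h3)
  have h7 := h1.prod h6
  have h8 : MeasurePreserving (fun x : Eu k × Eu m × (Fin l → Eu m) ↦ (x.2.2, x.1, x.2.1))
      ((stdGaussian (Eu k)).prod ((stdGaussian (Eu m)).prod
        (Measure.pi fun _ : Fin l ↦ stdGaussian (Eu m)))) (model l (Eu k) (Eu m)) :=
    (Measure.measurePreserving_swap).comp (measurePreserving_prodAssoc _ _ _).symm
  exact (h8.comp h7).map_eq

end Laws

/-! ### Quantiles -/

section Quantile

lemma measureReal_Iio_le {ν : Measure ℝ} [IsProbabilityMeasure ν] {b x : ℝ} (hb : 0 ≤ b)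
    (h : ∀ y < x, ν.real (Set.Iic y) ≤ b) : ν.real (Set.Iio x) ≤ b := by
  refine ENNReal.toReal_le_of_le_ofReal hb ?_
  rw [measurableSet_Iio.measure_eq_iSup_isCompact]
  refine iSup_le fun K ↦ iSup_le fun hKD ↦ iSup_le fun hK ↦ ?_
  rcases K.eq_empty_or_nonempty with rfl | hne
  · simp
  obtain ⟨z, hz, hmax⟩ := hK.exists_isGreatest hne
  calc ν K ≤ ν (Set.Iic z) := measure_mono fun w hw ↦ hmax hw
    _ = ENNReal.ofReal (ν.real (Set.Iic z)) := (ofReal_measureReal).symm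
    _ ≤ _ := ENNReal.ofReal_le_ofReal (h z (hKD hz))

/-- If the distribution function of `f` is uniformly `η`-close to that of `g`, then a quantile of
`f` is nearly a quantile of `g`. -/
lemma quantile_bounds {X Ω : Type*} [MeasurableSpace X] [MeasurableSpace Ω] {μ : Measure X}
    [IsProbabilityMeasure μ] {ρ : Measure Ω} [IsProbabilityMeasure ρ] (f : X → ℝ) {g : Ω → ℝ}
    (hg : Measurable g) {q η : ℝ} (hη : 0 ≤ η)
    (h : ∀ c, |μ.real {x | f x ≤ c} - ρ.real {ω | g ω ≤ c}| ≤ η) (h0 : η < q) (h1 : η < 1 - q) :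
    ρ.real {ω | quantile μ f q < g ω} ≤ 1 - q + η ∧
      1 - q - η ≤ ρ.real {ω | quantile μ f q ≤ g ω} := by
  have : IsProbabilityMeasure (ρ.map g) := Measure.isProbabilityMeasure_map hg.aemeasurable
  set ν := ρ.map g with hν
  have hF : ∀ c, cdf ν c = ρ.real {ω | g ω ≤ c} := fun c ↦ by
    rw [cdf_eq_real, map_measureReal_apply hg measurableSet_Iic]; rfl
  set Q := {c : ℝ | q ≤ μ.real {x | f x ≤ c}} with hQ
  have hne : Q.Nonempty := by
    obtain ⟨c, hc⟩ := ((tendsto_cdf_atTop ν).eventually_const_lt (u := q + η) (by linarith)).exists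
    refine ⟨c, ?_⟩
    have := (abs_le.1 (h c)).1
    rw [hF] at hc
    show q ≤ _
    linarith
  have hbd : BddBelow Q := by
    obtain ⟨c, hc⟩ := ((tendsto_cdf_atBot ν).eventually_lt_const (u := q - η) (by linarith)).exists
    refine ⟨c, fun z hz ↦ ?_⟩
    by_contra hzc
    push Not at hzc
    have h2 := (abs_le.1 (h c)).2
    rw [hF] at hc
    have h3 : q ≤ μ.real {x | f x ≤ z} := hz
    have h4 : μ.real {x | f x ≤ z} ≤ μ.real {x | f x ≤ c} :=
      measureReal_mono fun x hx ↦ le_trans hx hzc.le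
    linarith
  set c₀ := quantile μ f q with hc₀
  have hup : ∀ c, c₀ < c → q ≤ μ.real {x | f x ≤ c} := fun c hc ↦ by
    obtain ⟨z, hz, hzc⟩ := (csInf_lt_iff hbd hne).1 hc
    exact le_trans hz (measureReal_mono fun x hx ↦ le_trans hx hzc.le)
  have hlow : ∀ c, c < c₀ → μ.real {x | f x ≤ c} < q := fun c hc ↦ by
    by_contra hcon
    exact absurd (csInf_le hbd (not_lt.1 hcon)) (not_le.2 hc)
  constructor
  · have h2 : q - η ≤ cdf ν c₀ := by
      have ht : Tendsto (cdf ν) (𝓝[>] c₀) (𝓝 (cdf ν c₀)) :=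
        ((cdf ν).right_continuous c₀).mono_left (nhdsWithin_mono _ Set.Ioi_subset_Ici_self)
      refine ge_of_tendsto ht ?_
      filter_upwards [self_mem_nhdsWithin] with c hc
      rw [hF]
      have := hup c hc
      have := (abs_le.1 (h c)).2
      linarith
    rw [hF] at h2
    have h3 := probReal_compl_eq_one_sub (μ := ρ) (s := {ω | g ω ≤ c₀})
      (measurableSet_le hg measurable_const)
    have e : {ω | g ω ≤ c₀}ᶜ = {ω | c₀ < g ω} := by ext ω; simp
    rw [e] at h3
    linarith
  · have h2 : ν.real (Set.Iio c₀) ≤ q + η := by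
      refine measureReal_Iio_le (by linarith) fun y hy ↦ ?_
      rw [← cdf_eq_real, hF]
      have := hlow y hy
      have := (abs_le.1 (h y)).1
      linarith
    rw [map_measureReal_apply hg measurableSet_Iio] at h2
    have h3 := probReal_compl_eq_one_sub (μ := ρ) (s := {ω | g ω < c₀})
      (measurableSet_lt hg measurable_const)
    have e : {ω | g ω < c₀}ᶜ = {ω | c₀ ≤ g ω} := by ext ω; simp
    rw [e] at h3
    have h4 : ρ.real {ω | g ω < c₀} ≤ q + η := h2
    linarith

end Quantile

/-! ### The critical value function -/

section CriticalValueFunction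

variable {l k m : ℕ}

lemma measurable_cols_apply (t : Matrix (Fin k) (Fin l) ℝ) (r : Fin k) (j : Fin (l + 1)) :
    Measurable fun S : Fin k → ℝ ↦ cols S t r j := by
  refine Fin.cases ?_ (fun i ↦ ?_) j
  · simpa [cols] using measurable_pi_apply r
  · simp [cols]

lemma measurable_psiRat (t : Matrix (Fin k) (Fin l) ℝ) :
    Measurable fun x : (Fin k → ℝ) × (Fin (l + 1) → Fin (l + 1) → ℝ) ↦
      psiRat (cols x.1 t) (Matrix.of x.2) := by
  have hX : ∀ r j, Measurable fun x : (Fin k → ℝ) × (Fin (l + 1) → Fin (l + 1) → ℝ) ↦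
      cols x.1 t r j := fun r j ↦ (measurable_cols_apply t r j).comp measurable_fst
  have hW : ∀ i j, Measurable fun x : (Fin k → ℝ) × (Fin (l + 1) → Fin (l + 1) → ℝ) ↦
      x.2 i j := fun i j ↦ by fun_prop
  unfold psiRat
  simp only [dotProduct, Matrix.mulVec, Matrix.mul_apply, Matrix.transpose_apply, Matrix.of_apply]
  refine Measurable.sub (Measurable.div (Finset.measurable_fun_sum _ fun r _ ↦ (hX r 0).mul (hX r 0))
    (hW 0 0)) (Measurable.iInf fun q ↦ Measurable.div ?_ ?_)
  · exact Finset.measurable_fun_sum _ fun i _ ↦ (Finset.measurable_fun_sum _ fun j _ ↦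
      (Finset.measurable_fun_sum _ fun r _ ↦ (hX r i).mul (hX r j)).mul_const _).const_mul _
  · exact Finset.measurable_fun_sum _ fun i _ ↦ (Finset.measurable_fun_sum _ fun j _ ↦
      (hW i j).mul_const _).const_mul _

lemma measurableSet_posDef (p : ℕ) :
    MeasurableSet {W : Fin p → Fin p → ℝ | (Matrix.of W).PosDef} := by
  have h1 : IsClosed {W : Fin p → Fin p → ℝ | (Matrix.of W)ᵀ = Matrix.of W} :=
    isClosed_eq (by fun_prop) (by fun_prop)
  have h2 : IsClosed {W : Fin p → Fin p → ℝ | ∀ x : Fin p → ℝ, 0 ≤ x ⬝ᵥ (Matrix.of W *ᵥ x)} := by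
    simp only [Set.ofPred_forall]
    exact isClosed_iInter fun x ↦ isClosed_le (by fun_prop) (by fun_prop)
  have h3 : IsOpen {W : Fin p → Fin p → ℝ | (Matrix.of W).det ≠ 0} :=
    isOpen_ne_fun (by fun_prop) (by fun_prop)
  convert (h1.measurableSet.inter h2.measurableSet).inter h3.measurableSet using 1
  ext W
  simp only [Set.mem_inter_iff, Set.mem_ofPred_eq]
  constructor
  · intro h
    refine ⟨⟨by simpa [Matrix.conjTranspose_eq_transpose_of_trivial] using h.1.eq, fun x ↦ ?_⟩, h.det_pos.ne'⟩
    simpa using h.posSemidef.dotProduct_mulVec_nonneg x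
  · rintro ⟨⟨h1, h2⟩, h3⟩
    have h4 : (Matrix.of W).PosSemidef := Matrix.PosSemidef.of_dotProduct_mulVec_nonneg
      (by rw [Matrix.IsHermitian, Matrix.conjTranspose_eq_transpose_of_trivial]; exact h1)
      fun x ↦ by simpa using h2 x
    rw [h4.posDef_iff_isUnit, Matrix.isUnit_iff_isUnit_det, isUnit_iff_ne_zero]
    exact h3

lemma abs_measureReal_sub_le {X : Type*} [MeasurableSpace X] {μ : Measure X} [IsProbabilityMeasure μ]
    {s s' G : Set X} (h : s ∩ G = s' ∩ G) : |μ.real s - μ.real s'| ≤ μ.real Gᶜ := by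
  have key : ∀ {s s' : Set X}, s ∩ G = s' ∩ G → μ.real s ≤ μ.real s' + μ.real Gᶜ := by
    intro s s' h
    refine (measureReal_mono (fun x hx ↦ ?_)).trans (measureReal_union_le s' Gᶜ)
    by_cases hxG : x ∈ G
    · exact Or.inl ((h ▸ (⟨hx, hxG⟩ : x ∈ s ∩ G) : x ∈ s' ∩ G)).1
    · exact Or.inr hxG
  rw [abs_le]
  constructor
  · linarith [key h.symm]
  · linarith [key h]

/-- The critical value is nearly the `1 - a` quantile of the statistic in the Gaussian model. The
determinantal root defining the former agrees with the infimum in `lr` except where `γ` and `Γ` are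
linearly dependent. -/
lemma critVal_bounds {n : ℕ} (t : Matrix (Fin k) (Fin l) ℝ) {a η : ℝ} (hηa : η < a)
    (hηa' : η < 1 - a)
    (hη : (model l (Eu k) (Eu (n - k))).real {ω | ¬ FullRank ω.2.2 ω.1} ≤ η) :
    (model l (Eu k) (Eu (n - k))).real
      {ω | critVal n k a t < lr ω.2.1 (colVec t) ω.2.2 ω.1} ≤ a + η ∧
    a - η ≤ (model l (Eu k) (Eu (n - k))).real
      {ω | critVal n k a t ≤ lr ω.2.1 (colVec t) ω.2.2 ω.1} := by
  set Q := (Measure.pi fun _ : Fin k ↦ gaussianReal 0 1).prod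
      (Measure.pi fun _ : Fin (n - k) ↦ Measure.pi fun _ : Fin (l + 1) ↦ gaussianReal 0 1) with hQ
  let gram : (Fin (n - k) → Fin (l + 1) → ℝ) → Fin (l + 1) → Fin (l + 1) → ℝ :=
    fun G i j ↦ ∑ r, G r i * G r j
  have hgram : Measurable gram := by fun_prop
  have hgr : ∀ G, Matrix.of (gram G) = (Matrix.of G)ᵀ * Matrix.of G := fun G ↦ by
    ext i j; simp [gram, Matrix.mul_apply]
  let Φ : (Fin k → ℝ) × (Fin (n - k) → Fin (l + 1) → ℝ) → (Fin l → Eu (n - k)) × Eu k × Eu (n - k) :=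
    fun x ↦ (colTail (Matrix.of x.2), (WithLp.toLp 2 x.1 : Eu k), colHead (Matrix.of x.2))
  have hΦ : Measurable Φ := by unfold Φ colTail colHead; fun_prop
  have hΦm : Q.map Φ = model l (Eu k) (Eu (n - k)) := map_model k (n - k) l
  set ν := (Measure.pi fun _ : Fin k => gaussianReal 0 1).prod (wishart (n - k) (l + 1)) with hν
  have hνQ : ν = Q.map (Prod.map id gram) := by
    rw [hν, wishart, hQ, ← Measure.map_prod_map _ _ measurable_id hgram, Measure.map_id]
  have : IsProbabilityMeasure ν := by
    rw [hνQ]; exact Measure.isProbabilityMeasure_map (by fun_prop)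
  have hpre := measurable_psiRat (l := l) t
  have hlr : Measurable fun ω : (Fin l → Eu (n - k)) × Eu k × Eu (n - k) ↦
    lr ω.2.1 (colVec t) ω.2.2 ω.1 := by fun_prop
  set Gd : Set ((Fin k → ℝ) × (Fin (l + 1) → Fin (l + 1) → ℝ)) := {x | (Matrix.of x.2).PosDef}
  have hGd : MeasurableSet Gd := measurable_snd (measurableSet_posDef (l + 1))
  have hη0 : 0 ≤ η := le_trans measureReal_nonneg hη
  have hbad : ν.real Gdᶜ ≤ η := by
    rw [hνQ, map_measureReal_apply (by fun_prop) hGd.compl]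
    refine le_trans ?_ hη
    rw [← hΦm]
    refine ENNReal.toReal_mono (by finiteness) (le_trans (measure_mono ?_)
      (Measure.le_map_apply hΦ.aemeasurable _))
    intro x hx hf
    apply hx
    show (Matrix.of (gram x.2)).PosDef
    rw [hgr, posDef_gram_iff_fullRank]
    exact hf
  have hclose : ∀ c, |ν.real {x | psi1 ((cols x.1 t)ᵀ * cols x.1 t) (Matrix.of x.2) ≤ c} -
      (model l (Eu k) (Eu (n - k))).real {ω | lr ω.2.1 (colVec t) ω.2.2 ω.1 ≤ c}| ≤ η := by
    intro c
    have e : (model l (Eu k) (Eu (n - k))).real {ω | lr ω.2.1 (colVec t) ω.2.2 ω.1 ≤ c} =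
        ν.real {x | psiRat (cols x.1 t) (Matrix.of x.2) ≤ c} := by
      rw [← hΦm, hνQ, map_measureReal_apply hΦ (measurableSet_le hlr measurable_const),
        map_measureReal_apply (by fun_prop) (measurableSet_le hpre measurable_const)]
      congr 1
      ext x
      simp only [Set.mem_preimage, Set.mem_ofPred_eq, Prod.map_fst, Prod.map_snd, id]
      rw [hgr, psiRat_gram, colHead_cols, colTail_cols]
    rw [e]
    refine (abs_measureReal_sub_le (G := Gd) ?_).trans hbad
    ext x
    simp only [Set.mem_inter_iff, Set.mem_ofPred_eq, and_congr_left_iff]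
    intro hx
    rw [psi1_eq_psiRat _ hx]
  have := quantile_bounds (μ := ν) _ hlr hη0 hclose (q := 1 - a) hηa' (by linarith)
  rwa [sub_sub_cancel] at this

end CriticalValueFunction

/-! ### The rejection probability under nearly correct critical values -/

section Conditional

variable {l k m : ℕ}

/-- The law of the data after reduction: the noise in `T`, and the triple `(Γ, S, γ)`. -/
noncomputable def dataLaw (l k m : ℕ) :
    Measure ((Fin l → Eu k) × ((Fin l → Eu m) × Eu k × Eu m)) :=
  (Measure.pi fun _ : Fin l ↦ stdGaussian (Eu k)).prod (model l (Eu k) (Eu m))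

instance : IsProbabilityMeasure (dataLaw l k m) := by unfold dataLaw; infer_instance

/-- The test statistic computed from the reduced data, where `M` is the mean of `T`. -/
noncomputable def dataLr (M : Fin l → Eu k)
    (d : (Fin l → Eu k) × ((Fin l → Eu m) × Eu k × Eu m)) : ℝ :=
  lr d.2.2.1 (M + d.1) d.2.2.2 d.2.1

lemma measurable_dataLr (M : Fin l → Eu k) : Measurable (dataLr (m := m) M) := by
  unfold dataLr
  refine measurable_lr_comp (by fun_prop) ?_ (by fun_prop) (by fun_prop)
  exact measurable_const.add measurable_fst

/-- A critical value `c` is acceptable for the column matrix `t` if it lies between nearby quantiles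
of the statistic at a column matrix `τ` whose law of the statistic is close to that at `t`. -/
def Acceptable (m : ℕ) (a η : ℝ) (t : Fin l → Eu k) (c : ℝ) : Prop :=
  ∃ τ : Fin l → Eu k,
    (model l (Eu k) (Eu m)).real {ω | c < lr ω.2.1 τ ω.2.2 ω.1} ≤ a + η ∧
    a - η ≤ (model l (Eu k) (Eu m)).real {ω | c ≤ lr ω.2.1 τ ω.2.2 ω.1} ∧
    (∀ y, (model l (Eu k) (Eu m)).real {ω | y ≤ lr ω.2.1 t ω.2.2 ω.1} ≤
      (model l (Eu k) (Eu m)).real {ω | y < lr ω.2.1 τ ω.2.2 ω.1} + η) ∧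
    ∀ y, (model l (Eu k) (Eu m)).real {ω | y ≤ lr ω.2.1 τ ω.2.2 ω.1} ≤
      (model l (Eu k) (Eu m)).real {ω | y < lr ω.2.1 t ω.2.2 ω.1} + η

/-- If off a small event `B` the test rejects when the statistic reaches an acceptable critical
value, then its rejection probability is near `a`. Conditionally on the noise `Γ` in `T = M + Γ`, a
rejection implies that the conservative p-value of the statistic is at most `a + 2 η`, and a
non-rejection that the reverse p-value is at most `1 - a + 2 η`. Both p-values are stochastically
larger than uniform, so that no continuity of the law of the statistic is needed. -/
lemma abs_rejection_sub_le {Ω : Type*} [MeasurableSpace Ω] {P : Measure Ω} [IsProbabilityMeasure P]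
    (M : Fin l → Eu k) {D : Ω → (Fin l → Eu k) × ((Fin l → Eu m) × Eu k × Eu m)}
    (hD : HasLaw D (dataLaw l k m) P) {R : Set Ω}
    {B : Set ((Fin l → Eu k) × ((Fin l → Eu m) × Eu k × Eu m))} {a η β : ℝ}
    (ha0 : 0 ≤ a) (ha1 : a ≤ 1) (hη : 0 ≤ η) (hB : (dataLaw l k m).real B ≤ β)
    (h : ∀ ω, D ω ∉ B → ∃ c, (ω ∈ R ↔ c ≤ dataLr M (D ω)) ∧
      Acceptable m a η (M + (D ω).1) c) :
    |P.real R - a| ≤ 2 * η + β := by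
  set ρ := model l (Eu k) (Eu m) with hρ
  have hpre : ∀ s, P.real (D ⁻¹' s) ≤ (dataLaw l k m).real s := fun s ↦ by
    rw [← hD.map_eq]
    exact ENNReal.toReal_mono (by rw [hD.map_eq]; finiteness) (Measure.le_map_apply hD.aemeasurable _)
  have hf := measurable_dataLr (m := m) M
  set U := {d : (Fin l → Eu k) × ((Fin l → Eu m) × Eu k × Eu m) |
    ρ.real {ω' | dataLr M d ≤ dataLr M (d.1, ω')} ≤ a + 2 * η}
  set L := {d : (Fin l → Eu k) × ((Fin l → Eu m) × Eu k × Eu m) |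
    ρ.real {ω' | - dataLr M d ≤ - dataLr M (d.1, ω')} ≤ 1 - a + 2 * η}
  have hU : (dataLaw l k m).real U ≤ a + 2 * η := prod_prob_pvalue_le hf (by linarith)
  have hL : (dataLaw l k m).real L ≤ 1 - a + 2 * η :=
    prod_prob_pvalue_le (f := fun d ↦ - dataLr M d) hf.neg (by linarith)
  have hRU : R ⊆ D ⁻¹' (U ∪ B) := by
    intro ω hω
    by_cases hB : D ω ∈ B
    · exact Or.inr hB
    obtain ⟨c, hc, τ, h1, -, h3, -⟩ := h ω hB
    left
    have hle := hc.1 hω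
    have h4 := h3 c
    calc ρ.real {ω' | dataLr M (D ω) ≤ dataLr M ((D ω).1, ω')}
        ≤ ρ.real {ω' | c ≤ lr ω'.2.1 (M + (D ω).1) ω'.2.2 ω'.1} :=
          measureReal_mono fun ω' hω' ↦ hle.trans hω'
      _ ≤ a + 2 * η := by linarith
  have hRL : Rᶜ ⊆ D ⁻¹' (L ∪ B) := by
    intro ω hω
    by_cases hB : D ω ∈ B
    · exact Or.inr hB
    obtain ⟨c, hc, τ, -, h2, -, h3⟩ := h ω hB
    left
    have hlt : dataLr M (D ω) < c := not_le.1 fun hle ↦ hω (hc.2 hle)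
    have h4 := h3 c
    have hms : MeasurableSet {ω' : (Fin l → Eu m) × Eu k × Eu m |
        c < lr ω'.2.1 (M + (D ω).1) ω'.2.2 ω'.1} :=
      measurableSet_lt measurable_const (by fun_prop)
    have h5 := probReal_compl_eq_one_sub (μ := ρ) hms
    calc ρ.real {ω' | - dataLr M (D ω) ≤ - dataLr M ((D ω).1, ω')}
        ≤ ρ.real {ω' | c < lr ω'.2.1 (M + (D ω).1) ω'.2.2 ω'.1}ᶜ := by
          refine measureReal_mono fun ω' hω' ↦ ?_
          have h6 : dataLr M ((D ω).1, ω') ≤ dataLr M (D ω) := neg_le_neg_iff.1 hω'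
          exact not_lt.2 (h6.trans hlt.le)
      _ ≤ 1 - a + 2 * η := by linarith
  have e1 : P.real R ≤ a + 2 * η + β := (measureReal_mono hRU).trans ((hpre _).trans
    ((measureReal_union_le _ _).trans (by linarith)))
  have e2 : P.real Rᶜ ≤ 1 - a + 2 * η + β := (measureReal_mono hRL).trans ((hpre _).trans
    ((measureReal_union_le _ _).trans (by linarith)))
  have e3 : 1 ≤ P.real R + P.real Rᶜ := by
    have := measureReal_union_le (μ := P) R Rᶜ
    rwa [Set.union_compl_self, probReal_univ] at this
  rw [abs_le]
  constructor <;> linarith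

end Conditional

/-! ### Acceptability of the feasible critical value -/

section Acceptance

variable {l : ℕ}

/-- Linear independence of `Γ` and `γ` with high probability, which suffices here; it follows from
the regularity of their Gram matrix. -/
lemma exists_fullRank_prob (l : ℕ) {η : ℝ} (hη : 0 < η) :
    ∃ m₀ : ℝ, ∀ k m : ℕ, m₀ ≤ m →
      (model l (Eu k) (Eu m)).real {ω | ¬ FullRank ω.2.2 ω.1} ≤ η := by
  obtain ⟨K, hK1, hK⟩ := exists_div_sq_le ((l + 1 : ℝ) ^ 2 * (1 + chiVar)) hη
  have hl : (0 : ℝ) ≤ l := Nat.cast_nonneg l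
  refine ⟨(4 * ((l + 1 : ℝ) ^ 2 * K)) ^ 2, fun k m hm ↦ ?_⟩
  have h1 : 4 * ((l + 1 : ℝ) ^ 2 * K) ≤ √(m : ℝ) := Real.le_sqrt_of_sq_le hm
  have h2 := model_gramNear (l := l) (E := Eu k) (F := Eu m) (K := K) (by linarith)
  rw [finrank_euclideanSpace_fin, ← mul_div_assoc] at h2
  refine (measureReal_mono fun ω hω ↦ ?_).trans (h2.trans hK)
  have hω' : ¬ FullRank ω.2.2 ω.1 := hω
  show ¬ GramNear K (√m) ω.2.2 ω.1
  exact fun hG ↦ hω' (hG.near.fullRank (lt_of_lt_of_le (by positivity) h1) h1)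

/-- Acceptability of the feasible critical value with few instruments. -/
lemma exists_acceptable_of_small (hl : 0 < l) {C a η : ℝ} (hC : 0 ≤ C) (hη : 0 < η) (hηa : η < a)
    (hηa' : η < 1 - a) :
    ∃ θ₀ : ℝ, 0 < θ₀ ∧ ∃ m₀ : ℝ, ∀ n k : ℕ, 1 ≤ k → m₀ ≤ (n - k : ℕ) → k ≤ θ₀ * (n - k : ℕ) →
      ∀ (T : Fin l → Eu k) (t : Matrix (Fin k) (Fin l) ℝ) (x : Eu k),
        Rel (C / √(n - k : ℕ)) x T (colVec t) → ‖x‖ ≤ C * √k →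
        Acceptable (n - k) a η T (critVal n k a t) := by
  obtain ⟨m₁, hfull⟩ := exists_fullRank_prob l hη
  obtain ⟨θ₀, hθ₀, m₂, hdom⟩ := exists_domination_of_small hl (2 * C) (by positivity) hη
  refine ⟨θ₀, hθ₀, max (max m₁ m₂) ((2 * C + 1) ^ 2), fun n k hk hm hkm T t x hrel hx ↦ ?_⟩
  set m := n - k with hmd
  have hm1 : m₁ ≤ m := (le_max_left _ _).trans ((le_max_left _ _).trans hm)
  have hm2 : m₂ ≤ m := (le_max_right _ _).trans ((le_max_left _ _).trans hm)
  have hm3 : 2 * C + 1 ≤ √(m : ℝ) := Real.le_sqrt_of_sq_le ((le_max_right _ _).trans hm)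
  have hpos : 0 < √(m : ℝ) := by linarith
  have hδ : C / √(m : ℝ) ≤ 1 / 2 := by rw [div_le_iff₀ hpos]; linarith
  have hx' : ‖x‖ ≤ 2 * C * √k := hx.trans (by
    have : 0 ≤ C * √k := by positivity
    linarith)
  have hrel' := hrel.symm (by positivity) hδ
  rw [← mul_div_assoc] at hrel'
  obtain ⟨b1, b2⟩ := critVal_bounds (n := n) t hηa hηa' (hfull k m hm1)
  refine ⟨colVec t, b1, b2, hdom k m hk hm2 hkm _ _ x hrel' hx', hdom k m hk hm2 hkm _ _ x
    (hrel.mono ?_) hx'⟩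
  gcongr; linarith

/-- Acceptability of the feasible critical value with strong instruments. -/
lemma exists_acceptable_of_strong (hl : 0 < l) {C a η κ : ℝ} (hC : 0 ≤ C) (hκ : 1 ≤ κ) (hη : 0 < η)
    (hηa : η < a) (hηa' : η < 1 - a) :
    ∃ A m₀ : ℝ, ∀ n k : ℕ, 1 ≤ k → m₀ ≤ (n - k : ℕ) → k ≤ κ ^ 2 * (n - k : ℕ) →
      ∀ (T : Fin l → Eu k) (t : Matrix (Fin k) (Fin l) ℝ) (x : Eu k),
        Rel (C / √(n - k : ℕ)) x T (colVec t) → ‖x‖ ≤ C * √k →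
        (∀ v, (k + A * √k) * ‖v‖ ^ 2 ≤ ‖comb T v‖ ^ 2) →
        Acceptable (n - k) a η T (critVal n k a t) := by
  obtain ⟨m₁, hfull⟩ := exists_fullRank_prob l hη
  obtain ⟨A₀, m₂, hdom⟩ := exists_domination_of_strong hl (2 * C) (by positivity) hκ hη
  have hκ0 : 0 ≤ κ := by linarith
  set A := 2 * |A₀| + 1 + 16 * (C * κ) + 512 * (C ^ 2 * κ) ^ 2 with hA
  have hA0 : A₀ ≤ A / 2 := by
    have : 0 ≤ 16 * (C * κ) + 512 * (C ^ 2 * κ) ^ 2 := by positivity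
    have := le_abs_self A₀
    linarith
  have h16 : 0 ≤ 16 * (C * κ) := by positivity
  have h512 : 0 ≤ 512 * (C ^ 2 * κ) ^ 2 := by positivity
  have habs := abs_nonneg A₀
  refine ⟨A, max (max m₁ m₂) ((8 * C + 1) ^ 2), fun n k hk hm hkm T t x hrel hx hT ↦ ?_⟩
  set m := n - k with hmd
  have hm1 : m₁ ≤ m := (le_max_left _ _).trans ((le_max_left _ _).trans hm)
  have hm2 : m₂ ≤ m := (le_max_right _ _).trans ((le_max_left _ _).trans hm)
  have hm3 : 8 * C + 1 ≤ √(m : ℝ) := Real.le_sqrt_of_sq_le ((le_max_right _ _).trans hm)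
  have hpos : 0 < √(m : ℝ) := by linarith
  have hδ : C / √(m : ℝ) ≤ 1 / 8 := by rw [div_le_iff₀ hpos]; linarith
  have hx' : ‖x‖ ≤ 2 * C * √k := hx.trans (by
    have : 0 ≤ C * √k := by positivity
    linarith)
  have hrel' := hrel.symm (by positivity) (hδ.trans (by norm_num))
  rw [← mul_div_assoc] at hrel'
  have hrμ : √(k : ℝ) ≤ κ * √(m : ℝ) := by
    rw [← Real.sqrt_sq hκ0, ← Real.sqrt_mul (by positivity)]
    exact Real.sqrt_le_sqrt hkm
  have hδk : C / √(m : ℝ) * √(k : ℝ) ≤ C * κ := by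
    rw [div_mul_eq_mul_div, div_le_iff₀ hpos, mul_assoc]
    gcongr
  have hT' := hrel.strong (C := C) (κ := κ) (A := A) (by positivity) hδ (by exact_mod_cast hk) hδk hC
    hx (by linarith) (by linarith) (by linarith) hT
  obtain ⟨b1, b2⟩ := critVal_bounds (n := n) t hηa hηa' (hfull k m hm1)
  refine ⟨colVec t, b1, b2, hdom k m (A / 2) hk hm2 hkm hA0 _ _ x hrel' hx' fun v ↦ ?_,
    hdom k m (A / 2) hk hm2 hkm hA0 _ _ x (hrel.mono ?_) hx' hT'⟩
  · refine le_trans ?_ (hT v)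
    have : A / 2 ≤ A := by linarith
    gcongr
  · gcongr; linarith

end Acceptance

/-! ### Positive definite matrices -/

section SquareRoot

variable {p : ℕ}

open scoped MatrixOrder in
lemma exists_sqrt {X : Matrix (Fin p) (Fin p) ℝ} (hX : X.PosDef) :
    ∃ B : Matrix (Fin p) (Fin p) ℝ, B.PosDef ∧ B * B = X ∧ invSqrt X = B⁻¹ := by
  have h0 : CFC.sqrt X * CFC.sqrt X = X := CFC.sqrt_mul_sqrt_self X hX.posSemidef.nonneg
  have h1 : (CFC.sqrt X).PosSemidef := Matrix.nonneg_iff_posSemidef.1 (CFC.sqrt_nonneg X)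
  refine ⟨CFC.sqrt X, ?_, h0, rfl⟩
  rw [h1.posDef_iff_det_ne_zero]
  intro hd
  have := hX.det_pos
  rw [← h0, Matrix.det_mul, hd, mul_zero] at this
  exact lt_irrefl _ this

lemma isUnit_det_of_posDef {X : Matrix (Fin p) (Fin p) ℝ} (hX : X.PosDef) : IsUnit X.det :=
  isUnit_iff_ne_zero.2 hX.det_pos.ne'

lemma transpose_of_posDef {X : Matrix (Fin p) (Fin p) ℝ} (hX : X.PosDef) : Xᵀ = X := by
  have := hX.1.eq
  rwa [Matrix.conjTranspose_eq_transpose_of_trivial] at this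

lemma posDef_transpose_mul_mul {q : ℕ} {X : Matrix (Fin p) (Fin p) ℝ} (hX : X.PosDef)
    {N : Matrix (Fin p) (Fin q) ℝ} (hN : Function.Injective N.mulVec) : (Nᵀ * X * N).PosDef := by
  have := hX.conjTranspose_mul_mul_same hN
  rwa [Matrix.conjTranspose_eq_transpose_of_trivial] at this

lemma posDef_inv {X : Matrix (Fin p) (Fin p) ℝ} (hX : X.PosDef) : X⁻¹.PosDef := hX.inv

end SquareRoot

/-! ### Lipschitz continuity of the square root and of the weight matrix -/

section Frobenius

open scoped Matrix.Norms.Frobenius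

variable {p q : ℕ}

lemma frobenius_sq (A : Matrix (Fin p) (Fin q) ℝ) : ‖A‖ ^ 2 = ∑ i, ∑ j, A i j ^ 2 := by
  rw [Matrix.frobenius_norm_def, ← Real.rpow_natCast, ← Real.rpow_mul (by positivity)]
  simp

lemma norm_mulVec_le (A : Matrix (Fin p) (Fin q) ℝ) (v : Eu q) :
    ‖(WithLp.toLp 2 (A *ᵥ v.ofLp) : Eu p)‖ ≤ ‖A‖ * ‖v‖ := by
  refine abs_le_of_sq_le_sq' ?_ (by positivity) |>.2
  rw [mul_pow, frobenius_sq, EuclideanSpace.real_norm_sq_eq, EuclideanSpace.real_norm_sq_eq,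
    Finset.sum_mul]
  refine Finset.sum_le_sum fun i _ ↦ ?_
  exact Finset.sum_mul_sq_le_sq_mul_sq Finset.univ (fun j ↦ A i j) fun j ↦ v j

lemma trace_mul_le (D X : Matrix (Fin p) (Fin p) ℝ) : (D * X).trace ≤ ‖D‖ * ‖X‖ := by
  refine abs_le_of_sq_le_sq' ?_ (by positivity) |>.2
  rw [mul_pow, frobenius_sq, frobenius_sq, Finset.sum_comm (f := fun i j ↦ X i j ^ 2)]
  have e : (D * X).trace = ∑ x : Fin p × Fin p, D x.1 x.2 * X x.2 x.1 := by
    rw [Fintype.sum_prod_type]; simp [Matrix.trace, Matrix.mul_apply]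
  have e1 : ∑ i, ∑ j, D i j ^ 2 = ∑ x : Fin p × Fin p, D x.1 x.2 ^ 2 :=
    (Fintype.sum_prod_type (fun x : Fin p × Fin p ↦ D x.1 x.2 ^ 2)).symm
  have e2 : ∑ j, ∑ i, X i j ^ 2 = ∑ x : Fin p × Fin p, X x.2 x.1 ^ 2 :=
    (Fintype.sum_prod_type (fun x : Fin p × Fin p ↦ X x.2 x.1 ^ 2)).symm
  rw [e, e1, e2]
  exact Finset.sum_mul_sq_le_sq_mul_sq _ _ _

lemma trace_transpose_mul_self (A : Matrix (Fin p) (Fin q) ℝ) : (Aᵀ * A).trace = ‖A‖ ^ 2 := by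
  rw [frobenius_sq, Finset.sum_comm]
  simp [Matrix.trace, Matrix.mul_apply, sq]

/-- The square root is Lipschitz near a positive definite matrix: with `D = B - R`,
`tr (D (B² - R²)) = tr (D B D) + tr (D R D)`, and the second term controls `‖D‖²`. -/
lemma exists_sqrt_lipschitz {R : Matrix (Fin p) (Fin p) ℝ} (hR : R.PosDef) :
    ∃ L : ℝ, 0 ≤ L ∧ ∀ B : Matrix (Fin p) (Fin p) ℝ, B.PosSemidef →
      ‖B - R‖ ≤ L * ‖B * B - R * R‖ := by
  obtain ⟨C, hC⟩ := exists_eq_transpose_mul_self hR.posSemidef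
  have hCu : IsUnit C.det := by
    have := hR.det_pos.ne'
    rw [hC, Matrix.det_mul] at this
    exact isUnit_iff_ne_zero.2 (right_ne_zero_of_mul this)
  refine ⟨‖C⁻¹‖ ^ 2, by positivity, fun B hB ↦ ?_⟩
  set D := B - R with hD
  have hBt : Bᵀ = B := by
    have := hB.1.eq
    rwa [Matrix.conjTranspose_eq_transpose_of_trivial] at this
  have hDt : Dᵀ = D := by rw [hD, Matrix.transpose_sub, transpose_of_posDef hR, hBt]
  have e1 : D * (B * B - R * R) = D * B * D + D * (D * R) := by
    rw [hD]; noncomm_ring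
  have e2 : (D * (D * R)).trace = ‖C * D‖ ^ 2 := by
    rw [← trace_transpose_mul_self, Matrix.transpose_mul, hDt,
      Matrix.trace_mul_comm D (D * R), hC]
    simp only [Matrix.mul_assoc]
  have e3 : 0 ≤ (D * B * D).trace := by
    have := (hB.conjTranspose_mul_mul_same D).trace_nonneg
    rwa [Matrix.conjTranspose_eq_transpose_of_trivial, hDt] at this
  have e4 := trace_mul_le D (B * B - R * R)
  rw [e1, Matrix.trace_add, e2] at e4
  have e5 : ‖D‖ ≤ ‖C⁻¹‖ * ‖C * D‖ := by
    calc ‖D‖ = ‖C⁻¹ * (C * D)‖ := by rw [Matrix.nonsing_inv_mul_cancel_left _ _ hCu]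
      _ ≤ _ := Matrix.frobenius_norm_mul _ _
  rcases eq_or_lt_of_le (norm_nonneg D) with h0 | h0
  · rw [← h0]; positivity
  · refine le_of_mul_le_mul_left ?_ h0
    calc ‖D‖ * ‖D‖ ≤ (‖C⁻¹‖ * ‖C * D‖) * (‖C⁻¹‖ * ‖C * D‖) := by gcongr
      _ = ‖C⁻¹‖ ^ 2 * ‖C * D‖ ^ 2 := by ring
      _ ≤ ‖C⁻¹‖ ^ 2 * (‖D‖ * ‖B * B - R * R‖) := by gcongr; linarith
      _ = _ := by ring

lemma norm_inv_le {R B : Matrix (Fin p) (Fin p) ℝ} (hR : IsUnit R.det) (hB : IsUnit B.det)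
    (h : ‖R⁻¹‖ * ‖B - R‖ ≤ 1 / 2) : ‖B⁻¹‖ ≤ 2 * ‖R⁻¹‖ := by
  have e : B⁻¹ = R⁻¹ - B⁻¹ * (B - R) * R⁻¹ := by
    rw [Matrix.mul_sub, Matrix.sub_mul, Matrix.nonsing_inv_mul _ hB, Matrix.one_mul,
      Matrix.mul_assoc, Matrix.mul_nonsing_inv _ hR, Matrix.mul_one]
    abel
  have h1 : ‖B⁻¹‖ ≤ ‖R⁻¹‖ + ‖B⁻¹‖ * ‖B - R‖ * ‖R⁻¹‖ := by
    conv_lhs => rw [e]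
    refine (norm_sub_le _ _).trans ?_
    gcongr
    refine (Matrix.frobenius_norm_mul _ _).trans ?_
    gcongr
    exact Matrix.frobenius_norm_mul _ _
  have h2 : ‖B⁻¹‖ * (‖R⁻¹‖ * ‖B - R‖) ≤ ‖B⁻¹‖ * (1 / 2) := by gcongr
  nlinarith only [h1, h2]

lemma norm_mul_three_le {a b c d : ℕ} (X : Matrix (Fin a) (Fin b) ℝ) (Y : Matrix (Fin b) (Fin c) ℝ)
    (W : Matrix (Fin c) (Fin d) ℝ) : ‖X * Y * W‖ ≤ ‖X‖ * ‖Y‖ * ‖W‖ :=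
  (Matrix.frobenius_norm_mul _ _).trans (by gcongr; exact Matrix.frobenius_norm_mul _ _)

set_option maxHeartbeats 400000 in
/-- Perturbation of the normalised weight matrix: with `ι = (0, I)'`, the matrix
`W⁻¹ ι R (R' ι' W⁻¹ ι R)^{-1/2}` is Lipschitz in `W` at `W = I`, where its value is `ι`. -/
lemma exists_weight_lipschitz {l : ℕ} {R : Matrix (Fin l) (Fin l) ℝ} (hR : R.PosDef)
    {ι : Matrix (Fin (l + 1)) (Fin l) ℝ} (hι : ιᵀ * ι = 1) :
    ∃ C s₀ : ℝ, 0 ≤ C ∧ 0 < s₀ ∧ ∀ W : Matrix (Fin (l + 1)) (Fin (l + 1)) ℝ, W.PosDef →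
      ‖W - 1‖ ≤ s₀ →
      ‖W⁻¹ * (ι * R) * invSqrt ((ι * R)ᵀ * W⁻¹ * (ι * R)) - ι‖ ≤ C * ‖W - 1‖ := by
  obtain ⟨L, hL0, hL⟩ := exists_sqrt_lipschitz hR
  set c₁ := ‖(1 : Matrix (Fin (l + 1)) (Fin (l + 1)) ℝ)‖ with hc₁
  set c₂ := ‖(ι * R)ᵀ‖ * (2 * c₁) * ‖ι * R‖ with hc₂
  have hc₁0 : 0 ≤ c₁ := norm_nonneg _
  have hc₂0 : 0 ≤ c₂ := by positivity
  have hRu := isUnit_det_of_posDef hR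
  refine ⟨2 * c₁ * ‖ι * R‖ * (2 * ‖R⁻¹‖) + ‖ι‖ * (L * c₂) * (2 * ‖R⁻¹‖),
    1 / (2 * (c₁ + ‖R⁻¹‖ * (L * c₂) + 1)), by positivity, by positivity, fun W hW hs ↦ ?_⟩
  set s := ‖W - 1‖ with hsd
  have hs0 : 0 ≤ s := norm_nonneg _
  rw [le_div_iff₀ (by positivity)] at hs
  have hP : 0 ≤ ‖R⁻¹‖ * (L * c₂) * s := by positivity
  have hP1 : 0 ≤ c₁ * s := by positivity
  have hWu := isUnit_det_of_posDef hW
  have hWi : ‖W⁻¹‖ ≤ 2 * c₁ := by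
    have := norm_inv_le (R := 1) (B := W) (by simp) hWu (by rw [inv_one]; nlinarith only [hs, hs0, hP])
    rwa [inv_one] at this
  have hWd : ‖W⁻¹ - 1‖ ≤ 2 * c₁ * s := by
    have : W⁻¹ - 1 = -(W⁻¹ * (W - 1)) := by
      rw [Matrix.mul_sub, Matrix.nonsing_inv_mul _ hWu, Matrix.mul_one, neg_sub]
    rw [this, norm_neg]
    exact (Matrix.frobenius_norm_mul _ _).trans (mul_le_mul_of_nonneg_right hWi hs0)
  have hιR : Function.Injective (ι * R).mulVec := by
    have h1 : R⁻¹ * ιᵀ * (ι * R) = 1 := by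
      rw [Matrix.mul_assoc, ← Matrix.mul_assoc ιᵀ, hι, Matrix.one_mul, Matrix.nonsing_inv_mul _ hRu]
    refine Function.LeftInverse.injective (g := (R⁻¹ * ιᵀ).mulVec) fun v ↦ ?_
    rw [Matrix.mulVec_mulVec, h1, Matrix.one_mulVec]
  set X := (ι * R)ᵀ * W⁻¹ * (ι * R) with hX
  have hXpd : X.PosDef := posDef_transpose_mul_mul (posDef_inv hW) hιR
  obtain ⟨B, hB, hBB, hBi⟩ := exists_sqrt hXpd
  have hBu := isUnit_det_of_posDef hB
  have hXR : ‖X - R * R‖ ≤ c₂ * s := by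
    have : X - R * R = (ι * R)ᵀ * (W⁻¹ - 1) * (ι * R) := by
      rw [Matrix.mul_sub, Matrix.sub_mul, Matrix.mul_one, ← hX, Matrix.transpose_mul,
        Matrix.mul_assoc Rᵀ, ← Matrix.mul_assoc ιᵀ, hι, Matrix.one_mul, transpose_of_posDef hR]
    rw [this]
    refine (norm_mul_three_le _ _ _).trans ?_
    calc _ ≤ ‖(ι * R)ᵀ‖ * (2 * c₁ * s) * ‖ι * R‖ := by gcongr
      _ = c₂ * s := by rw [hc₂]; ring
  have hBR : ‖B - R‖ ≤ L * c₂ * s := by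
    refine (hL B hB.posSemidef).trans ?_
    rw [hBB, mul_assoc]
    gcongr
  have hBinv : ‖B⁻¹‖ ≤ 2 * ‖R⁻¹‖ := by
    refine norm_inv_le hRu hBu ?_
    calc ‖R⁻¹‖ * ‖B - R‖ ≤ ‖R⁻¹‖ * (L * c₂ * s) := by gcongr
      _ = ‖R⁻¹‖ * (L * c₂) * s := by ring
      _ ≤ 1 / 2 := by nlinarith only [hs, hs0, hP1]
  rw [hBi]
  have e : W⁻¹ * (ι * R) * B⁻¹ - ι = (W⁻¹ - 1) * (ι * R) * B⁻¹ + ι * (R - B) * B⁻¹ := by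
    have : ι * B * B⁻¹ = ι := by rw [Matrix.mul_assoc, Matrix.mul_nonsing_inv _ hBu, Matrix.mul_one]
    rw [Matrix.sub_mul, Matrix.sub_mul, Matrix.mul_sub, Matrix.sub_mul, this, Matrix.one_mul]
    abel
  rw [e]
  refine (norm_add_le _ _).trans ?_
  have f1 : ‖(W⁻¹ - 1) * (ι * R) * B⁻¹‖ ≤ 2 * c₁ * s * ‖ι * R‖ * (2 * ‖R⁻¹‖) :=
    (norm_mul_three_le _ _ _).trans (by gcongr)
  have f2 : ‖ι * (R - B) * B⁻¹‖ ≤ ‖ι‖ * (L * c₂ * s) * (2 * ‖R⁻¹‖) :=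
    (norm_mul_three_le _ _ _).trans (by rw [norm_sub_rev]; gcongr)
  linarith only [f1, f2]

end Frobenius

/-! ### Rotation of the sample space -/

section Rotation

variable {n k : ℕ}

lemma mulVec_injective_of_rank {Z : Matrix (Fin n) (Fin k) ℝ} (hZ : Z.rank = k) :
    Function.Injective Z.mulVec := by
  rw [Matrix.mulVec_injective_iff, linearIndependent_iff_card_eq_finrank_span, Set.finrank,
    ← Matrix.rank_eq_finrank_span_cols, hZ, Fintype.card_fin]

lemma posDef_gram_of_rank {Z : Matrix (Fin n) (Fin k) ℝ} (hZ : Z.rank = k) : (Zᵀ * Z).PosDef := by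
  have := posDef_transpose_mul_mul (X := 1) Matrix.PosDef.one (mulVec_injective_of_rank hZ)
  rwa [Matrix.mul_one] at this

/-- The rows of `C = (Z'Z)^{-1/2} Z'` are completed to an orthonormal basis by the rows of a matrix
`N`; then `C'C = P_Z` and `N'N = M_Z`. -/
lemma exists_rotation {Z : Matrix (Fin n) (Fin k) ℝ} (hZ : Z.rank = k) :
    ∃ (C : Matrix (Fin k) (Fin n) ℝ) (N : Matrix (Fin (n - k)) (Fin n) ℝ),
      C = invSqrt (Zᵀ * Z) * Zᵀ ∧ C * Cᵀ = 1 ∧ N * Nᵀ = 1 ∧ C * Nᵀ = 0 ∧ Cᵀ * C = projMat Z ∧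
      Nᵀ * N = residMat Z ∧ N * Z = 0 := by
  have hk : k ≤ n := hZ ▸ Matrix.rank_le_height Z
  obtain ⟨B, hB, hBB, hBi⟩ := exists_sqrt (posDef_gram_of_rank hZ)
  have hBu := isUnit_det_of_posDef hB
  have hBt : (B⁻¹)ᵀ = B⁻¹ := by rw [Matrix.transpose_nonsing_inv, transpose_of_posDef hB]
  set C := B⁻¹ * Zᵀ with hC
  have hCt : Cᵀ = Z * B⁻¹ := by rw [hC, Matrix.transpose_mul, Matrix.transpose_transpose, hBt]
  have hCC : C * Cᵀ = 1 := by
    rw [hCt, hC, Matrix.mul_assoc, ← Matrix.mul_assoc Zᵀ, ← hBB, Matrix.mul_assoc B,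
      Matrix.mul_nonsing_inv _ hBu, Matrix.mul_one, Matrix.nonsing_inv_mul _ hBu]
  have hP : Cᵀ * C = projMat Z := by
    rw [hCt, hC, projMat, ← hBB, Matrix.mul_inv_rev]
    simp only [Matrix.mul_assoc]
  let v : Fin k ⊕ Fin (n - k) → EuclideanSpace ℝ (Fin n) :=
    Sum.elim (fun i ↦ WithLp.toLp 2 (C i)) fun _ ↦ 0
  have hv : Orthonormal ℝ ((Set.range Sum.inl).domRestrict v) := by
    rw [orthonormal_iff_ite]
    rintro ⟨_, i, rfl⟩ ⟨_, j, rfl⟩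
    have h1 := congrFun (congrFun hCC i) j
    rw [Matrix.mul_apply, Matrix.one_apply] at h1
    have h2 : ⟪(WithLp.toLp 2 (C i) : EuclideanSpace ℝ (Fin n)), WithLp.toLp 2 (C j)⟫ =
        if i = j then 1 else 0 := by
      rw [← h1, EuclideanSpace.inner_eq_star_dotProduct]
      simp [dotProduct, mul_comm]
    exact h2.trans (if_congr ⟨fun h ↦ by subst h; rfl,
      fun h ↦ Sum.inl_injective (congrArg Subtype.val h)⟩ rfl rfl)
  obtain ⟨b, hb⟩ := hv.exists_orthonormalBasis_extension_of_card_eq (by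
    rw [finrank_euclideanSpace_fin, Fintype.card_sum, Fintype.card_fin, Fintype.card_fin]; omega)
  have hbC : ∀ i, b (Sum.inl i) = WithLp.toLp 2 (C i) := fun i ↦ hb _ ⟨i, rfl⟩
  let N : Matrix (Fin (n - k)) (Fin n) ℝ := fun i r ↦ b (Sum.inr i) r
  have hbN : ∀ i, b (Sum.inr i) = WithLp.toLp 2 (N i) := fun i ↦ rfl
  have hortho := orthonormal_iff_ite.1 b.orthonormal
  have hNN : N * Nᵀ = 1 := by
    ext i j
    have := hortho (Sum.inr i) (Sum.inr j)
    rw [hbN, hbN, EuclideanSpace.inner_eq_star_dotProduct] at this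
    simp only [Sum.inr.injEq] at this
    rw [Matrix.one_apply, ← this]
    simp [Matrix.mul_apply, dotProduct, mul_comm]
  have hCN : C * Nᵀ = 0 := by
    ext i j
    have := hortho (Sum.inl i) (Sum.inr j)
    rw [hbC, hbN, EuclideanSpace.inner_eq_star_dotProduct] at this
    simp only [reduceCtorEq, if_false] at this
    rw [Matrix.zero_apply, ← this]
    simp [Matrix.mul_apply, dotProduct, mul_comm]
  have hsum : Cᵀ * C + Nᵀ * N = 1 := by
    ext r s
    have := b.sum_inner_mul_inner (EuclideanSpace.single r 1) (EuclideanSpace.single s 1)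
    rw [Fintype.sum_sum_type] at this
    simp only [hbC, hbN, EuclideanSpace.inner_single_left, EuclideanSpace.inner_single_right] at this
    simp only [Matrix.add_apply, Matrix.mul_apply, Matrix.transpose_apply, Matrix.one_apply]
    simp at this
    rw [this]; exact if_congr eq_comm rfl rfl
  have hM : Nᵀ * N = residMat Z := by rw [residMat, ← hP, ← hsum]; abel
  refine ⟨C, N, by rw [hBi], hCC, hNN, hCN, hP, hM, ?_⟩
  have h1 : residMat Z * Z = 0 := by
    rw [residMat, projMat, Matrix.sub_mul, Matrix.one_mul, Matrix.mul_assoc, Matrix.mul_assoc,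
      Matrix.nonsing_inv_mul _ (isUnit_det_of_posDef (posDef_gram_of_rank hZ)), Matrix.mul_one,
      sub_self]
  calc N * Z = N * Nᵀ * N * Z := by rw [hNN, Matrix.one_mul]
    _ = N * (Nᵀ * N * Z) := by simp only [Matrix.mul_assoc]
    _ = 0 := by rw [hM, h1, Matrix.mul_zero]

end Rotation

/-! ### Standardization of the errors -/

section Standardization

variable {l : ℕ}

lemma bVec_vecMul_aMat (β₀ : Fin l → ℝ) : bVec β₀ ᵥ* aMat β₀ = 0 := by
  ext j
  simp [Matrix.vecMul, dotProduct, Fin.sum_univ_succ, bVec, aMat, Matrix.one_apply]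

lemma aMat_injective (β₀ : Fin l → ℝ) : Function.Injective (aMat β₀).mulVec := by
  intro v w h
  ext i
  have := congrFun h i.succ
  simpa [aMat, Matrix.mulVec, dotProduct, Matrix.one_apply] using this

lemma aMat_apply_zero (β₀ : Fin l → ℝ) (j : Fin l) : aMat β₀ 0 j = β₀ j := rfl

lemma aMat_apply_succ (β₀ : Fin l → ℝ) (i j : Fin l) :
    aMat β₀ i.succ j = (1 : Matrix (Fin l) (Fin l) ℝ) i j := rfl

lemma mul_aMat_zero_apply {q : ℕ} (X : Matrix (Fin q) (Fin (l + 1)) ℝ) (i : Fin q) (j : Fin l) :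
    (X * aMat (0 : Fin l → ℝ)) i j = X i j.succ := by
  rw [Matrix.mul_apply, Fin.sum_univ_succ]
  simp [aMat_apply_zero, aMat_apply_succ, Matrix.one_apply]

lemma aMat_zero_mul_apply_zero {q : ℕ} (X : Matrix (Fin l) (Fin q) ℝ) (j : Fin q) :
    (aMat (0 : Fin l → ℝ) * X) 0 j = 0 := by
  rw [Matrix.mul_apply]
  simp [aMat_apply_zero]

lemma aMat_zero_mul_apply_succ {q : ℕ} (X : Matrix (Fin l) (Fin q) ℝ) (i : Fin l) (j : Fin q) :
    (aMat (0 : Fin l → ℝ) * X) i.succ j = X i j := by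
  rw [Matrix.mul_apply]
  simp [aMat_apply_succ, Matrix.one_apply]

lemma transpose_mul_self_aMat_zero :
    (aMat (0 : Fin l → ℝ))ᵀ * aMat (0 : Fin l → ℝ) = 1 := by
  ext i j
  rw [mul_aMat_zero_apply]
  simp [aMat_apply_succ, Matrix.one_apply, eq_comm]

lemma bVec_ne_zero (β₀ : Fin l → ℝ) : bVec β₀ ≠ 0 := fun h ↦ by
  have := congrFun h 0
  simp [bVec] at this

/-- A coordinate change `J` that standardizes the errors (`J'ΩJ = I`), whose first column is
proportional to `b₀` and for which `J'A₀ = (0, R)'` with `R = (A₀'Ω⁻¹A₀)^{1/2}`. -/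
lemma exists_standardization {Ω : Matrix (Fin (l + 1)) (Fin (l + 1)) ℝ} (hΩ : Ω.PosDef)
    (β₀ : Fin l → ℝ) :
    ∃ (J : Matrix (Fin (l + 1)) (Fin (l + 1)) ℝ) (R : Matrix (Fin l) (Fin l) ℝ) (σ : ℝ),
      0 < σ ∧ R.PosDef ∧ invSqrt ((aMat β₀)ᵀ * Ω⁻¹ * aMat β₀) = R⁻¹ ∧ IsUnit J.det ∧
      Jᵀ * Ω * J = 1 ∧ (∀ i, bVec β₀ i = σ * J i 0) ∧ Jᵀ * aMat β₀ = aMat (0 : Fin l → ℝ) * R ∧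
      J * aMat (0 : Fin l → ℝ) = Ω⁻¹ * aMat β₀ * R⁻¹ := by
  set A := aMat β₀ with hA
  set b := bVec β₀ with hb
  have hΩu := isUnit_det_of_posDef hΩ
  obtain ⟨R, hR, hRR, hRi⟩ := exists_sqrt
    (posDef_transpose_mul_mul (posDef_inv hΩ) (aMat_injective β₀))
  rw [← hA] at hRR hRi
  have hRu := isUnit_det_of_posDef hR
  have hbb : 0 < b ⬝ᵥ (Ω *ᵥ b) := by
    simpa using hΩ.dotProduct_mulVec_pos (bVec_ne_zero β₀)
  set σ := √(b ⬝ᵥ (Ω *ᵥ b)) with hσ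
  have hσ0 : 0 < σ := Real.sqrt_pos.2 hbb
  have hσ2 : σ ^ 2 = b ⬝ᵥ (Ω *ᵥ b) := Real.sq_sqrt hbb.le
  set Q := Ω⁻¹ * A * R⁻¹ with hQ
  have hRt : (R⁻¹)ᵀ = R⁻¹ := by rw [Matrix.transpose_nonsing_inv, transpose_of_posDef hR]
  have hΩt : (Ω⁻¹)ᵀ = Ω⁻¹ := by rw [Matrix.transpose_nonsing_inv, transpose_of_posDef hΩ]
  have hQt : Qᵀ = R⁻¹ * Aᵀ * Ω⁻¹ := by
    rw [hQ, Matrix.transpose_mul, Matrix.transpose_mul, hRt, hΩt, Matrix.mul_assoc]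
  have hΩQ : Ω * Q = A * R⁻¹ := by
    rw [hQ, ← Matrix.mul_assoc, ← Matrix.mul_assoc, Matrix.mul_nonsing_inv _ hΩu, Matrix.one_mul]
  have hQA : Qᵀ * A = R := by
    rw [hQt, Matrix.mul_assoc, Matrix.mul_assoc, ← Matrix.mul_assoc Aᵀ, ← hRR, ← Matrix.mul_assoc,
      Matrix.nonsing_inv_mul _ hRu, Matrix.one_mul]
  have hQΩQ : Qᵀ * Ω * Q = 1 := by
    rw [Matrix.mul_assoc, hΩQ, ← Matrix.mul_assoc, hQA, Matrix.mul_nonsing_inv _ hRu]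
  have hbA : b ᵥ* A = 0 := bVec_vecMul_aMat β₀
  have hbΩQ : b ᵥ* (Ω * Q) = 0 := by
    rw [hΩQ, ← Matrix.vecMul_vecMul, hbA, Matrix.zero_vecMul]
  set J := cols (σ⁻¹ • b) Q with hJ
  have hJ0 : ∀ i, J i 0 = σ⁻¹ * b i := fun i ↦ by simp [hJ, cols]
  have hJs : ∀ i j, J i (Fin.succ j) = Q i j := fun i j ↦ by simp [hJ, cols]
  have hJΩJ : Jᵀ * Ω * J = 1 := by
    have key : ∀ i j, (Jᵀ * Ω * J) i j = Jᵀ i ⬝ᵥ (Ω *ᵥ Jᵀ j) := fun i j ↦ by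
      rw [Matrix.mul_assoc, Matrix.mul_apply]; rfl
    have r0 : Jᵀ 0 = σ⁻¹ • b := by ext i; simp [hJ0]
    have rs : ∀ j, Jᵀ (Fin.succ j) = Qᵀ j := fun j ↦ by ext i; simp [hJs]
    have e0 : ∀ j, b ⬝ᵥ (Ω *ᵥ Qᵀ j) = 0 := fun j ↦ by
      have := congrFun hbΩQ j
      rw [← Matrix.vecMul_vecMul] at this
      rw [Matrix.dotProduct_mulVec]
      exact this
    have hsym : ∀ j, Qᵀ j ⬝ᵥ (Ω *ᵥ b) = 0 := fun j ↦ by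
      rw [Matrix.dotProduct_mulVec, ← Matrix.mulVec_transpose, transpose_of_posDef hΩ,
        dotProduct_comm, e0]
    ext i j
    rw [key]
    refine Fin.cases ?_ (fun i ↦ ?_) i <;> refine Fin.cases ?_ (fun j ↦ ?_) j
    · rw [r0, Matrix.mulVec_smul, dotProduct_smul, smul_dotProduct, ← hσ2]
      simp only [smul_eq_mul, Matrix.one_apply_eq]
      field_simp
    · rw [r0, rs, smul_dotProduct, e0, smul_zero]
      exact (Matrix.one_apply_ne (Fin.succ_ne_zero j).symm).symm
    · rw [r0, rs, Matrix.mulVec_smul, dotProduct_smul, hsym, smul_zero]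
      exact (Matrix.one_apply_ne (Fin.succ_ne_zero i)).symm
    · rw [rs, rs]
      have := congrFun (congrFun hQΩQ i) j
      rw [Matrix.mul_assoc, Matrix.mul_apply] at this
      have e : (1 : Matrix (Fin (l + 1)) (Fin (l + 1)) ℝ) i.succ j.succ =
          (1 : Matrix (Fin l) (Fin l) ℝ) i j := by simp [Matrix.one_apply]
      rw [e, ← this]; rfl
  refine ⟨J, R, σ, hσ0, hR, hRi, ?_, hJΩJ, fun i ↦ ?_, ?_, ?_⟩
  · have := congrArg Matrix.det hJΩJ
    rw [Matrix.det_mul, Matrix.det_one] at this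
    exact IsUnit.of_mul_eq_one_right _ this
  · rw [hJ0]; field_simp
  · ext i j
    refine Fin.cases ?_ (fun i ↦ ?_) i
    · have h1 : (Jᵀ * A) 0 j = σ⁻¹ * (b ᵥ* A) j := by
        simp [Matrix.mul_apply, hJ0, Matrix.vecMul, dotProduct, Finset.mul_sum, mul_assoc]
      rw [h1, hbA, aMat_zero_mul_apply_zero]
      simp
    · have h1 : (Jᵀ * A) i.succ j = (Qᵀ * A) i j := by simp [Matrix.mul_apply, hJs]
      rw [h1, hQA, aMat_zero_mul_apply_succ]
  · ext i j
    rw [mul_aMat_zero_apply, hJs]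

end Standardization

/-! ### Reduction of the test statistic and the conditioning statistic -/

section Reduction

variable {n k l q : ℕ}

lemma gram_change {m : ℕ} (N : Matrix (Fin q) (Fin n) ℝ) (Y : Matrix (Fin n) (Fin m) ℝ)
    (J : Matrix (Fin m) (Fin m) ℝ) {P : Matrix (Fin n) (Fin n) ℝ} (hN : Nᵀ * N = P) :
    Jᵀ * (Yᵀ * P * Y) * J = (N * Y * J)ᵀ * (N * Y * J) := by
  rw [← hN]; simp only [Matrix.transpose_mul, Matrix.mul_assoc]

lemma quad_bVec {b : Fin (l + 1) → ℝ} {σ : ℝ} {J D : Matrix (Fin (l + 1)) (Fin (l + 1)) ℝ}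
    (hb : ∀ i, b i = σ * J i 0) : b ⬝ᵥ (D *ᵥ b) = σ ^ 2 * (Jᵀ * D * J) 0 0 := by
  have : b = σ • (Jᵀ 0) := by ext i; simp [hb]
  have key : (Jᵀ * D * J) 0 0 = Jᵀ 0 ⬝ᵥ (D *ᵥ Jᵀ 0) := by
    rw [Matrix.mul_assoc, Matrix.mul_apply]; rfl
  rw [key, this, Matrix.mulVec_smul, dotProduct_smul, smul_dotProduct, smul_eq_mul, smul_eq_mul]
  ring

/-- The eigenvalues of `c B⁻¹ D B⁻¹` with `B² = c E` are the roots of `det (J'DJ - x J'EJ) = 0`. -/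
lemma mem_spectrum_iff_det {p : ℕ} {B D E J : Matrix (Fin p) (Fin p) ℝ} {c : ℝ} (hc : c ≠ 0)
    (hB : IsUnit B.det) (hJ : IsUnit J.det) (hBB : B * B = c • E) (x : ℝ) :
    x ∈ spectrum ℝ (c • (B⁻¹ * D * B⁻¹)) ↔ (Jᵀ * D * J - x • (Jᵀ * E * J)).det = 0 := by
  rw [spectrum.mem_iff, Matrix.isUnit_iff_isUnit_det, isUnit_iff_ne_zero, not_not,
    Algebra.algebraMap_eq_smul_one]
  have e1 : B * (x • 1 - c • (B⁻¹ * D * B⁻¹)) * B = (-c) • (D - x • E) := by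
    have h1 : B * (B⁻¹ * D * B⁻¹) * B = D := by
      rw [Matrix.mul_assoc B⁻¹, Matrix.mul_nonsing_inv_cancel_left _ _ hB, Matrix.mul_assoc,
        Matrix.nonsing_inv_mul _ hB, Matrix.mul_one]
    rw [Matrix.mul_sub, Matrix.sub_mul, Matrix.mul_smul, Matrix.mul_one, Matrix.smul_mul, hBB,
      Matrix.mul_smul, Matrix.smul_mul, h1, smul_sub, neg_smul, neg_smul, smul_comm x c E]
    abel
  have e2 : Jᵀ * D * J - x • (Jᵀ * E * J) = Jᵀ * (D - x • E) * J := by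
    rw [Matrix.mul_sub, Matrix.sub_mul, Matrix.mul_smul, Matrix.smul_mul]
  have d1 := congrArg Matrix.det e1
  rw [Matrix.det_mul, Matrix.det_mul, Matrix.det_smul] at d1
  rw [e2, Matrix.det_mul, Matrix.det_mul, Matrix.det_transpose]
  have hB0 := hB.ne_zero
  have hJ0 := hJ.ne_zero
  have hc' : (-c) ^ Fintype.card (Fin p) ≠ 0 := pow_ne_zero _ (neg_ne_zero.2 hc)
  constructor
  · intro h
    rw [h, mul_zero, zero_mul, eq_comm, mul_eq_zero] at d1
    rw [d1.resolve_left hc']; ring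
  · intro h
    have h1 : (D - x • E).det = 0 := by simpa [hJ0] using h
    rw [h1, mul_zero] at d1
    simpa [hB0] using d1

variable {Z : Matrix (Fin n) (Fin k) ℝ} {Y : Matrix (Fin n) (Fin (l + 1)) ℝ} {β₀ : Fin l → ℝ}
  {C : Matrix (Fin k) (Fin n) ℝ} {N : Matrix (Fin (n - k)) (Fin n) ℝ}
  {J : Matrix (Fin (l + 1)) (Fin (l + 1)) ℝ} {σ : ℝ}

lemma posDef_resid (hN : Nᵀ * N = residMat Z) (hJ : IsUnit J.det)
    (hfull : FullRank (colHead (N * Y * J)) (colTail (N * Y * J))) :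
    (Yᵀ * residMat Z * Y).PosDef := by
  have h1 := (posDef_gram_iff_fullRank _).2 hfull
  have hinj : Function.Injective (J⁻¹).mulVec := by
    refine Function.LeftInverse.injective (g := J.mulVec) fun v ↦ ?_
    rw [Matrix.mulVec_mulVec, Matrix.mul_nonsing_inv _ hJ, Matrix.one_mulVec]
  have h2 := posDef_transpose_mul_mul h1 hinj
  rw [← gram_change N Y J hN] at h2
  have e : (J⁻¹)ᵀ * (Jᵀ * (Yᵀ * residMat Z * Y) * J) * J⁻¹ = Yᵀ * residMat Z * Y := by
    have h3 : (J⁻¹)ᵀ * Jᵀ = 1 := by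
      rw [← Matrix.transpose_mul, Matrix.mul_nonsing_inv _ hJ, Matrix.transpose_one]
    rw [← Matrix.mul_assoc, ← Matrix.mul_assoc, h3, Matrix.one_mul, Matrix.mul_assoc,
      Matrix.mul_nonsing_inv _ hJ, Matrix.mul_one]
  rwa [e] at h2

lemma posDef_omegaHat (hkn : (k : ℝ) < n) (hN : Nᵀ * N = residMat Z) (hJ : IsUnit J.det)
    (hfull : FullRank (colHead (N * Y * J)) (colTail (N * Y * J))) : (omegaHat Z Y).PosDef := by
  have : 0 < ((n : ℝ) - k)⁻¹ := inv_pos.2 (sub_pos.2 hkn)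
  exact (posDef_resid hN hJ hfull).smul this

/-- The observed statistic in the standardized coordinates. -/
lemma LR1_div_eq_lr (hkn : (k : ℝ) < n) (hC : Cᵀ * C = projMat Z) (hN : Nᵀ * N = residMat Z)
    (hJ : IsUnit J.det) (hσ : 0 < σ) (hb : ∀ i, bVec β₀ i = σ * J i 0)
    (hfull : FullRank (colHead (N * Y * J)) (colTail (N * Y * J))) :
    LR1 β₀ Z Y / ((n : ℝ) - k) = lr (colHead (C * Y * J)) (colTail (C * Y * J))
      (colHead (N * Y * J)) (colTail (N * Y * J)) := by
  have hm : (0 : ℝ) < n - k := sub_pos.2 hkn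
  rw [LR1, mul_div_cancel_left₀ _ hm.ne', ← psi1_gram _ _ hfull, psi1, quad_bVec hb, quad_bVec hb,
    gram_change C Y J hC, gram_change N Y J hN, mul_div_mul_left _ _ (by positivity)]
  congr 1
  obtain ⟨B, hB, hBB, hBi⟩ := exists_sqrt (posDef_omegaHat hkn hN hJ hfull)
  rw [lambdaHat, minEig, hBi]
  congr 1
  ext x
  rw [mem_spectrum_iff_det (inv_ne_zero hm.ne') (isUnit_det_of_posDef hB) hJ hBB x,
    gram_change C Y J hC, gram_change N Y J hN]
  rfl

/-- The conditioning statistic in the standardized coordinates. -/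
lemma tHat_eq (hkn : (k : ℝ) < n) (hCd : C = invSqrt (Zᵀ * Z) * Zᵀ) (hN : Nᵀ * N = residMat Z)
    (hJ : IsUnit J.det) {R : Matrix (Fin l) (Fin l) ℝ}
    (hJA : Jᵀ * aMat β₀ = aMat (0 : Fin l → ℝ) * R)
    (hfull : FullRank (colHead (N * Y * J)) (colTail (N * Y * J)))
    {W : Matrix (Fin (l + 1)) (Fin (l + 1)) ℝ}
    (hW : W = ((n : ℝ) - k)⁻¹ • ((N * Y * J)ᵀ * (N * Y * J))) :
    tHat β₀ Z Y = C * Y * J * (W⁻¹ * (aMat (0 : Fin l → ℝ) * R) *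
      invSqrt ((aMat (0 : Fin l → ℝ) * R)ᵀ * W⁻¹ * (aMat (0 : Fin l → ℝ) * R))) := by
  have hO := isUnit_det_of_posDef (posDef_omegaHat hkn hN hJ hfull)
  have hWO : W = Jᵀ * omegaHat Z Y * J := by
    rw [hW, omegaHat, ← gram_change N Y J hN, Matrix.mul_smul, Matrix.smul_mul]
  have hJt : IsUnit Jᵀ.det := by rwa [Matrix.det_transpose]
  have hinv : (omegaHat Z Y)⁻¹ = J * W⁻¹ * Jᵀ := by
    rw [hWO, Matrix.mul_inv_rev, Matrix.mul_inv_rev, Matrix.mul_nonsing_inv_cancel_left _ _ hJ,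
      Matrix.mul_assoc, Matrix.nonsing_inv_mul _ hJt, Matrix.mul_one]
  have hA : (aMat β₀)ᵀ * (omegaHat Z Y)⁻¹ * aMat β₀ =
      (aMat (0 : Fin l → ℝ) * R)ᵀ * W⁻¹ * (aMat (0 : Fin l → ℝ) * R) := by
    rw [hinv, ← hJA, Matrix.transpose_mul, Matrix.transpose_transpose]
    simp only [Matrix.mul_assoc]
  rw [tHat, hA, hinv, ← hCd, ← hJA]
  simp only [Matrix.mul_assoc]

open scoped Matrix.Norms.Frobenius in
/-- A weight matrix near `(0, I)'` turns the columns `(x, t)` into columns related to `t`. -/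
lemma rel_of_weight {p : ℕ} (X : Matrix (Fin p) (Fin (l + 1)) ℝ) {M : Matrix (Fin (l + 1)) (Fin l) ℝ}
    {δ : ℝ} (h : ‖M - aMat (0 : Fin l → ℝ)‖ ≤ δ) :
    Rel δ (colHead X) (colTail X) (colVec (X * M)) := by
  set D := M - aMat (0 : Fin l → ℝ) with hD
  have hsplit : ∀ v : EuclideanSpace ℝ (Fin l),
      ((D *ᵥ v.ofLp) 0) ^ 2 + ∑ i : Fin l, ((D *ᵥ v.ofLp) i.succ) ^ 2 ≤ (δ * ‖v‖) ^ 2 := by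
    intro v
    have h1 := norm_mulVec_le D v
    have h2 : ‖D‖ * ‖v‖ ≤ δ * ‖v‖ := by gcongr
    have h3 := pow_le_pow_left₀ (norm_nonneg _) (h1.trans h2) 2
    rw [EuclideanSpace.real_norm_sq_eq, Fin.sum_univ_succ] at h3
    exact h3
  have hM : ∀ v : Fin l → ℝ, M *ᵥ v = D *ᵥ v + aMat (0 : Fin l → ℝ) *ᵥ v := fun v ↦ by
    rw [← Matrix.add_mulVec, hD, sub_add_cancel]
  have hι0 : ∀ v : Fin l → ℝ, (aMat (0 : Fin l → ℝ) *ᵥ v) 0 = 0 := fun v ↦ by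
    simp [Matrix.mulVec, dotProduct, aMat_apply_zero]
  have hιs : ∀ (v : Fin l → ℝ) (i : Fin l), (aMat (0 : Fin l → ℝ) *ᵥ v) i.succ = v i := fun v i ↦ by
    simp [Matrix.mulVec, dotProduct, aMat_apply_succ, Matrix.one_apply]
  have hδ0 : 0 ≤ δ := (norm_nonneg _).trans h
  refine ⟨{ toFun := fun v ↦ WithLp.toLp 2 fun i ↦ (M *ᵥ v.ofLp) i.succ
            map_add' := fun v w ↦ by ext i; simp [Matrix.mulVec_add]
            map_smul' := fun c v ↦ by ext i; simp [Matrix.mulVec_smul] },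
    WithLp.toLp 2 (M 0), fun v ↦ ?_, ?_, fun v ↦ ?_⟩
  · refine abs_le_of_sq_le_sq' ?_ (by positivity) |>.2
    refine le_trans ?_ (hsplit v)
    rw [EuclideanSpace.real_norm_sq_eq]
    have : ∀ i, (((WithLp.toLp 2 fun i ↦ (M *ᵥ v.ofLp) i.succ) : EuclideanSpace ℝ (Fin l)) - v) i =
        (D *ᵥ v.ofLp) i.succ := fun i ↦ by
      simp only [PiLp.sub_apply]
      rw [hM, Pi.add_apply, hιs]; ring
    simp only [LinearMap.coe_mk, AddHom.coe_mk, this]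
    nlinarith [sq_nonneg ((D *ᵥ v.ofLp) 0)]
  · -- `D` applied to its own first row `g` has first entry `‖g‖²`, so that `‖g‖² ≤ δ ‖g‖`
    have h1 := hsplit (WithLp.toLp 2 (M 0))
    have h2 : (D *ᵥ (M 0)) 0 = ‖(WithLp.toLp 2 (M 0) : EuclideanSpace ℝ (Fin l))‖ ^ 2 := by
      rw [EuclideanSpace.real_norm_sq_eq]
      simp [hD, Matrix.mulVec, dotProduct, aMat_apply_zero, sq]
    set g : EuclideanSpace ℝ (Fin l) := WithLp.toLp 2 (M 0)
    rw [h2] at h1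
    have h3 : (‖g‖ ^ 2) ^ 2 ≤ (δ * ‖g‖) ^ 2 :=
      le_trans (le_add_of_nonneg_right (Finset.sum_nonneg fun i _ ↦ sq_nonneg _)) h1
    have h4 := abs_le_of_sq_le_sq' h3 (by positivity) |>.2
    by_contra hc
    push Not at hc
    nlinarith
  · have h1 : comb (colVec (X * M)) v = WithLp.toLp 2 (X *ᵥ (M *ᵥ v.ofLp)) := by
      rw [Matrix.mulVec_mulVec, toLp_mulVec]
    have h2 : M *ᵥ v.ofLp = vecCons ((M *ᵥ v.ofLp) 0) fun i ↦ (M *ᵥ v.ofLp) i.succ :=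
      (Matrix.cons_head_tail _).symm
    rw [h1, h2, toLp_mulVec_cons, add_comm]
    congr 2
    rw [EuclideanSpace.inner_eq_star_dotProduct]
    simp [Matrix.mulVec, dotProduct_comm]

open scoped Matrix.Norms.Frobenius in
lemma norm_gram_sub_one_le {m : ℕ} {K : ℝ} (hm : 0 < m) {G : Matrix (Fin m) (Fin (l + 1)) ℝ}
    (h : GramNear K (√m) (colHead G) (colTail G)) :
    ‖(m : ℝ)⁻¹ • (Gᵀ * G) - 1‖ ≤ (l + 1) * K / √m := by
  have hmr : (0 : ℝ) < m := by exact_mod_cast hm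
  have hs : √(m : ℝ) ^ 2 = m := Real.sq_sqrt hmr.le
  have hs0 : 0 < √(m : ℝ) := Real.sqrt_pos.2 hmr
  obtain ⟨h1, h2, h3, h4⟩ := h
  have hK : 0 ≤ K := by
    have := (abs_nonneg _).trans h1
    exact nonneg_of_mul_nonneg_left this hs0
  rw [hs] at h1
  have h3' : ∀ i, |‖colTail G i‖ ^ 2 - m| ≤ K * √m := fun i ↦ by have := h3 i; rwa [hs] at this
  have hin : ∀ i j, (Gᵀ * G) i j = ⟪(WithLp.toLp 2 fun r ↦ G r i : Eu m), WithLp.toLp 2 fun r ↦ G r j⟫ := by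
    intro i j
    rw [EuclideanSpace.inner_eq_star_dotProduct]
    simp [Matrix.mul_apply, dotProduct, mul_comm]
  have hentry : ∀ i j, |(Gᵀ * G) i j - if i = j then (m : ℝ) else 0| ≤ K * √m := by
    intro i j
    rw [hin]
    refine Fin.cases ?_ (fun i ↦ ?_) i <;> refine Fin.cases ?_ (fun j ↦ ?_) j
    · rw [if_pos rfl, real_inner_self_eq_norm_sq]; exact h1
    · rw [if_neg (Fin.succ_ne_zero j).symm, sub_zero]; exact h2 j
    · rw [if_neg (Fin.succ_ne_zero i), sub_zero, real_inner_comm]; exact h2 i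
    · by_cases hij : i = j
      · subst hij
        rw [if_pos rfl, real_inner_self_eq_norm_sq]; exact h3' i
      · rw [if_neg (fun h ↦ hij (Fin.succ_injective _ h)), sub_zero]; exact h4 i j hij
  refine abs_le_of_sq_le_sq' ?_ (by positivity) |>.2
  rw [frobenius_sq]
  calc _ ≤ ∑ _i : Fin (l + 1), ∑ _j : Fin (l + 1), (K / √m) ^ 2 := by
        refine Finset.sum_le_sum fun i _ ↦ Finset.sum_le_sum fun j _ ↦ ?_
        refine sq_le_sq.2 ?_
        rw [abs_of_nonneg (by positivity : 0 ≤ K / √m)]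
        have e : ((m : ℝ)⁻¹ • (Gᵀ * G) - 1 : Matrix (Fin (l + 1)) (Fin (l + 1)) ℝ) i j =
            (m : ℝ)⁻¹ * ((Gᵀ * G) i j - if i = j then (m : ℝ) else 0) := by
          rw [Matrix.sub_apply, Matrix.smul_apply, Matrix.one_apply, mul_sub, smul_eq_mul]
          split_ifs
          · rw [inv_mul_cancel₀ hmr.ne']
          · simp
        rw [e, abs_mul, abs_of_pos (inv_pos.2 hmr)]
        calc (m : ℝ)⁻¹ * _ ≤ (m : ℝ)⁻¹ * (K * √m) := by gcongr; exact hentry i j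
          _ = K / √m := by nth_rewrite 1 [← hs]; field_simp
    _ = _ := by simp; ring

end Reduction

/-! ### The law of the reduced data -/

section DataLaw

variable {n k m p l : ℕ}

lemma map_vecMul_multivariateGaussian {Ω J : Matrix (Fin p) (Fin p) ℝ} (hΩ : Ω.PosSemidef)
    (hJ : Jᵀ * Ω * J = 1) :
    (multivariateGaussian 0 Ω).map (fun x ↦ (WithLp.toLp 2 (x.ofLp ᵥ* J) : Eu p)) =
      stdGaussian (Eu p) := by
  apply Measure.ext_of_charFun
  ext t
  rw [charFun_stdGaussian, charFun_apply, integral_map (by fun_prop) (by fun_prop)]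
  have h1 : ∀ x : Eu p, ⟪(WithLp.toLp 2 (x.ofLp ᵥ* J) : Eu p), t⟫ =
      ⟪x, WithLp.toLp 2 (J *ᵥ t.ofLp)⟫ := by
    intro x
    rw [EuclideanSpace.inner_eq_star_dotProduct, EuclideanSpace.inner_eq_star_dotProduct]
    simp only [star_trivial]
    rw [dotProduct_comm, ← Matrix.dotProduct_mulVec, dotProduct_comm]
  simp_rw [h1]
  rw [← charFun_apply, charFun_multivariateGaussian hΩ]
  have h2 : (J *ᵥ t.ofLp) ⬝ᵥ Ω *ᵥ (J *ᵥ t.ofLp) = ‖t‖ ^ 2 := by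
    rw [Matrix.mulVec_mulVec, ← Matrix.vecMul_transpose, ← Matrix.dotProduct_mulVec,
      Matrix.mulVec_mulVec, ← Matrix.mul_assoc, hJ, Matrix.one_mulVec,
      EuclideanSpace.real_norm_sq_eq]
    simp [dotProduct, sq]
  simp only [inner_zero_right, Complex.ofReal_zero, zero_mul]
  rw [h2]
  push_cast
  congr 1
  ring

/-- The images of a standard normal vector under the two blocks `C` and `N` of an orthogonal matrix
are independent standard normal vectors. -/
lemma map_rotation_stdGaussian {C : Matrix (Fin k) (Fin n) ℝ} {N : Matrix (Fin m) (Fin n) ℝ}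
    (hC : C * Cᵀ = 1) (hN : N * Nᵀ = 1) (hCN : C * Nᵀ = 0) :
    (stdGaussian (Eu n)).map (fun x ↦ ((WithLp.toLp 2 (C *ᵥ x.ofLp) : Eu k),
      (WithLp.toLp 2 (N *ᵥ x.ofLp) : Eu m))) = (stdGaussian (Eu k)).prod (stdGaussian (Eu m)) := by
  rw [← charFun_eq_prod_iff]
  intro t
  rw [Measure.map_map (by fun_prop) (by fun_prop), charFun_stdGaussian, charFun_stdGaussian,
    charFun_apply, integral_map (by fun_prop) (by fun_prop)]
  set y : Eu n := WithLp.toLp 2 (Cᵀ *ᵥ t.fst.ofLp + Nᵀ *ᵥ t.snd.ofLp) with hy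
  have h1 : ∀ x : Eu n, ⟪((WithLp.toLp 2) ∘ fun x : Eu n ↦ ((WithLp.toLp 2 (C *ᵥ x.ofLp) : Eu k),
      (WithLp.toLp 2 (N *ᵥ x.ofLp) : Eu m))) x, t⟫ = ⟪x, y⟫ := by
    intro x
    rw [WithLp.prod_inner_apply, EuclideanSpace.inner_eq_star_dotProduct,
      EuclideanSpace.inner_eq_star_dotProduct, EuclideanSpace.inner_eq_star_dotProduct]
    simp only [star_trivial, hy, Function.comp, Matrix.mulVec_transpose, add_dotProduct,
      Matrix.dotProduct_mulVec]
    rfl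
  simp_rw [h1]
  have h2 : ‖y‖ ^ 2 = ‖t.fst‖ ^ 2 + ‖t.snd‖ ^ 2 := by
    have e : ∀ {q : ℕ} (z : Eu q), ‖z‖ ^ 2 = z.ofLp ⬝ᵥ z.ofLp := fun z ↦ by
      rw [EuclideanSpace.real_norm_sq_eq]; simp [dotProduct, sq]
    have hNC : N * Cᵀ = 0 := by simpa using congrArg Matrix.transpose hCN
    rw [e, e, e, hy]
    simp only [dotProduct_add, add_dotProduct, Matrix.mulVec_transpose]
    simp only [← Matrix.mulVec_transpose, Matrix.dotProduct_mulVec, Matrix.transpose_transpose,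
      Matrix.mulVec_mulVec, hC, hN, hCN, hNC, Matrix.one_mulVec, Matrix.zero_mulVec, zero_dotProduct]
    ring
  rw [← charFun_apply, charFun_stdGaussian, ← Complex.exp_add, ← Complex.ofReal_pow, h2]
  congr 1
  push_cast
  change -((‖t.fst‖ : ℂ) ^ 2 + (‖t.snd‖ : ℂ) ^ 2) / 2 =
    -(‖t.fst‖ : ℂ) ^ 2 / 2 + -(‖t.snd‖ : ℂ) ^ 2 / 2
  ring

/-- The columns of the standardized error matrix `V J` are independent standard normal vectors. -/
lemma NormalRows.hasLaw_cols {E : Type*} [MeasurableSpace E] {P : Measure E} [IsProbabilityMeasure P]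
    {V : E → Matrix (Fin n) (Fin p) ℝ} {Ω J : Matrix (Fin p) (Fin p) ℝ} (hV : NormalRows P V Ω)
    (hΩ : Ω.PosSemidef) (hJ : Jᵀ * Ω * J = 1) :
    HasLaw (fun ω j ↦ (WithLp.toLp 2 fun r ↦ (V ω * J) r j : Eu n))
      (Measure.pi fun _ : Fin p ↦ stdGaussian (Eu n)) P := by
  have hf : HasLaw (fun x : Eu p ↦ (WithLp.toLp 2 (x.ofLp ᵥ* J) : Eu p)) (stdGaussian (Eu p))
      (multivariateGaussian 0 Ω) := ⟨by fun_prop, map_vecMul_multivariateGaussian hΩ hJ⟩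
  have h1 := (hV.1.comp (fun _ x ↦ (WithLp.toLp 2 (x.ofLp ᵥ* J) : Eu p))
    (fun _ ↦ by fun_prop)).hasLaw_pi fun i ↦ hf.comp (hV.2 i)
  have h2 : HasLaw _ _ _ := ⟨Measurable.aemeasurable (by fun_prop), map_transpose_pi_stdGaussian n p⟩
  exact h2.comp h1

lemma measurePreserving_shuffle {α β γ δ : Type*} [MeasurableSpace α] [MeasurableSpace β]
    [MeasurableSpace γ] [MeasurableSpace δ] (μ : Measure α) (ν : Measure β) (ρ : Measure γ)
    (τ : Measure δ) [IsProbabilityMeasure μ] [IsProbabilityMeasure ν] [IsProbabilityMeasure ρ]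
    [IsProbabilityMeasure τ] :
    MeasurePreserving (fun x : (α × β) × (γ × δ) ↦ (x.1.2, (x.2.2, x.1.1, x.2.1)))
      ((μ.prod ν).prod (ρ.prod τ)) (ν.prod (τ.prod (μ.prod ρ))) := by
  have h1 : MeasurePreserving (fun x : α × (δ × γ) ↦ (x.2.1, x.1, x.2.2))
      (μ.prod (τ.prod ρ)) (τ.prod (μ.prod ρ)) :=
    (measurePreserving_prodAssoc τ μ ρ).comp
      (((Measure.measurePreserving_swap (μ := μ) (ν := τ)).prod (.id ρ)).comp
        (measurePreserving_prodAssoc μ τ ρ).symm)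
  exact ((MeasurePreserving.id ν).prod h1).comp ((measurePreserving_prodAssoc ν μ (τ.prod ρ)).comp
    ((Measure.measurePreserving_swap (μ := μ) (ν := ν)).prod
      (Measure.measurePreserving_swap (μ := ρ) (ν := τ))))

/-- The standardized and rotated errors have the law `dataLaw`. -/
lemma NormalRows.hasLaw_data {E : Type*} [MeasurableSpace E] {P : Measure E}
    [IsProbabilityMeasure P] {V : E → Matrix (Fin n) (Fin (l + 1)) ℝ}
    {Ω J : Matrix (Fin (l + 1)) (Fin (l + 1)) ℝ} (hV : NormalRows P V Ω)
    (hΩ : Ω.PosSemidef) (hJ : Jᵀ * Ω * J = 1)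
    {C : Matrix (Fin k) (Fin n) ℝ} {N : Matrix (Fin m) (Fin n) ℝ}
    (hC : C * Cᵀ = 1) (hN : N * Nᵀ = 1) (hCN : C * Nᵀ = 0) :
    HasLaw (fun ω ↦ (colTail (C * V ω * J), (colTail (N * V ω * J), colHead (C * V ω * J),
      colHead (N * V ω * J)))) (dataLaw l k m) P := by
  have h0 : MeasurePreserving _ _ _ := ⟨by fun_prop, map_rotation_stdGaussian hC hN hCN⟩
  have h1 := measurePreserving_pi (fun _ : Fin (l + 1) ↦ _) (fun _ ↦ _) fun _ : Fin (l + 1) ↦ h0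
  have h2 := measurePreserving_arrowProdEquivProdArrow (Eu k) (Eu m) (Fin (l + 1))
    (fun _ ↦ stdGaussian (Eu k)) (fun _ ↦ stdGaussian (Eu m))
  have h3 := (measurePreserving_piFinSuccAbove (fun _ : Fin (l + 1) ↦ stdGaussian (Eu k)) 0).prod
    (measurePreserving_piFinSuccAbove (fun _ : Fin (l + 1) ↦ stdGaussian (Eu m)) 0)
  have h4 := ((measurePreserving_shuffle _ _ _ _).comp (h3.comp (h2.comp h1)))
  have h5 : HasLaw _ (dataLaw l k m) _ := ⟨h4.measurable.aemeasurable, h4.map_eq⟩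
  have h6 := h5.comp (hV.hasLaw_cols hΩ hJ)
  simp_rw [Matrix.mul_assoc]
  exact h6

end DataLaw

/-! ### The data matrix under the null hypothesis -/

section Reduced

variable {n k l : ℕ} {β : Fin l → ℝ}

lemma cols_mulVec_eq (β : Fin l → ℝ) (X : Matrix (Fin k) (Fin l) ℝ) :
    cols (X *ᵥ β) X = X * (aMat β)ᵀ := by
  ext i j
  refine Fin.cases ?_ (fun j ↦ ?_) j
  · rfl
  · simp [cols, Matrix.mul_apply, aMat_apply_succ, Matrix.one_apply]

lemma cols_eq_add (Z : Matrix (Fin n) (Fin k) ℝ) (X : Matrix (Fin k) (Fin l) ℝ)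
    (W Y₂ : Matrix (Fin n) (Fin l) ℝ) (u y : Fin n → ℝ) (hy : y = Y₂ *ᵥ β + u)
    (hY : Y₂ = Z * X + W) :
    cols y Y₂ = Z * cols (X *ᵥ β) X + cols (W *ᵥ β + u) W := by
  have h : Z * cols (X *ᵥ β) X = cols ((Z * X) *ᵥ β) (Z * X) := by
    rw [cols_mulVec_eq, cols_mulVec_eq, Matrix.mul_assoc]
  rw [h]
  subst hy hY
  ext i j
  refine Fin.cases ?_ (fun j ↦ ?_) j
  · simp [cols, Matrix.add_mulVec, add_assoc]
  · simp [cols]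

lemma colHead_add {p : ℕ} (X X' : Matrix (Fin p) (Fin (l + 1)) ℝ) :
    colHead (X + X') = colHead X + colHead X' := rfl

lemma colTail_add {p : ℕ} (X X' : Matrix (Fin p) (Fin (l + 1)) ℝ) :
    colTail (X + X') = colTail X + colTail X' := rfl

lemma colHead_mul_transpose_aMat {p : ℕ} (X : Matrix (Fin p) (Fin l) ℝ)
    {J : Matrix (Fin (l + 1)) (Fin (l + 1)) ℝ} {R : Matrix (Fin l) (Fin l) ℝ}
    (hJA : Jᵀ * aMat β = aMat (0 : Fin l → ℝ) * R) :
    colHead (X * (aMat β)ᵀ * J) = 0 := by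
  have h : (aMat β)ᵀ * J = (aMat (0 : Fin l → ℝ) * R)ᵀ := by
    rw [← hJA, Matrix.transpose_mul, Matrix.transpose_transpose]
  rw [Matrix.mul_assoc, h]
  ext r
  show (X * (aMat (0 : Fin l → ℝ) * R)ᵀ) r 0 = 0
  rw [Matrix.mul_apply]
  simp [aMat_zero_mul_apply_zero]

lemma colTail_eq_colVec {p : ℕ} (X : Matrix (Fin p) (Fin (l + 1)) ℝ) :
    colTail X = colVec (X * aMat (0 : Fin l → ℝ)) := by
  ext j r
  exact (mul_aMat_zero_apply X r j).symm

end Reduced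

/-! ### The concentration matrix -/

section Concentration

variable {n k l : ℕ}

lemma minEig_mul_le {p : ℕ} {A : Matrix (Fin p) (Fin p) ℝ} (hA : A.PosSemidef)
    (v : Fin p → ℝ) : minEig A * (v ⬝ᵥ v) ≤ v ⬝ᵥ (A *ᵥ v) := by
  have h : (A - minEig A • (1 : Matrix (Fin p) (Fin p) ℝ)).PosSemidef := by
    rw [Matrix.posSemidef_iff_isHermitian_and_spectrum_nonneg]
    refine ⟨hA.1.sub (Matrix.isHermitian_one.smul (by simp [IsSelfAdjoint])), fun x hx ↦ ?_⟩
    have h1 : x + minEig A ∈ spectrum ℝ A := by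
      rwa [spectrum.add_mem_iff, Algebra.algebraMap_eq_smul_one, neg_add_eq_sub]
    have h2 : minEig A ≤ x + minEig A :=
      csInf_le ⟨0, fun y hy ↦ (Matrix.posSemidef_iff_isHermitian_and_spectrum_nonneg.1 hA).2 hy⟩ h1
    show 0 ≤ x
    linarith
  have h3 := h.dotProduct_mulVec_nonneg v
  simp only [star_trivial, Matrix.sub_mulVec, Matrix.smul_mulVec, Matrix.one_mulVec,
    dotProduct_sub, dotProduct_smul, smul_eq_mul] at h3
  linarith

lemma norm_comb_colVec_sq {p : ℕ} (X : Matrix (Fin p) (Fin l) ℝ) (v : EuclideanSpace ℝ (Fin l)) :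
    ‖comb (colVec X) v‖ ^ 2 = v.ofLp ⬝ᵥ ((Xᵀ * X) *ᵥ v.ofLp) := by
  rw [dotProduct_gram_mulVec, toLp_mulVec]

/-- The concentration matrix is the Gram matrix of the mean of `T`. -/
lemma gram_mean_eq_concMat {Z : Matrix (Fin n) (Fin k) ℝ} (hZ : Z.rank = k)
    {C : Matrix (Fin k) (Fin n) ℝ} (hC : Cᵀ * C = projMat Z) {Pi : Matrix (Fin k) (Fin (l + 1)) ℝ}
    {Ω J : Matrix (Fin (l + 1)) (Fin (l + 1)) ℝ} (hΩ : Ω.PosDef) {β₀ : Fin l → ℝ}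
    {R : Matrix (Fin l) (Fin l) ℝ} (hR : R.PosDef)
    (hRe : invSqrt ((aMat β₀)ᵀ * Ω⁻¹ * aMat β₀) = R⁻¹)
    (hJ : J * aMat (0 : Fin l → ℝ) = Ω⁻¹ * aMat β₀ * R⁻¹) :
    (C * (Z * Pi) * J * aMat (0 : Fin l → ℝ))ᵀ * (C * (Z * Pi) * J * aMat (0 : Fin l → ℝ)) =
      concMat β₀ Ω Z Pi := by
  have hPZ : Cᵀ * (C * Z) = Z := by
    rw [← Matrix.mul_assoc, hC, projMat, Matrix.mul_assoc, Matrix.mul_assoc,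
      Matrix.nonsing_inv_mul _ (isUnit_det_of_posDef (posDef_gram_of_rank hZ)), Matrix.mul_one]
  have hΩt : (Ω⁻¹)ᵀ = Ω⁻¹ := transpose_of_posDef (posDef_inv hΩ)
  have hRt : (R⁻¹)ᵀ = R⁻¹ := transpose_of_posDef (posDef_inv hR)
  have e : C * (Z * Pi) * J * aMat (0 : Fin l → ℝ) = (C * Z) * (Pi * (Ω⁻¹ * aMat β₀ * R⁻¹)) := by
    rw [← hJ]; simp only [Matrix.mul_assoc]
  rw [e, Matrix.transpose_mul, Matrix.transpose_mul C, Matrix.mul_assoc, Matrix.mul_assoc Zᵀ,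
    ← Matrix.mul_assoc Cᵀ, hPZ, concMat, hRe]
  simp only [Matrix.transpose_mul, hΩt, hRt, Matrix.mul_assoc]

/-- The squared column combinations of the mean of `T` are bounded below by the smallest eigenvalue
of the concentration matrix. -/
lemma minEig_le_norm_comb_sq {X : Matrix (Fin k) (Fin (l + 1)) ℝ} {A : Matrix (Fin l) (Fin l) ℝ}
    (h : (X * aMat (0 : Fin l → ℝ))ᵀ * (X * aMat (0 : Fin l → ℝ)) = A)
    (v : EuclideanSpace ℝ (Fin l)) : minEig A * ‖v‖ ^ 2 ≤ ‖comb (colTail X) v‖ ^ 2 := by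
  rw [colTail_eq_colVec, norm_comb_colVec_sq, h]
  have := minEig_mul_le (h ▸ posSemidef_gram (X * aMat (0 : Fin l → ℝ))) v.ofLp
  rw [EuclideanSpace.real_norm_sq_eq]
  simpa [dotProduct, sq] using this

/-- The numerical part of `exists_strong_bound`, with `x = ‖comb M v‖`, `y = ‖comb Γ v‖²`,
`z = ⟪comb M v, comb Γ v⟫`, `w = ‖v‖` and `r = √k`. -/
lemma strong_arith {A K c w x y k r : ℝ} (hr : 1 ≤ r) (hK : (k - K * r) * w ^ 2 ≤ y)
    (hx : 2 * (A + K + 2 * c ^ 2) * r * w ^ 2 ≤ x ^ 2)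
    {z : ℝ} (hz : |z| ≤ x * (c * w)) :
    (k + A * r) * w ^ 2 ≤ x ^ 2 + 2 * z + y := by
  have h1 := (abs_le.1 hz).1
  have h2 : 2 * (x * (c * w)) ≤ x ^ 2 / 2 + 2 * (c * w) ^ 2 := by
    nlinarith only [sq_nonneg (x - 2 * (c * w))]
  have h3 : 2 * (c * w) ^ 2 ≤ 2 * c ^ 2 * r * w ^ 2 := by
    have : 0 ≤ 2 * c ^ 2 * w ^ 2 := by positivity
    nlinarith only [mul_le_mul_of_nonneg_left hr this]
  nlinarith only [h1, h2, h3, hK, hx]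

/-- If the mean `M` of `T` is sufficiently long compared with `k ^ (1 / 4)`, then with high
probability all squared column combinations of `T = M + Γ` exceed `k` by a large multiple of `√k`.
Only the projection of `Γ` on the span of `M`, which is bounded in probability, enters the cross
term `⟪comb M v, comb Γ v⟫`. -/
lemma exists_strong_bound (l : ℕ) (A : ℝ) {η : ℝ} (hη : 0 < η) :
    ∃ L : ℝ, ∀ k : ℕ, 1 ≤ k → ∀ M : Fin l → Eu k, (∀ v, L * √k * ‖v‖ ^ 2 ≤ ‖comb M v‖ ^ 2) →
      (Measure.pi fun _ : Fin l ↦ stdGaussian (Eu k)).real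
        {Γ | ¬ ∀ v, (k + A * √k) * ‖v‖ ^ 2 ≤ ‖comb (M + Γ) v‖ ^ 2} ≤ η := by
  obtain ⟨K, hK1, hK⟩ := exists_div_sq_le ((l + 1 : ℝ) ^ 2 * (1 + chiVar)) (half_pos hη)
  obtain ⟨c, hc1, hc⟩ := exists_div_sq_le ((l : ℝ) * l) (half_pos hη)
  have hl : (0 : ℝ) ≤ l := Nat.cast_nonneg l
  refine ⟨2 * (A + (l + 1) ^ 2 * K + 2 * (l * c) ^ 2), fun k hk M hM ↦ ?_⟩
  set π := Measure.pi fun _ : Fin l ↦ stdGaussian (Eu k) with hπ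
  set U := Submodule.span ℝ (Set.range M) with hU
  have hG : π.real {Γ | ¬ ∀ v, |‖comb Γ v‖ ^ 2 - √(k : ℝ) ^ 2 * ‖v‖ ^ 2| ≤
      (l + 1) ^ 2 * K * √k * ‖v‖ ^ 2} ≤ η / 2 := by
    have h2 := model_gramNear (l := l) (E := Eu k) (F := Eu k) (K := K) (by linarith)
    rw [finrank_euclideanSpace_fin, ← mul_div_assoc] at h2
    refine le_trans ?_ (h2.trans hK)
    set s := {Γ : Fin l → Eu k | ¬ ∀ v, |‖comb Γ v‖ ^ 2 - √(k : ℝ) ^ 2 * ‖v‖ ^ 2| ≤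
      (l + 1) ^ 2 * K * √k * ‖v‖ ^ 2} with hs
    have h3 : (model l (Eu k) (Eu k)).real (s ×ˢ Set.univ) = π.real s := by
      rw [model, measureReal_prod_prod]; simp [hπ]
    rw [← h3]
    refine measureReal_mono fun ω hω ↦ ?_
    have hω' : ¬ ∀ v, |‖comb ω.1 v‖ ^ 2 - √(k : ℝ) ^ 2 * ‖v‖ ^ 2| ≤
      (l + 1) ^ 2 * K * √k * ‖v‖ ^ 2 := hω.1
    show ¬ GramNear K (√k) ω.2.2 ω.1
    exact fun hG ↦ hω' hG.near.comb
  have hP : ∀ i, π.real {Γ | c ^ 2 < ‖U.starProjection (Γ i)‖ ^ 2} ≤ l / c ^ 2 := by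
    intro i
    have h1 := prob_projection U (K := c ^ 2) (by positivity)
    have h2 := (measurePreserving_eval (fun _ : Fin l ↦ stdGaussian (Eu k)) i).measureReal_preimage
      (s := {S | c ^ 2 < ‖U.starProjection S‖ ^ 2})
      (measurableSet_lt measurable_const (by fun_prop)).nullMeasurableSet
    refine (h2.le.trans h1).trans ?_
    have := finrank_span_range_le M
    gcongr
  have hPu : π.real (⋃ i, {Γ | c ^ 2 < ‖U.starProjection (Γ i)‖ ^ 2}) ≤ η / 2 := by
    refine (measureReal_iUnion_fintype_le _).trans ((Finset.sum_le_sum fun i _ ↦ hP i).trans ?_)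
    simpa [mul_div_assoc] using hc
  refine (measureReal_mono (s₂ := {Γ | ¬ ∀ v, |‖comb Γ v‖ ^ 2 - √(k : ℝ) ^ 2 * ‖v‖ ^ 2| ≤
      (l + 1) ^ 2 * K * √k * ‖v‖ ^ 2} ∪ ⋃ i, {Γ | c ^ 2 < ‖U.starProjection (Γ i)‖ ^ 2})
      fun Γ hΓ ↦ ?_).trans ((measureReal_union_le _ _).trans (by linarith))
  by_contra hcon
  rw [Set.mem_union, not_or] at hcon
  have g1 : ∀ v, |‖comb Γ v‖ ^ 2 - √(k : ℝ) ^ 2 * ‖v‖ ^ 2| ≤ (l + 1) ^ 2 * K * √k * ‖v‖ ^ 2 :=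
    not_not.1 hcon.1
  have g2 : ∀ i, ‖U.starProjection (Γ i)‖ ≤ c := fun i ↦ by
    have : ¬ c ^ 2 < ‖U.starProjection (Γ i)‖ ^ 2 := fun h ↦ hcon.2 (Set.mem_iUnion.2 ⟨i, h⟩)
    exact abs_le_of_sq_le_sq' (not_lt.1 this) (by linarith) |>.2
  refine hΓ fun v ↦ ?_
  have hk1 : (1 : ℝ) ≤ √k := Real.one_le_sqrt.2 (by exact_mod_cast hk)
  have hks : √(k : ℝ) ^ 2 = k := Real.sq_sqrt (Nat.cast_nonneg k)
  have hproj : ‖U.starProjection (comb Γ v)‖ ≤ l * c * ‖v‖ := by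
    rw [comb_apply, map_sum]
    calc _ ≤ ∑ i, ‖U.starProjection (v i • Γ i)‖ := norm_sum_le _ _
      _ ≤ ∑ _i : Fin l, ‖v‖ * c := by
          refine Finset.sum_le_sum fun i _ ↦ ?_
          rw [map_smul, norm_smul]
          exact mul_le_mul (PiLp.norm_apply_le v i) (g2 i) (norm_nonneg _) (norm_nonneg _)
      _ = _ := by simp; ring
  have hz : |⟪comb M v, comb Γ v⟫| ≤ ‖comb M v‖ * (l * c * ‖v‖) := by
    have e : ⟪comb M v, comb Γ v⟫ = ⟪comb M v, U.starProjection (comb Γ v)⟫ := by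
      rw [← Submodule.inner_starProjection_left_eq_right,
        Submodule.starProjection_eq_self_iff.2 (comb_mem_span M v)]
    rw [e]
    exact (abs_real_inner_le_norm _ _).trans (by gcongr)
  have hadd : comb (M + Γ) v = comb M v + comb Γ v := by
    simp [comb_apply, smul_add, Finset.sum_add_distrib]
  rw [hadd, norm_add_sq_real]
  have g1v := (abs_le.1 (g1 v)).1
  rw [hks] at g1v
  exact strong_arith hk1 (by linarith) (hM v) hz

end Concentration

/-! ### The rejection probability in finite samples -/

section Rejection

variable {l : ℕ}

lemma dataLaw_real_fst (k m : ℕ) (p : (Fin l → Eu k) → Prop) :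
    (dataLaw l k m).real {d | p d.1} = (Measure.pi fun _ : Fin l ↦ stdGaussian (Eu k)).real {Γ | p Γ} := by
  have : {d : (Fin l → Eu k) × ((Fin l → Eu m) × Eu k × Eu m) | p d.1} =
      {Γ | p Γ} ×ˢ Set.univ := by ext; simp
  rw [this, dataLaw, measureReal_prod_prod]
  simp

lemma dataLaw_real_snd (k m : ℕ) (p : ((Fin l → Eu m) × Eu k × Eu m) → Prop) :
    (dataLaw l k m).real {d | p d.2} = (model l (Eu k) (Eu m)).real {ω | p ω} := by
  have : {d : (Fin l → Eu k) × ((Fin l → Eu m) × Eu k × Eu m) | p d.2} =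
      Set.univ ×ˢ {ω | p ω} := by ext; simp
  rw [this, dataLaw, measureReal_prod_prod]
  simp

lemma exists_good_data (l : ℕ) {η : ℝ} (hη : 0 < η) :
    ∃ K : ℝ, 1 ≤ K ∧ ∀ k m : ℕ,
      (dataLaw l k m).real {d | ¬ GramNear K (√m) d.2.2.2 d.2.1} ≤ η ∧
      (dataLaw l k m).real {d | K * √k < |‖d.2.2.1‖ ^ 2 - k|} ≤ η := by
  obtain ⟨K, hK1, hK⟩ := exists_div_sq_le (max ((l + 1 : ℝ) ^ 2 * (1 + chiVar)) chiVar) hη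
  have hK0 : 0 < K := by linarith
  refine ⟨K, hK1, fun k m ↦ ⟨?_, ?_⟩⟩
  · rw [dataLaw_real_snd k m fun ω ↦ ¬ GramNear K (√m) ω.2.2 ω.1]
    have h2 := model_gramNear (l := l) (E := Eu k) (F := Eu m) hK0
    rw [finrank_euclideanSpace_fin, ← mul_div_assoc] at h2
    refine h2.trans (le_trans ?_ hK)
    gcongr
    exact le_max_left _ _
  · rw [dataLaw_real_snd k m fun ω ↦ K * √k < |‖ω.2.1‖ ^ 2 - k|]
    have h2 := prob_norm_sq_sub (Eu k) hK0
    rw [finrank_euclideanSpace_fin] at h2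
    have h3 := (measurePreserving_S (l := l) (E := Eu k) (F := Eu m)).measureReal_preimage
      (s := {S | K * √k < |‖S‖ ^ 2 - k|})
      (measurableSet_lt measurable_const (by fun_prop)).nullMeasurableSet
    refine (h3.le.trans h2).trans (le_trans ?_ hK)
    gcongr
    exact le_max_right _ _

lemma norm_le_of_sq_sub_le {k : ℕ} (hk : 1 ≤ k) {K : ℝ} (hK : 0 ≤ K) {x : Eu k}
    (h : |‖x‖ ^ 2 - k| ≤ K * √k) : ‖x‖ ≤ (1 + K) * √k := by
  have h1 := (abs_le.1 h).2
  have hk1 : (1 : ℝ) ≤ √k := Real.one_le_sqrt.2 (by exact_mod_cast hk)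
  have hks : √(k : ℝ) ^ 2 = k := Real.sq_sqrt (Nat.cast_nonneg k)
  refine (abs_le_of_sq_le_sq' ?_ (by positivity)).2
  have : K * √k ≤ K * √k ^ 2 := by gcongr; nlinarith only [hk1]
  nlinarith only [h1, hks, this, mul_nonneg (mul_nonneg hK hK) (sq_nonneg √(k : ℝ)),
    mul_nonneg hK (sq_nonneg √(k : ℝ))]

open scoped Matrix.Norms.Frobenius in
set_option maxHeartbeats 400000 in
/-- The rejection probability is near the nominal level once `Q T` makes the feasible critical value
acceptable, and `Q T` holds with high probability given the bound on the mean of `T` by the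
concentration matrix. In the case of few instruments `Q` is trivial; with strong instruments it says
that `T` is long. -/
lemma exists_rejection_bound {Ω : Matrix (Fin (l + 1)) (Fin (l + 1)) ℝ} (hΩ : Ω.PosDef)
    (β₀ : Fin l → ℝ) {a η : ℝ} (ha0 : 0 ≤ a) (ha1 : a ≤ 1) (hη : 0 < η) :
    ∃ C m₀ : ℝ, 0 ≤ C ∧ ∀ (n k : ℕ) (Z : Matrix (Fin n) (Fin k) ℝ), Z.rank = k → 1 ≤ k → k < n →
      m₀ ≤ (n - k : ℕ) → ∀ (Pi₂ : Matrix (Fin k) (Fin l) ℝ) {E : Type*} [MeasurableSpace E]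
      (P : Measure E) [IsProbabilityMeasure P] (V : E → Matrix (Fin n) (Fin (l + 1)) ℝ),
      NormalRows P V Ω → ∀ Q : (Fin l → Eu k) → Prop,
      (∀ (T : Fin l → Eu k) (t : Matrix (Fin k) (Fin l) ℝ) (x : Eu k),
        Rel (C / √(n - k : ℕ)) x T (colVec t) → ‖x‖ ≤ C * √k → Q T →
          Acceptable (n - k) a η T (critVal n k a t)) →
      (∀ M : Fin l → Eu k,
        (∀ v, minEig (concMat β₀ Ω Z (cols (Pi₂ *ᵥ β₀) Pi₂)) * ‖v‖ ^ 2 ≤ ‖comb M v‖ ^ 2) →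
          (Measure.pi fun _ : Fin l ↦ stdGaussian (Eu k)).real {Γ | ¬ Q (M + Γ)} ≤ η) →
      |P.real {ω | LR1 β₀ Z (Z * cols (Pi₂ *ᵥ β₀) Pi₂ + V ω) / ((n : ℝ) - k) ≥
        critVal n k a (tHat β₀ Z (Z * cols (Pi₂ *ᵥ β₀) Pi₂ + V ω))} - a| ≤ 5 * η := by
  obtain ⟨J, R, σ, hσ, hR, hRe, hJ, hJΩ, hb, hJA, hJι⟩ := exists_standardization hΩ β₀
  obtain ⟨Cw, s₀, hCw, hs₀, hw⟩ := exists_weight_lipschitz hR (transpose_mul_self_aMat_zero (l := l))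
  obtain ⟨K, hK1, hgood⟩ := exists_good_data l hη
  have hl : (0 : ℝ) ≤ l := Nat.cast_nonneg l
  have hK0 : 0 ≤ K := by linarith
  refine ⟨Cw * ((l + 1) * K) + (1 + K), max ((4 * ((l + 1 : ℝ) ^ 2 * K)) ^ 2)
    (((l + 1) * K / s₀) ^ 2), by positivity, ?_⟩
  intro n k Z hZ hk hkn hm Pi₂ E _ P _ V hV Q hacc hQ
  have hm1 : 4 * ((l + 1 : ℝ) ^ 2 * K) ≤ √(n - k : ℕ) :=
    Real.le_sqrt_of_sq_le ((le_max_left _ _).trans hm)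
  have hm2 : (l + 1) * K / s₀ ≤ √(n - k : ℕ) :=
    Real.le_sqrt_of_sq_le ((le_max_right _ _).trans hm)
  have hmpos : 0 < √((n - k : ℕ) : ℝ) := lt_of_lt_of_le (by positivity) hm1
  have hcast : (n : ℝ) - k = (n - k : ℕ) := by rw [Nat.cast_sub hkn.le]
  have hknr : (k : ℝ) < n := by exact_mod_cast hkn
  obtain ⟨C, N, hCd, hCC, hNN, hCN, hCP, hNP, hNZ⟩ := exists_rotation hZ
  set Pi := cols (Pi₂ *ᵥ β₀) Pi₂ with hPi
  set M := colTail (C * (Z * Pi) * J) with hM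
  have hMm : ∀ v, minEig (concMat β₀ Ω Z Pi) * ‖v‖ ^ 2 ≤ ‖comb M v‖ ^ 2 :=
    minEig_le_norm_comb_sq (gram_mean_eq_concMat hZ hCP hΩ hR hRe hJι)
  have hD := hV.hasLaw_data hΩ.posSemidef hJΩ hCC hNN hCN
  have hNY : ∀ ω, N * (Z * Pi + V ω) * J = N * V ω * J := fun ω ↦ by
    rw [Matrix.mul_add, ← Matrix.mul_assoc, hNZ, Matrix.zero_mul, zero_add]
  have hCY : ∀ ω, C * (Z * Pi + V ω) * J = C * (Z * Pi) * J + C * V ω * J := fun ω ↦ by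
    rw [Matrix.mul_add, Matrix.add_mul]
  have hhead : colHead (C * (Z * Pi) * J) = 0 := by
    have := colHead_mul_transpose_aMat (C * Z * Pi₂) hJA
    rwa [Matrix.mul_assoc (C * Z), ← cols_mulVec_eq, Matrix.mul_assoc C] at this
  refine (abs_rejection_sub_le M hD (η := η) (β := 3 * η)
    (B := {d | ¬ GramNear K (√(n - k : ℕ)) d.2.2.2 d.2.1} ∪
      ({d | K * √k < |‖d.2.2.1‖ ^ 2 - k|} ∪ {d | ¬ Q (M + d.1)})) ha0 ha1 hη.le ?_ ?_).trans
    (by linarith)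
  · refine (measureReal_union_le _ _).trans ?_
    have h1 := measureReal_union_le (μ := dataLaw l k (n - k)) {d | K * √k < |‖d.2.2.1‖ ^ 2 - k|}
      {d | ¬ Q (M + d.1)}
    have h2 := dataLaw_real_fst k (n - k) fun Γ ↦ ¬ Q (M + Γ)
    have h3 := hQ M hMm
    have h4 := hgood k (n - k)
    linarith [h4.1, h4.2]
  · intro ω hω
    rw [Set.mem_union, Set.mem_union, not_or, not_or] at hω
    have g1 : GramNear K (√(n - k : ℕ)) (colHead (N * V ω * J)) (colTail (N * V ω * J)) :=
      not_not.1 hω.1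
    have g2 : |‖colHead (C * V ω * J)‖ ^ 2 - k| ≤ K * √k := not_lt.1 hω.2.1
    have g3 : Q (M + colTail (C * V ω * J)) := not_not.1 hω.2.2
    have hfull : FullRank (colHead (N * (Z * Pi + V ω) * J)) (colTail (N * (Z * Pi + V ω) * J)) := by
      rw [hNY]; exact g1.near.fullRank hmpos hm1
    have hX1 : colHead (C * (Z * Pi + V ω) * J) = colHead (C * V ω * J) := by
      rw [hCY, colHead_add, hhead, zero_add]
    have hX2 : colTail (C * (Z * Pi + V ω) * J) = M + colTail (C * V ω * J) := by
      rw [hCY, colTail_add]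
    have hLR := LR1_div_eq_lr hknr hCP hNP hJ hσ hb hfull
    have hTh := tHat_eq hknr hCd hNP hJ hJA hfull rfl
    refine ⟨critVal n k a (tHat β₀ Z (Z * Pi + V ω)), ?_, ?_⟩
    · rw [hX1, hX2, hNY] at hLR
      show critVal n k a _ ≤ _ ↔ _
      rw [hLR]
      rfl
    · rw [hTh]
      set W := ((n : ℝ) - k)⁻¹ • ((N * (Z * Pi + V ω) * J)ᵀ * (N * (Z * Pi + V ω) * J)) with hW
      have hWp : W.PosDef :=
        ((posDef_gram_iff_fullRank _).2 hfull).smul (inv_pos.2 (sub_pos.2 hknr))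
      have hW1 : ‖W - 1‖ ≤ (l + 1) * K / √(n - k : ℕ) := by
        rw [hW, hNY, hcast]
        exact norm_gram_sub_one_le (by omega) g1
      have hW2 : (l + 1) * K / √(n - k : ℕ) ≤ s₀ := by
        rw [div_le_iff₀ hmpos, mul_comm s₀]; exact (div_le_iff₀ hs₀).1 hm2
      have hrel := rel_of_weight (C * (Z * Pi + V ω) * J)
        ((hw W hWp (hW1.trans hW2)).trans (mul_le_mul_of_nonneg_left hW1 hCw))
      rw [hX1, hX2] at hrel
      refine hacc _ _ _ (hrel.mono ?_) ?_ g3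
      · rw [← mul_div_assoc]
        gcongr
        linarith
      · refine (norm_le_of_sq_sub_le hk hK0 g2).trans ?_
        have : 0 ≤ Cw * ((l + 1) * K) := by positivity
        exact mul_le_mul_of_nonneg_right (by linarith) (Real.sqrt_nonneg _)

end Rejection

/-! ### Sample sizes -/

section Limits

lemma eventually_sample_size {k : ℕ → ℕ} {q : ℝ} (hq : q < 1) (m₀ : ℝ)
    (h : ∀ᶠ n in atTop, (k n : ℝ) / (n : ℝ) ≤ q) :
    ∀ᶠ n in atTop, k n < n ∧ m₀ ≤ (n - k n : ℕ) ∧ (k n : ℝ) ≤ q / (1 - q) * (n - k n : ℕ) := by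
  have hq1 : 0 < 1 - q := by linarith
  have h1 : ∀ᶠ n : ℕ in atTop, m₀ / (1 - q) ≤ n := tendsto_natCast_atTop_atTop.eventually_ge_atTop _
  filter_upwards [h, h1, eventually_gt_atTop 0] with n hn hm hpos
  have hn0 : (0 : ℝ) < n := by exact_mod_cast hpos
  rw [div_le_iff₀ hn0] at hn
  rw [div_le_iff₀ hq1] at hm
  have hlt : (k n : ℝ) < n := by nlinarith only [hn, mul_pos hn0 hq1]
  have hlt' : k n < n := by exact_mod_cast hlt
  rw [Nat.cast_sub hlt'.le]
  refine ⟨hlt', by linarith, ?_⟩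
  rw [div_mul_eq_mul_div, le_div_iff₀ hq1]
  linarith

end Limits

end MCLR

theorem theorem2 {l : ℕ} (hl : 1 ≤ l)
    -- true and hypothesized structural parameter, and the null hypothesis
    (β β₀ : Fin l → ℝ) (hH₀ : β = β₀)
    (Ω : Matrix (Fin (l + 1)) (Fin (l + 1)) ℝ) (hΩ : Ω.PosDef)
    -- number of instruments, non-random instruments, first-stage coefficients
    (k : ℕ → ℕ) (hk : ∀ᶠ n in atTop, 1 ≤ k n)
    (Z : (n : ℕ) → Matrix (Fin n) (Fin (k n)) ℝ) (hZ : ∀ᶠ n in atTop, (Z n).rank = k n)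
    (Pi₂ : (n : ℕ) → Matrix (Fin (k n)) (Fin l) ℝ)
    -- errors and data
    {E : ℕ → Type*} [∀ n, MeasurableSpace (E n)]
    (P : (n : ℕ) → Measure (E n)) [∀ n, IsProbabilityMeasure (P n)]
    (u : (n : ℕ) → E n → Fin n → ℝ)
    (V₂ : (n : ℕ) → E n → Matrix (Fin n) (Fin l) ℝ)
    (y₁ : (n : ℕ) → E n → Fin n → ℝ)
    (Y₂ : (n : ℕ) → E n → Matrix (Fin n) (Fin l) ℝ)
    (hy₁ : ∀ n ω, y₁ n ω = Y₂ n ω *ᵥ β + u n ω)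
    (hY₂ : ∀ n ω, Y₂ n ω = Z n * Pi₂ n + V₂ n ω)
    -- normal reduced-form errors
    (hV : ∀ n, MCLR.NormalRows (P n)
      (fun ω => MCLR.cols (V₂ n ω *ᵥ β + u n ω) (V₂ n ω)) Ω)
    -- many weak instruments
    (hμ : MCLR.ManyWeakInstruments k
      (fun n => MCLR.concMat β₀ Ω (Z n) (MCLR.cols (Pi₂ n *ᵥ β) (Pi₂ n))))
    -- significance level
    (a : ℝ) (ha₀ : 0 < a) (ha₁ : a < 1) :
    Tendsto
      (fun n => (P n).real {ω |
        MCLR.LR1 β₀ (Z n) (MCLR.cols (y₁ n ω) (Y₂ n ω)) / ((n : ℝ) - (k n : ℝ)) ≥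
          MCLR.critVal n (k n) a (MCLR.tHat β₀ (Z n) (MCLR.cols (y₁ n ω) (Y₂ n ω)))})
      atTop (𝓝 a) := by
  subst hH₀
  have hdata : ∀ n ω, MCLR.cols (y₁ n ω) (Y₂ n ω) =
      Z n * MCLR.cols (Pi₂ n *ᵥ β) (Pi₂ n) + MCLR.cols (V₂ n ω *ᵥ β + u n ω) (V₂ n ω) :=
    fun n ω ↦ MCLR.cols_eq_add _ _ _ _ _ _ (hy₁ n ω) (hY₂ n ω)
  simp_rw [hdata]
  rw [Metric.tendsto_nhds]
  intro ε hε
  obtain ⟨η, hη, hηε, hηa, hηa'⟩ : ∃ η : ℝ, 0 < η ∧ 5 * η < ε ∧ η < a ∧ η < 1 - a := by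
    refine ⟨min (ε / 10) (min (a / 2) ((1 - a) / 2)), ?_, ?_, ?_, ?_⟩
    · have : 0 < 1 - a := by linarith
      positivity
    · linarith [min_le_left (ε / 10) (min (a / 2) ((1 - a) / 2))]
    · linarith [min_le_right (ε / 10) (min (a / 2) ((1 - a) / 2)),
        min_le_left (a / 2) ((1 - a) / 2)]
    · linarith [min_le_right (ε / 10) (min (a / 2) ((1 - a) / 2)),
        min_le_right (a / 2) ((1 - a) / 2)]
  obtain ⟨C, m₀, hC, hrej⟩ := MCLR.exists_rejection_bound hΩ β ha₀.le ha₁.le hη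
  rcases hμ with ⟨⟨κ, hκ0, hκ1, hκ⟩, hconc⟩ | hsmall
  · set q := (1 + κ) / 2 with hq
    have hq0 : 0 < q := by linarith
    have hq1 : q < 1 := by linarith
    have hκ' : 1 ≤ 1 / (1 - q) := by rw [le_div_iff₀ (by linarith)]; linarith
    obtain ⟨A, m₁, hacc⟩ := MCLR.exists_acceptable_of_strong hl hC hκ' hη hηa hηa'
    obtain ⟨L, hL⟩ := MCLR.exists_strong_bound l A hη
    have hkn := MCLR.eventually_sample_size hq1 (max m₀ m₁)
      (hκ.eventually_le_const (by linarith : κ < q))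
    filter_upwards [hk, hZ, hkn, hconc.eventually_ge_atTop L] with n hk1 hZn ⟨hlt, hm, hkm⟩ hLn
    refine lt_of_le_of_lt (hrej n (k n) (Z n) hZn hk1 hlt ((le_max_left _ _).trans hm) (Pi₂ n) (P n)
      _ (hV n) (fun T ↦ ∀ v, (k n + A * √(k n : ℝ)) * ‖v‖ ^ 2 ≤ ‖MCLR.comb T v‖ ^ 2) ?_ ?_) hηε
    · refine hacc n (k n) hk1 ((le_max_right _ _).trans hm) (hkm.trans ?_)
      -- `q / (1 - q) ≤ 1 / (1 - q) ≤ (1 / (1 - q)) ^ 2`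
      have h1 : q / (1 - q) ≤ 1 / (1 - q) := by gcongr
      have h2 : 1 / (1 - q) ≤ (1 / (1 - q)) ^ 2 := by nlinarith only [hκ']
      exact mul_le_mul_of_nonneg_right (h1.trans h2) (Nat.cast_nonneg _)
    · intro M hM
      refine hL (k n) hk1 M fun v ↦ le_trans ?_ (hM v)
      have hs : 0 < √(k n : ℝ) := Real.sqrt_pos.2 (by exact_mod_cast hk1)
      exact mul_le_mul_of_nonneg_right ((le_div_iff₀ hs).1 hLn) (sq_nonneg _)
  · obtain ⟨θ₀, hθ₀, m₁, hacc⟩ := MCLR.exists_acceptable_of_small hl hC hη hηa hηa'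
    set q := min (1 / 2) (θ₀ / 2) with hq
    have hq0 : 0 < q := by positivity
    have hq2 : q ≤ 1 / 2 := min_le_left _ _
    have hkn := MCLR.eventually_sample_size (by linarith) (max m₀ m₁)
      (hsmall.eventually_le_const hq0)
    filter_upwards [hk, hZ, hkn] with n hk1 hZn ⟨hlt, hm, hkm⟩
    refine lt_of_le_of_lt (hrej n (k n) (Z n) hZn hk1 hlt ((le_max_left _ _).trans hm) (Pi₂ n) (P n)
      _ (hV n) (fun _ ↦ True) ?_ ?_) hηε
    · refine fun T t x hT hx _ ↦ hacc n (k n) hk1 ((le_max_right _ _).trans hm) (hkm.trans ?_) T t x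
        hT hx
      refine mul_le_mul_of_nonneg_right ?_ (Nat.cast_nonneg _)
      rw [div_le_iff₀ (by linarith)]
      nlinarith only [min_le_right (1 / 2) (θ₀ / 2), hq2, hθ₀]
    · intro M _
      simp only [not_true_eq_false, Set.ofPred_false, measureReal_empty]
      exact hη.le
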